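/- Notation. All matrices are $n\times n$ with $n\ge 1$. The Hermite form of a nonsingular $A\in\mathbb Z^{n\times n}$ is the unique matrix $H=VA$, $V$ unimodular, that is upper triangular with positive diagonal entries $h_1,\dots,h_n$ and off-diagonal entries $0\le h_{ij}<h_j$ for $i<j$. The Smith form of $A$ is $S=\mathrm{diag}(s_1,\dots,s_n)$ with $s_i>0$, $s_i\mid s_{i+1}$, and $S=PAQ$ for unimodular $P,Q$; put $s:=s_n$ and $S^*:=sS^{-1}$. $\mathrm{Colmod}(B,S)$ (respectively $\mathrm{Rowmod}(B,S)$) is obtained from $B$ by replacing the entries of column (respectively row) $j$ by their nonnegative remainders modulo $s_j$, for every $j$. A matrix $M\in\mathbb Z^{n\times n}$ is a Smith massager for $A$ if column $j$ of $AM$ is $0$ modulo $s_j$ for every $j$, and there is a $W\in\mathbb Z^{n\times n}$ such that column $j$ of $WM-I_n$ is $0$ modulo $s_j$ for every $j$; it is reduced if $M=\mathrm{Colmod}(M,S)$. For $B\in(\mathbb Z/(s))^{n\times n}$, a matrix $T$ is a Howell form of $B$ over $\mathbb Z/(s)$ if $T=BV$ for some $V$ invertible over $\mathbb Z/(s)$;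 $T$ is upper triangular; every diagonal entry of $T$ is the class of a positive divisor of $s$ (a zero diagonal entry being represented by $s$); and, for $0\le k\le n$, the set of all vectors in the column span of $B$ whose last $k$ entries are zero equals the span of those columns of $T$ whose last $k$ entries are zero. Cost model. Bit operations are counted for a fixed program on a random access machine with integer registers and arrays under naive (quadratic) integer arithmetic: with $\lg 0=1$ and $\lg a=1+\lfloor\log_2|a|\rfloor$ for $a\ne0$, adding, comparing or right-shifting operands $a,b$ costs $\lg a+\lg b$, shifting $a$ left by $b$ bits costs $\lg a+\lg b+b$, multiplying costs $(\lg a)(\lg b)$, division with remainder costs $\lg a+\lg b+(\lg\lfloor a/b\rfloor)(\lg b)$, and accessing an array cell costs the number of bits of its two indices and of its content. The input is in memory and all other cells are initially zero. In the estimates below, $\log x$ stands for $\max(1,\log_2x)$ and $\log\log x$ for $\log(\log x)$. Theorem. There is an algorithm (one program for all inputs) that takes as input (i) a nonsingular $A\in\mathbb Z^{n\times n}$, (ii) the Smith form $S=\mathrm{diag}(s_1,\dots,s_n)$ of $A$, (iii) a reduced Smith massager $M$ for $A$, (iv) the diagonal entries $h_1,\dots,h_n$ of the Hermite form of $A$,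 and (v) a prime $p$ with $\gcd(p,s)=1$ and $\log_2 p\in\Theta(\log\log s)$, and computes a matrix $U\in\mathbb Z^{n\times n}$ with $U=\mathrm{Rowmod}(U,S)$ such that $MS^*U$ is a Howell form of $MS^*$ over $\mathbb Z/(s)$, using $$O\bigl(n(\log\det S)^2+n^2(\log\det S)(\log\log\det S)\bigr)$$ bit operations. More precisely: for all constants $c_1,c_2>0$ there is a constant $C$ such that, for every $n\ge1$ and every input with $c_1\log\log s\le\log_2p\le c_2\log\log s$, the program halts with a correct $U$ after at most $C\bigl(n(\log\det S)^2+n^2(\log\det S)(\log\log\det S)\bigr)$ bit operations. -/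

import Mathlib

/-! ### Integer matrices: Hermite form, Smith form, Smith massagers -/

namespace HermiteHowell

/-- A nonsingular (row) Hermite normal form: upper triangular, positive diagonal, entries above
the diagonal nonnegative and strictly smaller than the diagonal entry of the same column. -/
def IsHermite {n : ℕ} (H : Matrix (Fin n) (Fin n) ℤ) : Prop :=
  (∀ i j, j < i → H i j = 0) ∧ (∀ j, 0 < H j j) ∧ (∀ i j, i < j → 0 ≤ H i j ∧ H i j < H j j)

/-- `H` is the Hermite form of `A`: it is in Hermite form and `H = V * A`, `V` unimodular. -/
def IsHermiteFormOf {n : ℕ} (H A : Matrix (Fin n) (Fin n) ℤ) : Prop :=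
  IsHermite H ∧ ∃ V : Matrix (Fin n) (Fin n) ℤ, IsUnit V.det ∧ H = V * A

/-- `S` is the Smith form of the nonsingular matrix `A`: diagonal, with positive diagonal entries,
each dividing the next ones, and unimodularly equivalent to `A`. -/
def IsSmithFormOf {n : ℕ} (S A : Matrix (Fin n) (Fin n) ℤ) : Prop :=
  S.IsDiag ∧ (∀ i, 0 < S i i) ∧ (∀ i j, i ≤ j → S i i ∣ S j j) ∧
    ∃ P Q : Matrix (Fin n) (Fin n) ℤ, IsUnit P.det ∧ IsUnit Q.det ∧ S = P * A * Q

/-- Column `j` is replaced by its nonnegative remainder modulo the `j`-th diagonal entry of `S`. -/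
def colmod {n : ℕ} (B S : Matrix (Fin n) (Fin n) ℤ) : Matrix (Fin n) (Fin n) ℤ :=
  Matrix.of fun i j => B i j % S j j

/-- Row `i` is replaced by its nonnegative remainder modulo the `i`-th diagonal entry of `S`. -/
def rowmod {n : ℕ} (B S : Matrix (Fin n) (Fin n) ℤ) : Matrix (Fin n) (Fin n) ℤ :=
  Matrix.of fun i j => B i j % S i i

/-- `M` is a Smith massager for `A`, where `S` is the Smith form of `A`. -/
def IsSmithMassager {n : ℕ} (M A S : Matrix (Fin n) (Fin n) ℤ) : Prop :=
  (∀ i j, S j j ∣ (A * M) i j) ∧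
    ∃ W : Matrix (Fin n) (Fin n) ℤ, ∀ i j, S j j ∣ (W * M - 1) i j

/-- `M` is a reduced Smith massager for `A`, where `S` is the Smith form of `A`. -/
def IsReducedSmithMassager {n : ℕ} (M A S : Matrix (Fin n) (Fin n) ℤ) : Prop :=
  IsSmithMassager M A S ∧ M = colmod M S

/-- The last diagonal entry `s` of `S`. -/
def lastEntry {n : ℕ} (hn : 0 < n) (S : Matrix (Fin n) (Fin n) ℤ) : ℤ :=
  S ⟨n - 1, Nat.sub_lt hn Nat.one_pos⟩ ⟨n - 1, Nat.sub_lt hn Nat.one_pos⟩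

/-- The matrix `S* = s S⁻¹ = diag(s / s₁, …, s / sₙ)`; the divisions are exact for a Smith form. -/
def starMatrix {n : ℕ} (hn : 0 < n) (S : Matrix (Fin n) (Fin n) ℤ) : Matrix (Fin n) (Fin n) ℤ :=
  Matrix.diagonal fun i => lastEntry hn S / S i i

/-- Reduction of an integer matrix to `ℤ/(m)`. -/
def reduceMod {n : ℕ} (m : ℕ) (B : Matrix (Fin n) (Fin n) ℤ) : Matrix (Fin n) (Fin n) (ZMod m) :=
  B.map fun a => (a : ZMod m)

/-! ### Column Howell forms over `ℤ/(m)` -/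

/-- The last `k` entries of `v` are zero. -/
def LastZero {n m : ℕ} (k : ℕ) (v : Fin n → ZMod m) : Prop :=
  ∀ i : Fin n, n ≤ (i : ℕ) + k → v i = 0

/-- `Span_k(B)`: the linear combinations of the columns of `B` whose last `k` entries are zero. -/
def spanK {n m : ℕ} (k : ℕ) (B : Matrix (Fin n) (Fin n) (ZMod m)) : Set (Fin n → ZMod m) :=
  {w | (∃ v : Fin n → ZMod m, w = B.mulVec v) ∧ LastZero k w}

/-- `Span(T_k)`: the span of those columns of `T` whose last `k` entries are zero. -/
def spanCols {n m : ℕ} (k : ℕ) (T : Matrix (Fin n) (Fin n) (ZMod m)) :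
    Submodule (ZMod m) (Fin n → ZMod m) :=
  Submodule.span (ZMod m) {w | LastZero k w ∧ ∃ j, w = fun i => T i j}

/-- `T` is a (column) Howell form of `B` over `ℤ/(m)`: it is right equivalent to `B`, has the
Howell property, is upper triangular, and its diagonal entries are (the classes of) positive
divisors of `m`, a zero diagonal entry being represented by `m` itself. -/
def IsHowellFormOf {n m : ℕ} (T B : Matrix (Fin n) (Fin n) (ZMod m)) : Prop :=
  (∃ V : Matrix (Fin n) (Fin n) (ZMod m), IsUnit V.det ∧ T = B * V) ∧
    (∀ k, k ≤ n → spanK k B = (spanCols k T : Set (Fin n → ZMod m))) ∧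
    (∀ i j, j < i → T i j = 0) ∧
    (∀ i, ∃ t : ℕ, 0 < t ∧ t ∣ m ∧ T i i = (t : ZMod m))

/-! ### A random access machine on integers with naive bit cost

Programs are finite objects of a structured imperative language.  The memory consists of integer
variables and two-dimensional integer arrays.  Every instruction is charged the bit cost of
schoolbook arithmetic on its actual operands; array accesses are charged the lengths of the
address and of the transferred integer. -/

/-- Number of bits of an integer: `1` for `0`, and `1 + ⌊log₂ |a|⌋` otherwise. -/
def lg (a : ℤ) : ℕ := Nat.log 2 a.natAbs + 1

structure State where
  vars : ℕ → ℤ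
  mem : ℕ → ℤ → ℤ → ℤ

inductive Operand where
  | var (x : ℕ)
  | lit (c : ℤ)

def Operand.val (σ : State) : Operand → ℤ
  | .var x => σ.vars x
  | .lit c => c

inductive BinOp where
  | add | sub | mul | div | mod | shl | shr

/-- Values; `div` and `mod` are quotient and nonnegative remainder, and the shifts multiply
by (respectively take the floor of the quotient by) a power of two. -/
def BinOp.eval : BinOp → ℤ → ℤ → ℤ
  | .add, a, b => a + b
  | .sub, a, b => a - b
  | .mul, a, b => a * b
  | .div, a, b => a / b
  | .mod, a, b => a % b
  | .shl, a, b => a * 2 ^ b.toNat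
  | .shr, a, b => a / 2 ^ b.toNat

/-- Bit costs: linear for additions and shifts, `lg a * lg b` for products, and
`lg (a / b) * lg b` plus the lengths of the operands for division with remainder. -/
def BinOp.cost : BinOp → ℤ → ℤ → ℕ
  | .add, a, b => lg a + lg b
  | .sub, a, b => lg a + lg b
  | .mul, a, b => lg a * lg b
  | .div, a, b => lg a + lg b + lg (a / b) * lg b
  | .mod, a, b => lg a + lg b + lg (a / b) * lg b
  | .shl, a, b => lg a + lg b + b.toNat
  | .shr, a, b => lg a + lg b

inductive Test where
  | lt (a b : Operand)
  | eq (a b : Operand)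

def Test.Holds (σ : State) : Test → Prop
  | .lt a b => a.val σ < b.val σ
  | .eq a b => a.val σ = b.val σ

def Test.cost (σ : State) : Test → ℕ
  | .lt a b => lg (a.val σ) + lg (b.val σ)
  | .eq a b => lg (a.val σ) + lg (b.val σ)

inductive Cmd where
  | skip
  /-- `x := a op b` -/
  | op (x : ℕ) (o : BinOp) (a b : Operand)
  /-- `x := r[i, j]` for the array number `r` -/
  | load (x r : ℕ) (i j : Operand)
  /-- `r[i, j] := a` for the array number `r` -/
  | store (r : ℕ) (i j a : Operand)
  | seq (P Q : Cmd)
  | ite (b : Test) (P Q : Cmd)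
  | loop (b : Test) (P : Cmd)

def State.setVar (σ : State) (x : ℕ) (a : ℤ) : State :=
  { σ with vars := fun y => if y = x then a else σ.vars y }

def State.setMem (σ : State) (r : ℕ) (i j a : ℤ) : State :=
  { σ with mem := fun r' i' j' => if r' = r ∧ i' = i ∧ j' = j then a else σ.mem r' i' j' }

/-- `Exec P σ τ t`: started in state `σ`, the program `P` halts in state `τ` after `t` bit
operations. `loop b P` repeats `P` while the test `b` holds. -/
inductive Exec : Cmd → State → State → ℕ → Prop
  | skip (σ : State) : Exec .skip σ σ 1
  | op (σ : State) (x : ℕ) (o : BinOp) (a b : Operand) :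
      Exec (.op x o a b) σ (σ.setVar x (o.eval (a.val σ) (b.val σ))) (o.cost (a.val σ) (b.val σ))
  | load (σ : State) (x r : ℕ) (i j : Operand) :
      Exec (.load x r i j) σ (σ.setVar x (σ.mem r (i.val σ) (j.val σ)))
        (lg (i.val σ) + lg (j.val σ) + lg (σ.mem r (i.val σ) (j.val σ)))
  | store (σ : State) (r : ℕ) (i j a : Operand) :
      Exec (.store r i j a) σ (σ.setMem r (i.val σ) (j.val σ) (a.val σ))
        (lg (i.val σ) + lg (j.val σ) + lg (a.val σ))
  | seq (P Q : Cmd) (σ τ υ : State) (t u : ℕ) :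
      Exec P σ τ t → Exec Q τ υ u → Exec (.seq P Q) σ υ (t + u)
  | iteTrue (b : Test) (P Q : Cmd) (σ τ : State) (t : ℕ) :
      b.Holds σ → Exec P σ τ t → Exec (.ite b P Q) σ τ (b.cost σ + t)
  | iteFalse (b : Test) (P Q : Cmd) (σ τ : State) (t : ℕ) :
      ¬ b.Holds σ → Exec Q σ τ t → Exec (.ite b P Q) σ τ (b.cost σ + t)
  | loopDone (b : Test) (P : Cmd) (σ : State) :
      ¬ b.Holds σ → Exec (.loop b P) σ σ (b.cost σ)
  | loopStep (b : Test) (P : Cmd) (σ τ υ : State) (t u : ℕ) :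
      b.Holds σ → Exec P σ τ t → Exec (.loop b P) τ υ u →
        Exec (.loop b P) σ υ (b.cost σ + t + u)

/-- The machine is deterministic: final state and cost are determined by program and input. -/
theorem Exec.unique {P : Cmd} {σ τ : State} {t : ℕ} (h : Exec P σ τ t) :
    ∀ {τ' : State} {t' : ℕ}, Exec P σ τ' t' → τ' = τ ∧ t' = t := by
  induction h with
  | skip => intro τ' t' h'; cases h'; exact ⟨rfl, rfl⟩
  | op => intro τ' t' h'; cases h'; exact ⟨rfl, rfl⟩
  | load => intro τ' t' h'; cases h'; exact ⟨rfl, rfl⟩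
  | store => intro τ' t' h'; cases h'; exact ⟨rfl, rfl⟩
  | seq P Q σ τ υ t u _ _ ih1 ih2 =>
    intro τ' t' h'
    cases h' with
    | seq _ _ _ τ2 _ t2 u2 k1 k2 =>
      obtain ⟨rfl, rfl⟩ := ih1 k1
      obtain ⟨rfl, rfl⟩ := ih2 k2
      exact ⟨rfl, rfl⟩
  | iteTrue b P Q σ τ t hb _ ih =>
    intro τ' t' h'
    cases h' with
    | iteTrue _ _ _ _ _ _ _ k => obtain ⟨rfl, rfl⟩ := ih k; exact ⟨rfl, rfl⟩
    | iteFalse _ _ _ _ _ _ hb' _ => exact absurd hb hb'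
  | iteFalse b P Q σ τ t hb _ ih =>
    intro τ' t' h'
    cases h' with
    | iteTrue _ _ _ _ _ _ hb' _ => exact absurd hb' hb
    | iteFalse _ _ _ _ _ _ _ k => obtain ⟨rfl, rfl⟩ := ih k; exact ⟨rfl, rfl⟩
  | loopDone b P σ hb =>
    intro τ' t' h'
    cases h' with
    | loopDone => exact ⟨rfl, rfl⟩
    | loopStep _ _ _ _ _ _ _ hb' _ _ => exact absurd hb' hb
  | loopStep b P σ τ υ t u hb _ _ ih1 ih2 =>
    intro τ' t' h'
    cases h' with
    | loopDone _ _ _ hb' => exact absurd hb hb'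
    | loopStep _ _ _ τ2 _ t2 u2 _ k1 k2 =>
      obtain ⟨rfl, rfl⟩ := ih1 k1
      obtain ⟨rfl, rfl⟩ := ih2 k2
      exact ⟨rfl, rfl⟩

/-- The contents of an array that holds the matrix `B` (rows and columns numbered from `0`),
with zeros outside. -/
def matrixCells {n : ℕ} (B : Matrix (Fin n) (Fin n) ℤ) (i j : ℤ) : ℤ :=
  if h : i.toNat < n ∧ j.toNat < n ∧ 0 ≤ i ∧ 0 ≤ j then
    B ⟨i.toNat, h.1⟩ ⟨j.toNat, h.2.1⟩ else 0

/-- The initial state: variables `0`, `1` hold `n`, `p`; arrays `0`, `1`, `2` hold `A`, `S`, `M`;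
array `3` holds `h₁, …, hₙ` on its diagonal; everything else is zero. -/
def inputState {n : ℕ} (A S M : Matrix (Fin n) (Fin n) ℤ) (h : Fin n → ℤ) (p : ℕ) : State where
  vars := fun x => if x = 0 then (n : ℤ) else if x = 1 then (p : ℤ) else 0
  mem := fun r =>
    if r = 0 then matrixCells A
    else if r = 1 then matrixCells S
    else if r = 2 then matrixCells M
    else if r = 3 then matrixCells (Matrix.diagonal h)
    else fun _ _ => 0

/-- The output is read from array `4`. -/
def outputMatrix (n : ℕ) (τ : State) : Matrix (Fin n) (Fin n) ℤ :=
  Matrix.of fun i j => τ.mem 4 ((i : ℕ) : ℤ) ((j : ℕ) : ℤ)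

/-! ### Cost functions -/

/-- The binary logarithm, rounded up to `1` where it is smaller, as usual in `O`-estimates. -/
noncomputable def log1 (x : ℝ) : ℝ := max 1 (Real.logb 2 x)

/-- `n (log D)² + n² (log D) (log log D)`. -/
noncomputable def costBound (n : ℕ) (D : ℝ) : ℝ :=
  (n : ℝ) * log1 D ^ 2 + (n : ℝ) ^ 2 * log1 D * log1 (log1 D)

end HermiteHowell

namespace HermiteHowell

open Matrix

/-! Modulo `s` the columns of `M * S*` span the kernel of `H`. Filter this kernel by the subgroups
`kerFrom H m t` of vectors that vanish from row `t` on. Since `H` is triangular, the entry `i` of a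
vector in the step `i + 1` is killed by `h i`, so it is a multiple of `κ i = s / h i`; column `i` of
the integral matrix `s H⁻¹` attains `κ i`. Hence a matrix `M S* U` whose column `i` lies in the step
`i + 1` and has diagonal entry `κ i` is a Howell form (`isHowellFormOf_of_kerFrom`): by induction
its first `t` columns span the step `t`. The same span gives right equivalence by an invertible
matrix, because matrices over `ℤ/(m)` have stable range one.

The algorithm peels the filtration off from the last row upwards. It keeps coordinate vectors whose
combinations of the columns of `M S*` generate the step `i + 1`. The entry `i` of each generator is
an integer multiple `c j` of `κ i`. Starting from the pair `(0, h i)`, Euclid's algorithm is run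
successively against every pair `(Y j, c j)`. Each step preserves the subgroup of `E × ℤ` spanned by
all pairs; that subgroup consists of the `(y, z)` with `π y = z κ`. At the end the only nonzero
integer left is `1`, attached to the pivot vector of row `i`, and the other generators span the next
step of the filtration (`pivot_of_span_eq`, `wp_columnLoop`).

The cost rests on four facts. Coordinate `l` matters only modulo `s l`, so a vector has about `log
det S` bits. The quotients in one Euclidean run have total length `O(lg (h i))` (`euclidPot_step`),
and `∏ h i = det S`. The entry `i` is summed along the divisor chain of the `s l`, and generators
stay triangular, so evaluating one row at all generators costs about `(log det S) ^ 2`. Finally only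
the `k ≤ log₂ det S` invariant factors different from `1` take part, which turns the addressing cost
`k lg n` into `O(n log log det S)` (`mul_lg_le`). -/

/-! ### Stable range one and right equivalence over `ℤ/(m)`. -/

/-- Endomorphisms of a finite-dimensional space have stable range one. -/
theorem exists_injective_add_comp {K V : Type*} [Field K] [AddCommGroup V] [Module K V]
    [FiniteDimensional K V] (u x f : V →ₗ[K] V) (h : u ∘ₗ x + f = LinearMap.id) :
    ∃ z : V →ₗ[K] V, Function.Injective (u + f ∘ₗ z) := by
  obtain ⟨C, hC⟩ := Submodule.exists_isCompl (LinearMap.range u)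
  obtain ⟨D, hD⟩ := Submodule.exists_isCompl (LinearMap.ker u)
  have hdim : Module.finrank K (LinearMap.ker u) = Module.finrank K C := by
    have h1 := LinearMap.finrank_range_add_finrank_ker u
    have h2 := Submodule.finrank_add_eq_of_isCompl hC
    omega
  let e := LinearEquiv.ofFinrankEq _ _ hdim
  let π := Submodule.projectionOnto _ _ hD
  -- The witness projects onto `ker u` along `D` and then identifies `ker u` with a complement of
  -- `range u`. If `v` is in the kernel of the sum and `c` is its image under the witness, then `c =
  -- -u (v - x c)` lies in `C` and in `range u`, so `c = 0`; hence `v` has no component in `ker u`,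
  -- while `u v = 0`.
  refine ⟨C.subtype ∘ₗ e.toLinearMap ∘ₗ π, ?_⟩
  rw [← LinearMap.ker_eq_bot, LinearMap.ker_eq_bot']
  intro v hv
  set c : V := (e (π v) : V) with hc
  have hcC : c ∈ C := (e (π v)).2
  have hfc : f c = c - u (x c) := by
    have := LinearMap.congr_fun h c
    simp only [LinearMap.add_apply, LinearMap.comp_apply, LinearMap.id_apply] at this
    exact eq_sub_of_add_eq' this
  have hv' : u (v - x c) + c = 0 := by
    have h1 : u v + f c = 0 := hv
    rw [hfc] at h1
    rw [map_sub, ← h1]; abel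
  have hc0 : c = 0 := by
    have h1 : c ∈ LinearMap.range u := by
      have : c = u (-(v - x c)) := by rw [map_neg]; exact (neg_eq_of_add_eq_zero_right hv').symm
      exact this ▸ LinearMap.mem_range_self _ _
    exact (Submodule.disjoint_def.1 hC.disjoint) c h1 hcC
  have hπ : π v = 0 := by
    have : e (π v) = 0 := Subtype.ext hc0
    simpa using this
  have huv : u v = 0 := by
    rw [hc0] at hv'; simpa using hv'
  have := Submodule.projectionOnto_apply_left hD ⟨v, huv⟩
  change π v = _ at this
  rw [hπ] at this
  exact (congrArg Subtype.val this).symm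

theorem exists_isUnit_det_add_mul_of_field {K : Type*} [Field K] {n : ℕ}
    (U X F : Matrix (Fin n) (Fin n) K) (h : U * X + F = 1) :
    ∃ Z : Matrix (Fin n) (Fin n) K, IsUnit (U + F * Z).det := by
  obtain ⟨z, hz⟩ := exists_injective_add_comp (Matrix.toLin' U) (Matrix.toLin' X) (Matrix.toLin' F)
    (by rw [← Matrix.toLin'_mul, ← map_add, h, Matrix.toLin'_one])
  refine ⟨LinearMap.toMatrix' z, ?_⟩
  rw [← Matrix.isUnit_iff_isUnit_det, ← Matrix.mulVec_injective_iff_isUnit]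
  have e : Matrix.toLin' U + Matrix.toLin' F ∘ₗ z
      = Matrix.toLin' (U + F * LinearMap.toMatrix' z) := by
    rw [map_add, Matrix.toLin'_mul, Matrix.toLin'_toMatrix']
  rw [e] at hz
  exact hz

/-- Matrices over `ℤ/(m)` have stable range one. -/
theorem exists_isUnit_det_add_mul {m : ℕ} [NeZero m] {n : ℕ}
    (U X F : Matrix (Fin n) (Fin n) (ZMod m)) (h : U * X + F = 1) :
    ∃ Z : Matrix (Fin n) (Fin n) (ZMod m), IsUnit (U + F * Z).det := by
  classical
  -- The matrix is found over each residue field and lifted to `ℤ`, so that the lifts can be glued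
  -- by the Chinese remainder theorem. For `p` outside the prime factors of `m` the value `0` is a
  -- dummy.
  have key : ∀ p : ℕ, ∃ Z : Matrix (Fin n) (Fin n) ℤ, p ∈ m.primeFactors → ∀ hp : p ∣ m,
      IsUnit ((U.map (ZMod.castHom hp (ZMod p)) +
        F.map (ZMod.castHom hp (ZMod p)) * Z.map (Int.castRingHom (ZMod p))).det) := by
    intro p
    by_cases hp : p ∈ m.primeFactors
    · have hpp : Fact p.Prime := ⟨(Nat.mem_primeFactors.1 hp).1⟩
      have hd := (Nat.mem_primeFactors.1 hp).2.1
      obtain ⟨Z, hZ⟩ := exists_isUnit_det_add_mul_of_field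
        (U.map (ZMod.castHom hd (ZMod p))) (X.map (ZMod.castHom hd (ZMod p)))
        (F.map (ZMod.castHom hd (ZMod p))) (by
          have := congrArg (RingHom.mapMatrix (ZMod.castHom hd (ZMod p))) h
          simpa only [map_add, map_mul, map_one, RingHom.mapMatrix_apply] using this)
      refine ⟨Z.map fun a => (a.val : ℤ), fun _ _ => ?_⟩
      have e : (Z.map fun a => (a.val : ℤ)).map (Int.castRingHom (ZMod p)) = Z := by
        ext i j
        simp
      rw [e]
      exact hZ
    · exact ⟨0, fun h => absurd h hp⟩
  choose Zp hZp using key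
  have hcop : ∀ p ∈ m.primeFactors, ∀ q ∈ m.primeFactors, p ≠ q →
      IsCoprime (Ideal.span {(p : ℤ)}) (Ideal.span {(q : ℤ)}) := by
    intro p hp q hq hpq
    rw [Ideal.isCoprime_span_singleton_iff, Nat.isCoprime_iff_coprime]
    exact (Nat.coprime_primes (Nat.mem_primeFactors.1 hp).1 (Nat.mem_primeFactors.1 hq).1).2 hpq
  have crt : ∀ i j, ∃ a : ℤ, ∀ p : m.primeFactors, a - Zp p i j ∈ Ideal.span {((p : ℕ) : ℤ)} := by
    intro i j
    exact Ideal.exists_forall_sub_mem_ideal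
      (I := fun p : m.primeFactors => Ideal.span {((p : ℕ) : ℤ)})
      (fun p q hpq => hcop p p.2 q q.2 fun h => hpq (Subtype.ext h)) (fun p => Zp p i j)
  choose Z hZ using crt
  refine ⟨(Matrix.of Z).map (Int.castRingHom (ZMod m)), ?_⟩
  set D := (U + F * (Matrix.of Z).map (Int.castRingHom (ZMod m))).det with hD
  rw [← ZMod.natCast_zmod_val D, ZMod.isUnit_iff_coprime]
  -- A determinant that is no unit modulo `m` vanishes modulo some prime factor of `m`, against the
  -- choice of `Zp`.
  apply Nat.Coprime.symm
  by_contra hc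
  obtain ⟨p, hp, hpm, hpD⟩ := Nat.Prime.not_coprime_iff_dvd.1 hc
  have hpf : p ∈ m.primeFactors := Nat.mem_primeFactors.2 ⟨hp, hpm, NeZero.ne m⟩
  have hu := hZp p hpf hpm
  have hpp : Fact p.Prime := ⟨hp⟩
  have e : ((U.map (ZMod.castHom hpm (ZMod p)) +
        F.map (ZMod.castHom hpm (ZMod p)) * (Zp p).map (Int.castRingHom (ZMod p))).det)
      = ZMod.castHom hpm (ZMod p) D := by
    rw [hD, RingHom.map_det, map_add, map_mul]
    simp only [RingHom.mapMatrix_apply]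
    congr 3
    ext i j
    have := hZ i j ⟨p, hpf⟩
    rw [Ideal.mem_span_singleton] at this
    simp only [Matrix.map_apply, Matrix.of_apply, eq_intCast, map_intCast]
    exact (((ZMod.intCast_eq_intCast_iff_dvd_sub _ _ _).2 this))
  rw [e] at hu
  have : ZMod.castHom hpm (ZMod p) D = 0 := by
    rw [← ZMod.natCast_zmod_val D, map_natCast]
    exact (ZMod.natCast_eq_zero_iff _ _).2 hpD
  rw [this] at hu
  exact not_isUnit_zero hu

/-- Square matrices over `ℤ/(m)` with the same column span are right equivalent. -/
theorem exists_isUnit_det_mul_eq {m : ℕ} [NeZero m] {n : ℕ}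
    {B T U X : Matrix (Fin n) (Fin n) (ZMod m)} (hT : T = B * U) (hB : B = T * X) :
    ∃ V : Matrix (Fin n) (Fin n) (ZMod m), IsUnit V.det ∧ T = B * V := by
  -- The correction `1 - U X` is annihilated by `B`, so adding its multiples to `U` does not change
  -- `B U`.
  obtain ⟨Z, hZ⟩ := exists_isUnit_det_add_mul U X (1 - U * X) (by abel)
  refine ⟨_, hZ, ?_⟩
  have h0 : B * (1 - U * X) = 0 := by
    rw [mul_sub, mul_one, ← mul_assoc, ← hT, ← hB, sub_self]
  rw [mul_add, ← mul_assoc, h0, zero_mul, add_zero, hT]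

/-! ### The kernel of the Hermite form modulo `s`, and Howell forms of `M S*`. -/

theorem reduceMod_eq_mapMatrix {n m : ℕ} (B : Matrix (Fin n) (Fin n) ℤ) :
    reduceMod m B = (Int.castRingHom (ZMod m)).mapMatrix B := rfl

theorem reduceMod_mul {n m : ℕ} (B C : Matrix (Fin n) (Fin n) ℤ) :
    reduceMod m (B * C) = reduceMod m B * reduceMod m C := by
  simp only [reduceMod_eq_mapMatrix, map_mul]

theorem reduceMod_mulVec {n m : ℕ} (B : Matrix (Fin n) (Fin n) ℤ) (u : Fin n → ℤ) :
    reduceMod m B *ᵥ (fun i => (u i : ZMod m)) = fun i => ((B *ᵥ u) i : ZMod m) := by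
  ext i
  simp [reduceMod, Matrix.mulVec, dotProduct]

theorem exists_intCast_eq {n m : ℕ} (y : Fin n → ZMod m) :
    ∃ u : Fin n → ℤ, y = fun i => (u i : ZMod m) := by
  choose u hu using fun i => ZMod.intCast_surjective (y i)
  exact ⟨u, (funext hu).symm⟩

section Smith

variable {n : ℕ} (hn : 0 < n) {A S M H : Matrix (Fin n) (Fin n) ℤ}

theorem lastEntry_pos (hS : IsSmithFormOf S A) : 0 < lastEntry hn S := hS.2.1 _

theorem natAbs_lastEntry (hS : IsSmithFormOf S A) :
    (((lastEntry hn S).natAbs : ℕ) : ℤ) = lastEntry hn S :=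
  Int.natAbs_of_nonneg (lastEntry_pos hn hS).le

theorem neZero_lastEntry (hS : IsSmithFormOf S A) : NeZero (lastEntry hn S).natAbs :=
  ⟨Int.natAbs_ne_zero.2 (lastEntry_pos hn hS).ne'⟩

theorem dvd_lastEntry (hS : IsSmithFormOf S A) (i : Fin n) : S i i ∣ lastEntry hn S :=
  hS.2.2.1 _ _ (Fin.le_def.2 (Nat.le_sub_one_of_lt i.2))

theorem mul_div_lastEntry (hS : IsSmithFormOf S A) (i : Fin n) :
    S i i * (lastEntry hn S / S i i) = lastEntry hn S :=
  Int.mul_ediv_cancel' (dvd_lastEntry hn hS i)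

theorem mul_starMatrix_apply (B : Matrix (Fin n) (Fin n) ℤ) (i j : Fin n) :
    (B * starMatrix hn S) i j = B i j * (lastEntry hn S / S j j) := by
  simp [starMatrix]

theorem intCast_lastEntry_eq_zero (hS : IsSmithFormOf S A) :
    ((lastEntry hn S : ℤ) : ZMod (lastEntry hn S).natAbs) = 0 := by
  rw [ZMod.intCast_zmod_eq_zero_iff_dvd, natAbs_lastEntry hn hS]

theorem reduceMod_eq_zero_of_dvd (hS : IsSmithFormOf S A) {B : Matrix (Fin n) (Fin n) ℤ}
    (h : ∀ i j, lastEntry hn S ∣ B i j) : reduceMod (lastEntry hn S).natAbs B = 0 := by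
  ext i j
  have := h i j
  rw [← natAbs_lastEntry hn hS] at this
  exact (ZMod.intCast_zmod_eq_zero_iff_dvd _ _).2 this

theorem dvd_mul_starMatrix (hS : IsSmithFormOf S A) {B : Matrix (Fin n) (Fin n) ℤ}
    (h : ∀ i j, S j j ∣ B i j) (i j : Fin n) : lastEntry hn S ∣ (B * starMatrix hn S) i j := by
  rw [mul_starMatrix_apply, ← mul_div_lastEntry hn hS j]
  exact mul_dvd_mul (h i j) (by rw [mul_div_lastEntry hn hS])

/-- The columns of `M S*` are annihilated by `H` modulo `s`. -/
theorem reduceMod_hermite_mul (hS : IsSmithFormOf S A) (hM : IsSmithMassager M A S)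
    (hH : IsHermiteFormOf H A) :
    reduceMod (lastEntry hn S).natAbs H *
      reduceMod (lastEntry hn S).natAbs (M * starMatrix hn S) = 0 := by
  obtain ⟨-, V, -, rfl⟩ := hH
  rw [← reduceMod_mul, mul_assoc, reduceMod_mul, ← mul_assoc A,
    reduceMod_eq_zero_of_dvd hn hS (dvd_mul_starMatrix hn hS hM.1), mul_zero]

/-- Lift `y` to an integer vector `u` with `A u = s z`. Then `S (Q⁻¹ u) = s P z`, and division by
the diagonal matrix `S` gives `Q⁻¹ u = S* P z`. -/
theorem exists_mulVec_star_of_mulVec_eq_zero (hS : IsSmithFormOf S A)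
    {P Q : Matrix (Fin n) (Fin n) ℤ} (hQ : IsUnit Q.det)
    (hPQ : S = P * A * Q) (y : Fin n → ZMod (lastEntry hn S).natAbs)
    (hy : reduceMod (lastEntry hn S).natAbs A *ᵥ y = 0) :
    ∃ v, y = reduceMod (lastEntry hn S).natAbs (Q * starMatrix hn S) *ᵥ v := by
  obtain ⟨u, rfl⟩ := exists_intCast_eq y
  rw [reduceMod_mulVec] at hy
  have h1 : ∀ i, ∃ z, (A *ᵥ u) i = lastEntry hn S * z := by
    intro i
    have := congrFun hy i
    rw [Pi.zero_apply, ZMod.intCast_zmod_eq_zero_iff_dvd, natAbs_lastEntry hn hS] at this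
    exact this
  choose z hz using h1
  have hAu : A *ᵥ u = lastEntry hn S • z := by ext i; simp [hz]
  have hu : Q *ᵥ (Q⁻¹ *ᵥ u) = u := by
    rw [Matrix.mulVec_mulVec, Matrix.mul_nonsing_inv _ hQ, Matrix.one_mulVec]
  have hSx : S *ᵥ (Q⁻¹ *ᵥ u) = lastEntry hn S • (P *ᵥ z) := by
    conv_lhs => rw [hPQ]
    rw [← Matrix.mulVec_mulVec, hu, ← Matrix.mulVec_mulVec, hAu, Matrix.mulVec_smul]
  have hx : Q⁻¹ *ᵥ u = starMatrix hn S *ᵥ (P *ᵥ z) := by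
    ext l
    have h2 := congrFun hSx l
    have h3 : (S *ᵥ (Q⁻¹ *ᵥ u)) l = S l l * (Q⁻¹ *ᵥ u) l := by
      rw [← hS.1.diagonal_diag, Matrix.mulVec_diagonal]; simp
    rw [h3, Pi.smul_apply, smul_eq_mul, ← mul_div_lastEntry hn hS l, mul_assoc] at h2
    rw [starMatrix, Matrix.mulVec_diagonal]
    exact mul_left_cancel₀ (hS.2.1 l).ne' h2
  refine ⟨fun i => ((P *ᵥ z) i : ℤ), ?_⟩
  rw [reduceMod_mulVec, ← Matrix.mulVec_mulVec, ← hx, hu]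

/-- The columns of `M S*` span the kernel of `H` modulo `s`. -/
theorem exists_mulVec_eq_of_hermite_mulVec_eq_zero (hS : IsSmithFormOf S A)
    (hM : IsSmithMassager M A S) (hH : IsHermiteFormOf H A) :
    ∀ y : Fin n → ZMod (lastEntry hn S).natAbs, reduceMod (lastEntry hn S).natAbs H *ᵥ y = 0 →
      ∃ u, y = reduceMod (lastEntry hn S).natAbs (M * starMatrix hn S) *ᵥ u := by
  have := neZero_lastEntry hn hS
  set m := (lastEntry hn S).natAbs with hm
  intro y hy
  obtain ⟨-, V, hV, rfl⟩ := hH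
  obtain ⟨-, -, -, P, Q, hP, hQ, hPQ⟩ := id hS
  have hAy : reduceMod m A *ᵥ y = 0 := by
    have h1 : reduceMod m V⁻¹ *ᵥ (reduceMod m (V * A) *ᵥ y) = reduceMod m A *ᵥ y := by
      rw [Matrix.mulVec_mulVec, ← reduceMod_mul, ← mul_assoc, Matrix.nonsing_inv_mul _ hV, one_mul]
    rw [← h1, hy, Matrix.mulVec_zero]
  obtain ⟨v, hv⟩ := exists_mulVec_star_of_mulVec_eq_zero hn hS hQ hPQ y hAy
  obtain ⟨hAM, W, hW⟩ := hM
  have hPAM : ∀ i j, S j j ∣ (P * (A * M)) i j := fun i j => by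
    rw [Matrix.mul_apply]
    exact Finset.dvd_sum fun k _ => (hAM k j).mul_left _
  choose Y hY using hPAM
  set Z := Q⁻¹ * M with hZ
  have hSZ : S * Z = P * (A * M) := by
    rw [hZ, hPQ, mul_assoc (P * A), ← mul_assoc Q, Matrix.mul_nonsing_inv _ hQ, one_mul, mul_assoc]
  -- The massager condition says that `s j` divides column `j` of `S Z`; in terms of `S*` this means
  -- that `Z = Q⁻¹ M` maps the column span of `S*` into itself.
  have hZS : Z * starMatrix hn S = starMatrix hn S * Matrix.of Y := by
    ext i j
    have h1 : S i i * Z i j = S j j * Y i j := by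
      rw [← hY, ← hSZ, ← hS.1.diagonal_diag, Matrix.diagonal_mul]; simp
    rw [mul_starMatrix_apply, starMatrix, Matrix.diagonal_mul, Matrix.of_apply]
    apply mul_left_cancel₀ (hS.2.1 i).ne'
    apply mul_left_cancel₀ (hS.2.1 j).ne'
    have e1 := mul_div_lastEntry hn hS i
    have e2 := mul_div_lastEntry hn hS j
    calc S j j * (S i i * (Z i j * (lastEntry hn S / S j j)))
        = (S i i * Z i j) * (S j j * (lastEntry hn S / S j j)) := by ring
      _ = (S j j * Y i j) * (S i i * (lastEntry hn S / S i i)) := by rw [h1, e1, e2]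
      _ = _ := by ring
  have hWS : reduceMod m (W * Q) * (reduceMod m Z * reduceMod m (starMatrix hn S))
      = reduceMod m (starMatrix hn S) := by
    have h1 : (W * Q) * (Z * starMatrix hn S)
        = (W * M - 1) * starMatrix hn S + starMatrix hn S := by
      rw [hZ, mul_assoc W, ← mul_assoc Q, ← mul_assoc Q, Matrix.mul_nonsing_inv _ hQ, one_mul,
        sub_mul, one_mul, sub_add_cancel, mul_assoc]
    rw [← reduceMod_mul, ← reduceMod_mul, h1, reduceMod_eq_mapMatrix, map_add,
      ← reduceMod_eq_mapMatrix, ← reduceMod_eq_mapMatrix,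
      reduceMod_eq_zero_of_dvd hn hS (dvd_mul_starMatrix hn hS hW), zero_add]
  let N := LinearMap.range (reduceMod m (starMatrix hn S)).mulVecLin
  have hmap : ∀ x ∈ N, (reduceMod m Z).mulVecLin x ∈ N := by
    rintro _ ⟨x, rfl⟩
    refine ⟨reduceMod m (Matrix.of Y) *ᵥ x, ?_⟩
    simp only [Matrix.mulVecLin_apply, Matrix.mulVec_mulVec, ← reduceMod_mul, hZS]
  let φ : N →ₗ[ZMod m] N := (reduceMod m Z).mulVecLin.restrict hmap
  have hinj : Function.Injective φ := by
    rw [← LinearMap.ker_eq_bot, LinearMap.ker_eq_bot']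
    rintro ⟨_, x, rfl⟩ hx
    have h0 : reduceMod m Z *ᵥ (reduceMod m (starMatrix hn S) *ᵥ x) = 0 := congrArg Subtype.val hx
    have h1 := congrArg (fun z => reduceMod m (W * Q) *ᵥ z) h0
    simp only [Matrix.mulVec_mulVec, Matrix.mulVec_zero, hWS] at h1
    exact Subtype.ext h1
  -- The left inverse supplied by `W Q` makes `Z` injective on the finite module `N`, hence
  -- bijective. So `Q S*` and `Q Z S* = M S*` have the same column span.
  have hsurj : Function.Surjective φ := Finite.surjective_of_injective hinj
  obtain ⟨⟨_, u, rfl⟩, hu⟩ := hsurj ⟨_, v, rfl⟩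
  have hu' : reduceMod m Z *ᵥ (reduceMod m (starMatrix hn S) *ᵥ u)
      = reduceMod m (starMatrix hn S) *ᵥ v := congrArg Subtype.val hu
  refine ⟨u, ?_⟩
  have hQZ : Q * Z = M := by rw [hZ, ← mul_assoc, Matrix.mul_nonsing_inv _ hQ, one_mul]
  rw [hv, reduceMod_mul, ← Matrix.mulVec_mulVec, ← hu', Matrix.mulVec_mulVec,
    Matrix.mulVec_mulVec, mul_assoc, ← mul_assoc, ← reduceMod_mul, hQZ, ← reduceMod_mul]

/-- The matrix `s H⁻¹` is integral and upper triangular. -/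
theorem exists_hermite_mul_eq_smul_one (hS : IsSmithFormOf S A) (hH : IsHermiteFormOf H A) :
    ∃ K : Matrix (Fin n) (Fin n) ℤ, H * K = lastEntry hn S • 1 ∧ (∀ i j, j < i → K i j = 0) ∧
      ∀ i, H i i * K i i = lastEntry hn S := by
  obtain ⟨hHer, V, hV, hVA⟩ := hH
  obtain ⟨-, -, -, P, Q, hP, hQ, hPQ⟩ := id hS
  have hSS : S * starMatrix hn S = lastEntry hn S • 1 := by
    ext i j
    rw [mul_starMatrix_apply]
    by_cases h : i = j
    · subst h; simp [mul_div_lastEntry hn hS]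
    · rw [hS.1 h]; simp [h]
  have hA : A * (Q * starMatrix hn S * P) = lastEntry hn S • 1 := by
    have h1 : P * (A * (Q * starMatrix hn S * P)) = P * (lastEntry hn S • 1) := by
      calc P * (A * (Q * starMatrix hn S * P)) = (P * A * Q * starMatrix hn S) * P := by
            simp only [mul_assoc]
        _ = _ := by rw [← hPQ, hSS, Matrix.smul_mul, Matrix.mul_smul, one_mul, mul_one]
    calc _ = P⁻¹ * (P * (A * (Q * starMatrix hn S * P))) := by
          rw [← mul_assoc P⁻¹, Matrix.nonsing_inv_mul _ hP, one_mul]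
      _ = _ := by rw [h1, ← mul_assoc, Matrix.nonsing_inv_mul _ hP, one_mul]
  -- `Q S* P` is `s A⁻¹` and `H = V A`, so this is `s H⁻¹`.
  set K := Q * starMatrix hn S * P * V⁻¹ with hK
  have hHK : H * K = lastEntry hn S • 1 := by
    rw [hVA, hK, mul_assoc V, ← mul_assoc A, hA, Matrix.smul_mul, Matrix.mul_smul,
      one_mul, Matrix.mul_nonsing_inv _ hV]
  -- Back substitution from the last row upwards: `d` bounds the distance of row `i` from the
  -- bottom.
  have htri : ∀ j : Fin n, ∀ d : ℕ, ∀ i : Fin n, n - i ≤ d → j < i → K i j = 0 := by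
    intro j d
    induction d with
    | zero => intro i hi; omega
    | succ d ih =>
      intro i hi hij
      have h1 := congrFun (congrFun hHK i) j
      rw [Matrix.mul_apply, Finset.sum_eq_single i] at h1
      · rw [Matrix.smul_apply, Matrix.one_apply_ne hij.ne', smul_zero] at h1
        exact (mul_eq_zero.1 h1).resolve_left (hHer.2.1 i).ne'
      · intro l _ hl
        rcases lt_or_gt_of_ne hl with h | h
        · rw [hHer.1 _ _ h, zero_mul]
        · rw [ih l (by have : (i : ℕ) < l := h; omega) (hij.trans h), mul_zero]
      · simp
  refine ⟨K, hHK, fun i j h => htri j n i (by omega) h, fun i => ?_⟩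
  have h1 := congrFun (congrFun hHK i) i
  rw [Matrix.mul_apply, Finset.sum_eq_single i] at h1
  · simpa using h1
  · intro l _ hl
    rcases lt_or_gt_of_ne hl with h | h
    · rw [hHer.1 _ _ h, zero_mul]
    · rw [htri i n l (by omega) h, mul_zero]
  · simp

theorem hermite_dvd_lastEntry (hS : IsSmithFormOf S A) (hH : IsHermiteFormOf H A) (i : Fin n) :
    H i i ∣ lastEntry hn S := by
  obtain ⟨K, -, -, hK⟩ := exists_hermite_mul_eq_smul_one hn hS hH
  exact ⟨_, (hK i).symm⟩

/-- The vectors modulo `s` that are annihilated by `H` and vanish from row `t` on. -/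
def kerFrom (H : Matrix (Fin n) (Fin n) ℤ) (m t : ℕ) : Submodule ℤ (Fin n → ZMod m) where
  carrier := {y | reduceMod m H *ᵥ y = 0 ∧ ∀ l : Fin n, t ≤ l → y l = 0}
  add_mem' := by
    rintro a b ⟨ha, ha'⟩ ⟨hb, hb'⟩
    exact ⟨by rw [Matrix.mulVec_add, ha, hb, add_zero], fun l hl => by simp [ha' l hl, hb' l hl]⟩
  zero_mem' := ⟨Matrix.mulVec_zero _, fun _ _ => rfl⟩
  smul_mem' := by
    rintro c a ⟨ha, ha'⟩
    exact ⟨by rw [Matrix.mulVec_smul, ha, smul_zero], fun l hl => by simp [ha' l hl]⟩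

/-- The witness is column `i` of `s H⁻¹`, which `H` maps to `s` times a unit vector. -/
theorem exists_kerFrom_apply_eq (hS : IsSmithFormOf S A) (hH : IsHermiteFormOf H A) (i : Fin n) :
    ∃ y ∈ kerFrom H (lastEntry hn S).natAbs (i + 1),
      y i = ((lastEntry hn S / H i i : ℤ) : ZMod (lastEntry hn S).natAbs) := by
  obtain ⟨K, hK, htri, hd⟩ := exists_hermite_mul_eq_smul_one hn hS hH
  refine ⟨fun l => (K l i : ZMod _), ⟨?_, fun l hl => ?_⟩, ?_⟩
  · rw [reduceMod_mulVec]
    ext l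
    have h1 : (H *ᵥ fun l => K l i) l = (H * K) l i := rfl
    rw [h1, hK, Matrix.smul_apply, smul_eq_mul, Int.cast_mul, intCast_lastEntry_eq_zero hn hS]
    simp
  · change ((K l i : ℤ) : ZMod (lastEntry hn S).natAbs) = 0
    rw [htri l i (Fin.lt_def.2 (by omega)), Int.cast_zero]
  · have : lastEntry hn S / H i i = K i i := by
      rw [← hd i]; exact Int.mul_ediv_cancel_left _ (hH.1.2.1 i).ne'
    rw [this]

theorem hermite_mul_apply_eq_zero (hH : IsHermiteFormOf H A) {m : ℕ} {i : Fin n}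
    {y : Fin n → ZMod m} (hy : y ∈ kerFrom H m (i + 1)) : (H i i : ZMod m) * y i = 0 := by
  have h1 := congrFun hy.1 i
  rw [Matrix.mulVec, dotProduct, Finset.sum_eq_single i] at h1
  · exact h1
  · intro l _ hl
    rcases lt_or_gt_of_ne hl with h | h
    · simp [reduceMod, hH.1.1 _ _ h]
    · rw [hy.2 l (by have : (i : ℕ) < l := h; omega), mul_zero]
  · simp

/-- The diagonal entries of the Hermite form are the pivots of the kernel of `H` modulo `s`. -/
theorem exists_apply_eq_mul (hS : IsSmithFormOf S A) (hH : IsHermiteFormOf H A) {i : Fin n}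
    {y : Fin n → ZMod (lastEntry hn S).natAbs}
    (hy : y ∈ kerFrom H (lastEntry hn S).natAbs (i + 1)) :
    ∃ c : ℤ, y i = ((c * (lastEntry hn S / H i i) : ℤ) : ZMod (lastEntry hn S).natAbs) := by
  have h1 := hermite_mul_apply_eq_zero hH hy
  obtain ⟨v, hv⟩ := ZMod.intCast_surjective (y i)
  rw [← hv, ← Int.cast_mul, ZMod.intCast_zmod_eq_zero_iff_dvd, natAbs_lastEntry hn hS] at h1
  obtain ⟨k, hk⟩ := hermite_dvd_lastEntry hn hS hH i
  have hpos := (hH.1.2.1 i).ne'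
  rw [hk] at h1
  obtain ⟨c, hc⟩ := (mul_dvd_mul_iff_left hpos).1 h1
  refine ⟨c, ?_⟩
  rw [← hv, hk, Int.mul_ediv_cancel_left _ hpos, hc, mul_comm k]

/-- A triangular matrix with the right pivots whose columns lie in the kernel of `H` modulo `s`
is a Howell form of `M S*`. -/
theorem isHowellFormOf_of_kerFrom (hS : IsSmithFormOf S A) (hM : IsSmithMassager M A S)
    (hH : IsHermiteFormOf H A) (U : Matrix (Fin n) (Fin n) ℤ)
    (hker : ∀ i : Fin n, (fun l => reduceMod (lastEntry hn S).natAbs (M * starMatrix hn S * U) l i)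
      ∈ kerFrom H (lastEntry hn S).natAbs (i + 1))
    (hdiag : ∀ i : Fin n, reduceMod (lastEntry hn S).natAbs (M * starMatrix hn S * U) i i
      = ((lastEntry hn S / H i i : ℤ) : ZMod (lastEntry hn S).natAbs)) :
    IsHowellFormOf (reduceMod (lastEntry hn S).natAbs (M * starMatrix hn S * U))
      (reduceMod (lastEntry hn S).natAbs (M * starMatrix hn S)) := by
  have := neZero_lastEntry hn hS
  set m := (lastEntry hn S).natAbs with hm
  set T := reduceMod m (M * starMatrix hn S * U) with hT
  set B := reduceMod m (M * starMatrix hn S) with hB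
  have hTB : T = B * reduceMod m U := by rw [hT, hB, ← reduceMod_mul]
  -- Once column `t` has cleared the entry `t`, what is left of a vector in the step `t + 1` lies in
  -- the step `t`.
  have hsub : ∀ t : ℕ, t ≤ n → ∀ y ∈ kerFrom H m t,
      y ∈ Submodule.span (ZMod m) {w | ∃ j : Fin n, (j : ℕ) < t ∧ w = fun i => T i j} := by
    intro t
    induction t with
    | zero =>
      intro _ y hy
      have : y = 0 := funext fun l => hy.2 l (Nat.zero_le _)
      rw [this]
      exact Submodule.zero_mem _
    | succ t ih =>
      intro ht y hy
      obtain ⟨c, hc⟩ := exists_apply_eq_mul hn hS hH (i := ⟨t, ht⟩) hy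
      have hk := hker ⟨t, ht⟩
      have hy' : y - c • (fun l => T l ⟨t, ht⟩) ∈ kerFrom H m t := by
        have h1 : y - c • (fun l => T l ⟨t, ht⟩) ∈ kerFrom H m (t + 1) :=
          Submodule.sub_mem _ hy (Submodule.smul_mem _ _ hk)
        refine ⟨h1.1, fun l hl => ?_⟩
        rcases hl.eq_or_lt with h | h
        · have hl' : l = ⟨t, ht⟩ := Fin.ext h.symm
          subst hl'
          rw [Pi.sub_apply, Pi.smul_apply, hc, hdiag, zsmul_eq_mul, Int.cast_mul, sub_self]
        · exact h1.2 l h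
      have h2 : y = (y - c • (fun l => T l ⟨t, ht⟩)) + (c : ZMod m) • (fun l => T l ⟨t, ht⟩) := by
        ext l; simp
      rw [h2]
      refine Submodule.add_mem _ (Submodule.span_mono ?_ (ih (by omega) _ hy')) ?_
      · rintro w ⟨j, hj, rfl⟩
        exact ⟨j, by omega, rfl⟩
      · exact Submodule.smul_mem _ _ (Submodule.subset_span ⟨⟨t, ht⟩, Nat.lt_succ_self t, rfl⟩)
  have hrange : ∀ u, reduceMod m H *ᵥ (B *ᵥ u) = 0 := fun u => by
    rw [Matrix.mulVec_mulVec, reduceMod_hermite_mul hn hS hM hH, Matrix.zero_mulVec]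
  have hspanB : ∀ w ∈ Submodule.span (ZMod m) {w | ∃ j : Fin n, w = fun i => T i j},
      ∃ v, w = T *ᵥ v := by
    intro w hw
    have : Submodule.span (ZMod m) {w | ∃ j : Fin n, w = fun i => T i j}
        ≤ LinearMap.range T.mulVecLin := by
      rw [Submodule.span_le]
      rintro _ ⟨j, rfl⟩
      exact ⟨Pi.single j 1, by ext i; simp⟩
    obtain ⟨v, hv⟩ := this hw
    exact ⟨v, hv.symm⟩
  refine ⟨?_, ?_, ?_, ?_⟩
  · have hX : ∀ j, ∃ v, (fun i => B i j) = T *ᵥ v := by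
      intro j
      apply hspanB
      have h1 : (fun i => B i j) = B *ᵥ Pi.single j 1 := by ext i; simp
      refine Submodule.span_mono ?_ (hsub n le_rfl _ ⟨?_, fun l hl => absurd l.2 (by omega)⟩)
      · rintro w ⟨j, -, rfl⟩
        exact ⟨j, rfl⟩
      · rw [h1]; exact hrange _
    choose X hX using hX
    -- The columns of `T` and of `B` span the same module, so stable range one applies.
    refine exists_isUnit_det_mul_eq hTB (X := (Matrix.of X)ᵀ) ?_
    ext i j
    exact congrFun (hX j) i
  · intro k hk
    ext w
    constructor
    · rintro ⟨⟨v, rfl⟩, hz⟩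
      have h1 := hsub (n - k) (by omega) (B *ᵥ v) ⟨hrange v, fun l hl => hz l (by omega)⟩
      refine Submodule.span_mono ?_ h1
      rintro w ⟨j, hj, rfl⟩
      exact ⟨fun i hi => (hker j).2 i (by omega), j, rfl⟩
    · intro hw
      refine Submodule.span_induction (p := fun w _ => w ∈ spanK k B) ?_ ?_ ?_ ?_ hw
      · rintro _ ⟨hz, j, rfl⟩
        refine ⟨⟨reduceMod m U *ᵥ Pi.single j 1, ?_⟩, hz⟩
        rw [Matrix.mulVec_mulVec, ← hTB]
        ext i; simp
      · exact ⟨⟨0, (Matrix.mulVec_zero _).symm⟩, fun _ _ => rfl⟩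
      · rintro _ _ _ _ ⟨⟨v, rfl⟩, hv⟩ ⟨⟨v', rfl⟩, hv'⟩
        exact ⟨⟨v + v', (Matrix.mulVec_add _ _ _).symm⟩, fun i hi => by simp [hv i hi, hv' i hi]⟩
      · rintro a _ _ ⟨⟨v, rfl⟩, hv⟩
        exact ⟨⟨a • v, (Matrix.mulVec_smul _ _ _).symm⟩, fun i hi => by simp [hv i hi]⟩
  · intro i j hji
    exact (hker j).2 i hji
  · intro i
    obtain ⟨k, hk⟩ := hermite_dvd_lastEntry hn hS hH i
    have hHpos := hH.1.2.1 i
    have hkpos : 0 < k := by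
      have := lastEntry_pos hn hS
      rw [hk] at this
      exact (pos_iff_pos_of_mul_pos this).1 hHpos
    refine ⟨k.natAbs, Int.natAbs_pos.2 hkpos.ne', ?_, ?_⟩
    · rw [hm]; exact Int.natAbs_dvd_natAbs.2 ⟨H i i, by rw [hk, mul_comm]⟩
    · rw [hdiag, hk, Int.mul_ediv_cancel_left _ hHpos.ne', ← Int.cast_natCast,
        Int.natAbs_of_nonneg hkpos.le]

theorem det_smith_eq_prod (hS : IsSmithFormOf S A) : S.det = ∏ i, S i i := by
  conv_lhs => rw [← hS.1.diagonal_diag]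
  rw [Matrix.det_diagonal]; rfl

/-- The determinant of the Smith form in terms of the Hermite form. -/
theorem det_smith_eq_prod_hermite (hS : IsSmithFormOf S A) (hH : IsHermiteFormOf H A) :
    S.det = ∏ i, H i i := by
  obtain ⟨hHer, V, hV, hVA⟩ := hH
  have h2 := det_smith_eq_prod hS
  obtain ⟨hdiag, hpos, -, P, Q, hP, hQ, hPQ⟩ := hS
  have h1 : H.det = ∏ i, H i i :=
    Matrix.det_of_isUpperTriangular fun i j hij => hHer.1 i j hij
  have hSpos : 0 < S.det := h2 ▸ Finset.prod_pos fun i _ => hpos i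
  have hHpos : 0 < H.det := h1 ▸ Finset.prod_pos fun i _ => hHer.2.1 i
  rw [← h1]
  have e1 : S.det.natAbs = A.det.natAbs := by
    rw [hPQ, Matrix.det_mul, Matrix.det_mul, Int.natAbs_mul, Int.natAbs_mul,
      Int.isUnit_iff_natAbs_eq.1 hP, Int.isUnit_iff_natAbs_eq.1 hQ, one_mul, mul_one]
  have e2 : H.det.natAbs = A.det.natAbs := by
    rw [hVA, Matrix.det_mul, Int.natAbs_mul, Int.isUnit_iff_natAbs_eq.1 hV, one_mul]
  omega

end Smith

/-! ### Subgroups of `E × ℤ` under Euclidean steps. -/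

section Span

variable {E : Type*} [AddCommGroup E]

theorem span_pair_euclid (x y : E) (q : ℤ) :
    Submodule.span ℤ {x, y} = Submodule.span ℤ {y, x - q • y} := by
  apply le_antisymm
  · rw [Submodule.span_le, Set.insert_subset_iff, Set.singleton_subset_iff]
    refine ⟨Submodule.mem_span_pair.2 ⟨q, 1, by simp⟩, Submodule.subset_span (by simp)⟩
  · rw [Submodule.span_le, Set.insert_subset_iff, Set.singleton_subset_iff]
    refine ⟨Submodule.subset_span (by simp), Submodule.mem_span_pair.2 ⟨1, -q, ?_⟩⟩
    rw [one_smul, neg_smul, sub_eq_add_neg]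

/-- Localises the effect of a Euclidean run: only the distinguished generator and the one with index
`j` change, so it suffices to compare the spans of these two. -/
theorem span_insert_image_congr {x x' : E} {Z Z' : ℕ → E} {I : Set ℕ} {j : ℕ} (hj : j ∈ I)
    (h : Submodule.span ℤ {x, Z j} = Submodule.span ℤ {x', Z' j})
    (hoff : ∀ k ∈ I, k ≠ j → Z k = Z' k) :
    Submodule.span ℤ (insert x (Z '' I)) = Submodule.span ℤ (insert x' (Z' '' I)) := by
  have split : ∀ (x : E) (Z : ℕ → E), insert x (Z '' I) = {x, Z j} ∪ Z '' (I \ {j}) := by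
    intro x Z
    conv_lhs => rw [← Set.insert_sdiff_self_of_mem hj, Set.image_insert_eq]
    ext y
    simp only [Set.mem_insert_iff, Set.mem_union, Set.mem_singleton_iff]
    tauto
  have himg : Z '' (I \ {j}) = Z' '' (I \ {j}) :=
    Set.image_congr fun k hk => hoff k hk.1 hk.2
  rw [split, split, Submodule.span_union, Submodule.span_union, h, himg]

/-- If the pairs `(Y j, 0)` and `(w, g)` span the same subgroup as the pairs `(Y₀ j, c j)` and
`(0, h)`, where `c j` is the value of a functional at `Y₀ j` in units of `m / h`, then `w` is a
pivot element and the `Y j` span the kernel of the functional. -/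
theorem pivot_of_span_eq {m : ℕ} (π : E →+ ZMod m) {h κ : ℤ} (hm : h * κ = m) (hκ : 0 < κ)
    {I : Set ℕ} {Y₀ Y : ℕ → E} {c : ℕ → ℤ} {w : E} {g : ℤ} (hg : 0 ≤ g)
    (hc : ∀ j ∈ I, π (Y₀ j) = ((c j * κ : ℤ) : ZMod m))
    (hN : ∃ y ∈ Submodule.span ℤ (Y₀ '' I), π y = (κ : ZMod m))
    (hP : Submodule.span ℤ (insert (w, g) ((fun j => (Y j, (0 : ℤ))) '' I)) =
      Submodule.span ℤ (insert ((0 : E), h) ((fun j => (Y₀ j, c j)) '' I))) :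
    w ∈ Submodule.span ℤ (Y₀ '' I) ∧ π w = (κ : ZMod m) ∧
      ∀ y, y ∈ Submodule.span ℤ (Y '' I) ↔ y ∈ Submodule.span ℤ (Y₀ '' I) ∧ π y = 0 := by
  set P := Submodule.span ℤ (insert ((0 : E), h) ((fun j => (Y₀ j, c j)) '' I)) with hPdef
  have h1 : ∀ z ∈ P, z.1 ∈ Submodule.span ℤ (Y₀ '' I) ∧ π z.1 = ((z.2 * κ : ℤ) : ZMod m) := by
    intro z hz
    refine Submodule.span_induction (p := fun z _ => z.1 ∈ Submodule.span ℤ (Y₀ '' I) ∧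
      π z.1 = ((z.2 * κ : ℤ) : ZMod m)) ?_ ?_ ?_ ?_ hz
    · rintro z (rfl | ⟨j, hj, rfl⟩)
      · refine ⟨Submodule.zero_mem _, ?_⟩
        change π 0 = ((h * κ : ℤ) : ZMod m)
        rw [map_zero, hm, Int.cast_natCast, ZMod.natCast_self]
      · exact ⟨Submodule.subset_span ⟨j, hj, rfl⟩, hc j hj⟩
    · exact ⟨Submodule.zero_mem _, by simp⟩
    · rintro x y _ _ ⟨hx, hx'⟩ ⟨hy, hy'⟩
      refine ⟨Submodule.add_mem _ hx hy, ?_⟩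
      rw [Prod.fst_add, map_add, hx', hy', Prod.snd_add, add_mul, Int.cast_add]
    · rintro a x _ ⟨hx, hx'⟩
      refine ⟨Submodule.smul_mem _ _ hx, ?_⟩
      rw [Prod.smul_fst, map_zsmul, hx', Prod.smul_snd, zsmul_eq_mul, smul_eq_mul, mul_assoc,
        ← Int.cast_mul]
  have h2 : ∀ y ∈ Submodule.span ℤ (Y₀ '' I), ∃ z, (y, z) ∈ P := by
    intro y hy
    refine Submodule.span_induction (p := fun y _ => ∃ z, (y, z) ∈ P) ?_ ?_ ?_ ?_ hy
    · rintro _ ⟨j, hj, rfl⟩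
      exact ⟨c j, Submodule.subset_span (Or.inr ⟨j, hj, rfl⟩)⟩
    · exact ⟨0, Submodule.zero_mem _⟩
    · rintro x y _ _ ⟨z, hz⟩ ⟨z', hz'⟩
      exact ⟨z + z', Submodule.add_mem _ hz hz'⟩
    · rintro a x _ ⟨z, hz⟩
      exact ⟨a • z, Submodule.smul_mem _ a hz⟩
  -- The functional determines the integer component only modulo `h`, because `m = h κ`; the
  -- generator `(0, h)` absorbs this ambiguity.
  have h3 : ∀ y ∈ Submodule.span ℤ (Y₀ '' I), ∀ z : ℤ, π y = ((z * κ : ℤ) : ZMod m) →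
      (y, z) ∈ P := by
    intro y hy z hz
    obtain ⟨z', hz'⟩ := h2 y hy
    have e := (h1 _ hz').2
    change π y = _ at e
    rw [hz, ZMod.intCast_eq_intCast_iff_dvd_sub] at e
    change (m : ℤ) ∣ z' * κ - z * κ at e
    rw [← sub_mul, ← hm, mul_dvd_mul_iff_right hκ.ne'] at e
    obtain ⟨a, ha⟩ := e
    have : (y, z) = (y, z') - a • ((0 : E), h) := by
      ext
      · simp
      · simp only [Prod.snd_sub, Prod.smul_snd, smul_eq_mul]; linarith
    rw [this]
    exact Submodule.sub_mem _ hz' (Submodule.smul_mem _ _ (Submodule.subset_span (Or.inl rfl)))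
  have h4 : Submodule.span ℤ ((fun j => (Y j, (0 : ℤ))) '' I)
      = (Submodule.span ℤ (Y '' I)).map (LinearMap.inl ℤ E ℤ) := by
    rw [Submodule.map_span, Set.image_image]; rfl
  have h5 : ∀ z ∈ P, ∃ a : ℤ, ∃ y ∈ Submodule.span ℤ (Y '' I), z = a • (w, g) + (y, 0) := by
    intro z hz
    rw [← hP, Submodule.mem_span_insert, h4] at hz
    obtain ⟨a, _, ⟨y, hy, rfl⟩, rfl⟩ := hz
    exact ⟨a, y, hy, rfl⟩
  -- All integer components in the span on the left are multiples of `g`, and `1` occurs because `κ`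
  -- is a value of the functional.
  have hg1 : g = 1 := by
    obtain ⟨y, hy, hyκ⟩ := hN
    obtain ⟨a, y', -, he⟩ := h5 _ (h3 y hy 1 (by rw [one_mul]; exact hyκ))
    have he2 := congrArg Prod.snd he
    simp only [Prod.snd_add, Prod.smul_snd, smul_eq_mul, add_zero] at he2
    exact Int.eq_one_of_dvd_one hg ⟨a, by rw [he2, mul_comm]⟩
  have hw : (w, g) ∈ P := hP ▸ Submodule.subset_span (Or.inl rfl)
  refine ⟨(h1 _ hw).1, ?_, fun y => ⟨fun hy => ?_, fun hy => ?_⟩⟩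
  · have := (h1 _ hw).2
    simpa [hg1] using this
  · have : (y, (0 : ℤ)) ∈ P := by
      rw [← hP]
      refine Submodule.span_mono (Set.subset_insert _ _) ?_
      rw [h4]
      exact ⟨y, hy, rfl⟩
    simpa using h1 _ this
  · obtain ⟨a, y', hy', he⟩ := h5 _ (h3 y hy.1 0 (by simpa using hy.2))
    have he2 := congrArg Prod.snd he
    have he1 := congrArg Prod.fst he
    simp only [Prod.snd_add, Prod.smul_snd, smul_eq_mul, add_zero, hg1, mul_one] at he2
    simp only [← he2, zero_smul, zero_add] at he1
    exact he1 ▸ hy'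

end Span

/-! ### Fractions over a divisor chain -/

/-- The entry before position `f + k` of the chain `1, s f, s (f + 1), …`. -/
def chainPrev (f : ℕ) (s : ℕ → ℤ) (k : ℕ) : ℤ := if k = 0 then 1 else s (f + k - 1)

/-- The numerator over `chainPrev f s k` of the fractional part of
`∑ b l * r l / s l`, `f ≤ l < f + k`. -/
def chainAcc (f : ℕ) (s b r : ℕ → ℤ) : ℕ → ℤ
  | 0 => 0
  | k + 1 => (chainAcc f s b r k * (s (f + k) / chainPrev f s k) + b (f + k) * r (f + k))
      % s (f + k)

theorem chainPrev_succ (f : ℕ) (s : ℕ → ℤ) (k : ℕ) : chainPrev f s (k + 1) = s (f + k) := by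
  simp [chainPrev, ← add_assoc]

theorem chainAcc_nonneg_lt {f n : ℕ} {s : ℕ → ℤ} (hs : ∀ l, f ≤ l → l < n → 0 < s l)
    (b r : ℕ → ℤ) {k : ℕ} (hk : f + k ≤ n) :
    0 ≤ chainAcc f s b r k ∧ chainAcc f s b r k < chainPrev f s k := by
  cases k with
  | zero => simp [chainAcc, chainPrev]
  | succ k =>
    rw [chainPrev_succ]
    have := hs (f + k) (by omega) (by omega)
    exact ⟨Int.emod_nonneg _ this.ne', Int.emod_lt_of_pos _ this⟩

/-- Each denominator divides the next one, so passing from `s (f + k - 1)` to `s (f + k)` multiplies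
the numerator by an integer. The remainder taken there drops a multiple of `s (f + k)`, which
becomes a multiple of `sL` after scaling by `sL / s (f + k)`. -/
theorem chainAcc_mul_modEq {f n : ℕ} {s : ℕ → ℤ} {sL : ℤ}
    (hs : ∀ l, f ≤ l → l < n → 0 < s l) (hd : ∀ l l', f ≤ l → l ≤ l' → l' < n → s l ∣ s l')
    (hL : ∀ l, f ≤ l → l < n → s l ∣ sL) (b r : ℕ → ℤ) {k : ℕ} (hk : f + k ≤ n) :
    chainAcc f s b r k * (sL / chainPrev f s k) ≡
      ∑ l ∈ Finset.Ico f (f + k), r l * (sL / s l) * b l [ZMOD sL] := by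
  induction k with
  | zero => simp [chainAcc]
  | succ k ih =>
    have ih := ih (by omega)
    rw [← add_assoc, Finset.sum_Ico_succ_top (by omega), chainPrev_succ]
    have hpos := hs (f + k) (by omega) (by omega)
    obtain ⟨e, he⟩ := hL (f + k) (by omega) (by omega)
    have hp : 0 < chainPrev f s k ∧ chainPrev f s k ∣ s (f + k) := by
      cases k with
      | zero => simp [chainPrev]
      | succ k =>
        rw [chainPrev_succ]
        exact ⟨hs _ (by omega) (by omega), hd _ _ (by omega) (by omega) (by omega)⟩
    obtain ⟨hp0, a, ha⟩ := hp
    have e1 : sL / s (f + k) = e := by rw [he]; exact Int.mul_ediv_cancel_left _ hpos.ne'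
    have e2 : s (f + k) / chainPrev f s k = a := by
      rw [ha]; exact Int.mul_ediv_cancel_left _ hp0.ne'
    have e3 : sL / chainPrev f s k = a * e := by
      rw [he, ha, mul_assoc]; exact Int.mul_ediv_cancel_left _ hp0.ne'
    rw [e3] at ih
    rw [chainAcc, e1, e2]
    set X := chainAcc f s b r k * a + b (f + k) * r (f + k) with hX
    have h1 : X % s (f + k) * e ≡ X * e [ZMOD sL] := by
      rw [he]
      exact (Int.mod_modEq X (s (f + k))).mul_right'
    refine h1.trans ?_
    have h2 : X * e = chainAcc f s b r k * (a * e) + r (f + k) * e * b (f + k) := by rw [hX]; ring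
    rw [h2]
    exact ih.add_right _

/-- Conversion of a numerator over `d` into a numerator over `h`. -/
theorem mul_ediv_spec {a d h sL κ : ℤ} (hd : 0 < d) (hdL : d ∣ sL) (hκ : h * κ = sL) (hL : 0 < sL)
    (hh : 0 < h) (ha : 0 ≤ a) (had : a < d) (hz : sL ∣ h * (a * (sL / d))) :
    0 ≤ a * h / d ∧ a * h / d < h ∧ a * h / d * κ = a * (sL / d) := by
  obtain ⟨e, he⟩ := hdL
  have e1 : sL / d = e := by rw [he]; exact Int.mul_ediv_cancel_left _ hd.ne'
  have he0 : e ≠ 0 := by rintro rfl; simp at he; omega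
  rw [e1] at hz ⊢
  have h1 : d ∣ a * h := by
    rw [he, ← mul_assoc, mul_dvd_mul_iff_right he0, mul_comm h] at hz
    exact hz
  obtain ⟨c, hc⟩ := h1
  have e2 : a * h / d = c := by rw [hc]; exact Int.mul_ediv_cancel_left _ hd.ne'
  rw [e2]
  refine ⟨?_, ?_, ?_⟩
  · have : 0 ≤ d * c := hc ▸ mul_nonneg ha hh.le
    exact nonneg_of_mul_nonneg_right this hd
  · have : d * c < d * h := hc ▸ mul_lt_mul_of_pos_right had hh
    exact lt_of_mul_lt_mul_left this hd.le
  · apply mul_left_cancel₀ (mul_ne_zero hd.ne' hh.ne')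
    calc d * h * (c * κ) = (d * c) * (h * κ) := by ring
      _ = (a * h) * (d * e) := by rw [hκ, he, ← hc]
      _ = d * h * (a * e) := by ring

/-! ### Lengths of integers -/

theorem one_le_lg (a : ℤ) : 1 ≤ lg a := Nat.le_add_left _ _

theorem lg_le_lg {a b : ℤ} (h : a.natAbs ≤ b.natAbs) : lg a ≤ lg b :=
  Nat.add_le_add_right (Nat.log_mono_right h) 1

theorem lg_le_lg_of_nonneg {a b : ℤ} (h0 : 0 ≤ a) (h : a ≤ b) : lg a ≤ lg b :=
  lg_le_lg (by omega)

theorem natAbs_lt_two_pow_lg (a : ℤ) : a.natAbs < 2 ^ lg a :=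
  Nat.lt_pow_succ_log_self (by norm_num) _

theorem lg_le_of_natAbs_lt {a : ℤ} {k : ℕ} (hk : 1 ≤ k) (h : a.natAbs < 2 ^ k) : lg a ≤ k := by
  unfold lg
  by_cases h0 : a.natAbs = 0
  · rw [h0]; simpa using hk
  · exact Nat.log_lt_of_lt_pow h0 h

theorem lg_mul_le (a b : ℤ) : lg (a * b) ≤ lg a + lg b := by
  apply lg_le_of_natAbs_lt (by have := one_le_lg a; omega)
  rw [Int.natAbs_mul, pow_add]
  exact Nat.mul_lt_mul'' (natAbs_lt_two_pow_lg a) (natAbs_lt_two_pow_lg b)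

theorem natAbs_add_lt {a b : ℤ} : a.natAbs + b.natAbs < 2 ^ (lg a + lg b) := by
  have h1 := natAbs_lt_two_pow_lg a
  have h2 := natAbs_lt_two_pow_lg b
  rw [pow_add]
  have h3 : 2 ≤ 2 ^ lg a := by
    calc 2 = 2 ^ 1 := rfl
      _ ≤ _ := Nat.pow_le_pow_right (by norm_num) (one_le_lg a)
  have h4 : 2 ≤ 2 ^ lg b := by
    calc 2 = 2 ^ 1 := rfl
      _ ≤ _ := Nat.pow_le_pow_right (by norm_num) (one_le_lg b)
  nlinarith

theorem lg_add_le (a b : ℤ) : lg (a + b) ≤ lg a + lg b :=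
  lg_le_of_natAbs_lt (by have := one_le_lg a; omega)
    (lt_of_le_of_lt (Int.natAbs_add_le a b) natAbs_add_lt)

theorem lg_sub_le (a b : ℤ) : lg (a - b) ≤ lg a + lg b :=
  lg_le_of_natAbs_lt (by have := one_le_lg a; omega)
    (lt_of_le_of_lt (Int.natAbs_sub_le a b) natAbs_add_lt)

theorem lg_zero : lg 0 = 1 := by simp [lg]

theorem lg_one : lg 1 = 1 := by simp [lg]

/-! ### Weakest preconditions -/

/-- The program `P`, started in `σ`, halts in a state and after a number of bit operations that
satisfy `Q`. -/
def Wp (P : Cmd) (σ : State) (Q : State → ℕ → Prop) : Prop :=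
  ∃ τ t, Exec P σ τ t ∧ Q τ t

theorem Wp.mono {P : Cmd} {σ : State} {Q Q' : State → ℕ → Prop} (h : Wp P σ Q)
    (hQ : ∀ τ t, Q τ t → Q' τ t) : Wp P σ Q' := by
  obtain ⟨τ, t, he, hq⟩ := h
  exact ⟨τ, t, he, hQ τ t hq⟩

theorem wp_op {σ : State} {x : ℕ} {o : BinOp} {a b : Operand} {Q : State → ℕ → Prop} :
    Wp (.op x o a b) σ Q ↔
      Q (σ.setVar x (o.eval (a.val σ) (b.val σ))) (o.cost (a.val σ) (b.val σ)) :=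
  ⟨fun ⟨_, _, he, hq⟩ => by cases he; exact hq, fun h => ⟨_, _, .op .., h⟩⟩

theorem wp_load {σ : State} {x r : ℕ} {i j : Operand} {Q : State → ℕ → Prop} :
    Wp (.load x r i j) σ Q ↔ Q (σ.setVar x (σ.mem r (i.val σ) (j.val σ)))
      (lg (i.val σ) + lg (j.val σ) + lg (σ.mem r (i.val σ) (j.val σ))) :=
  ⟨fun ⟨_, _, he, hq⟩ => by cases he; exact hq, fun h => ⟨_, _, .load .., h⟩⟩

theorem wp_store {σ : State} {r : ℕ} {i j a : Operand} {Q : State → ℕ → Prop} :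
    Wp (.store r i j a) σ Q ↔ Q (σ.setMem r (i.val σ) (j.val σ) (a.val σ))
      (lg (i.val σ) + lg (j.val σ) + lg (a.val σ)) :=
  ⟨fun ⟨_, _, he, hq⟩ => by cases he; exact hq, fun h => ⟨_, _, .store .., h⟩⟩

theorem wp_seq {P P' : Cmd} {σ : State} {Q : State → ℕ → Prop} :
    Wp (.seq P P') σ Q ↔ Wp P σ fun τ t => Wp P' τ fun υ u => Q υ (t + u) := by
  constructor
  · rintro ⟨τ, t, he, hq⟩
    cases he with
    | seq _ _ _ υ _ t u h1 h2 => exact ⟨υ, t, h1, τ, u, h2, hq⟩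
  · rintro ⟨τ, t, h1, υ, u, h2, hq⟩
    exact ⟨υ, t + u, .seq _ _ _ _ _ _ _ h1 h2, hq⟩

/-- Counting loops: `I l` is the invariant before the iteration number `l`, which costs at most
`c l`; the test costs at most `d`. -/
theorem wp_loop_count {b : Test} {P : Cmd} (I : ℕ → State → Prop) (c : ℕ → ℕ) (d : ℕ) {lo hi : ℕ}
    (hle : lo ≤ hi)
    (hstep : ∀ l σ, lo ≤ l → l < hi → I l σ →
      b.Holds σ ∧ b.cost σ ≤ d ∧ Wp P σ fun τ t => I (l + 1) τ ∧ t ≤ c l)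
    (hdone : ∀ σ, I hi σ → ¬ b.Holds σ ∧ b.cost σ ≤ d) {σ : State} (hσ : I lo σ) :
    Wp (.loop b P) σ fun τ t => I hi τ ∧ t ≤ ∑ l ∈ Finset.Ico lo hi, (c l + d) + d := by
  induction h : hi - lo generalizing lo σ with
  | zero =>
    have : lo = hi := by omega
    subst this
    obtain ⟨h1, h2⟩ := hdone σ hσ
    exact ⟨σ, _, .loopDone _ _ _ h1, hσ, by simpa using h2⟩
  | succ k ih =>
    obtain ⟨h1, h2, τ, t, h3, h4, h5⟩ := hstep lo σ le_rfl (by omega) hσ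
    obtain ⟨υ, u, h6, h7, h8⟩ := ih (by omega) (fun l σ hl => hstep l σ (by omega)) h4 (by omega)
    refine ⟨υ, _, .loopStep _ _ _ _ _ _ _ h1 h3 h6, h7, ?_⟩
    rw [Finset.sum_eq_sum_Ico_succ_bot (by omega)]
    omega

/-- A potential for the Euclidean algorithm. -/
def euclidPot (g c : ℤ) : ℕ :=
  2 * g.natAbs.size + 3 * c.natAbs.size + if g < c then 1 else 0

theorem size_le_lg (a : ℤ) : a.natAbs.size ≤ lg a := Nat.size_le.2 (natAbs_lt_two_pow_lg a)

/-- With sizes `|g|`, `|c|` and remainder `r`, the case `c ≤ g` follows from `lg (g / c) + |c| ≤ |g|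
+ 1`, `|r| + 1 ≤ |g|` and `|r| ≤ |c|`. If `g < c`, the step is a swap whose quotient `0` still has
length `1`; the indicator in the potential pays for it. -/
theorem euclidPot_step {g c : ℤ} (hg : 0 ≤ g) (hc : 0 < c) :
    lg (g / c) + euclidPot c (g % c) ≤ euclidPot g c := by
  have hr0 := Int.emod_nonneg g hc.ne'
  have hrc := Int.emod_lt_of_pos g hc
  have hdm := Int.mul_ediv_add_emod g c
  unfold euclidPot
  rw [if_neg (by omega : ¬ c < g % c)]
  have mono : ∀ {a b : ℤ}, 0 ≤ a → a ≤ b → a.natAbs.size ≤ b.natAbs.size :=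
    fun h0 h => Nat.size_le_size (by omega)
  rcases lt_or_ge g c with h | h
  · rw [if_pos h, Int.ediv_eq_zero_of_lt hg h, lg_zero, Int.emod_eq_of_lt hg h]
    have := mono hg h.le
    omega
  · rw [if_neg (by omega)]
    have hq : 1 ≤ g / c := by rw [Int.le_ediv_iff_mul_le hc]; omega
    have h1 : (g % c).natAbs.size ≤ c.natAbs.size := mono hr0 hrc.le
    have h2 : (g % c).natAbs.size + 1 ≤ g.natAbs.size := by
      -- `g` is at least `c + r`, and `r < c`.
      have hlt : 2 * (g % c) ≤ g := by nlinarith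
      have hgs : g.natAbs < 2 ^ g.natAbs.size := Nat.lt_size_self _
      have hpos : 0 < g.natAbs.size := Nat.size_pos.2 (by omega)
      obtain ⟨k, hk⟩ := Nat.exists_eq_succ_of_ne_zero hpos.ne'
      rw [hk, Nat.succ_eq_add_one]
      apply Nat.add_le_add_right
      rw [Nat.size_le]
      rw [hk, Nat.pow_succ] at hgs
      omega
    have h3 : lg (g / c) + c.natAbs.size ≤ g.natAbs.size + 1 := by
      have hgs : g.natAbs < 2 ^ g.natAbs.size := Nat.lt_size_self _
      have hcpos : 0 < c.natAbs.size := Nat.size_pos.2 (by omega)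
      have hcg := mono hc.le h
      have hc2 : 2 ^ (c.natAbs.size - 1) ≤ c.natAbs :=
        Nat.lt_size.1 (by omega)
      have : lg (g / c) ≤ g.natAbs.size + 1 - c.natAbs.size := by
        apply lg_le_of_natAbs_lt (by omega)
        by_contra hcon
        push Not at hcon
        have hmul := Nat.mul_le_mul hcon hc2
        rw [← pow_add, show g.natAbs.size + 1 - c.natAbs.size + (c.natAbs.size - 1)
          = g.natAbs.size by omega, ← Int.natAbs_mul] at hmul
        have : (g / c * c).natAbs ≤ g.natAbs := by
          have : 0 ≤ g / c * c := by positivity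
          have : g / c * c ≤ g := Int.ediv_mul_le g hc.ne'
          omega
        omega
      omega
    omega

/-- Loops that run the Euclidean algorithm on the pair `(g, c)`: if an iteration costs at most `K`
times the length of the quotient, the loop costs at most `K` times the potential. -/
theorem wp_loop_euclid {b : Test} {P : Cmd} (I : ℤ → ℤ → State → Prop) (K d : ℕ)
    (hstep : ∀ g c σ, I g c σ → 0 ≤ g → 0 < c →
      b.Holds σ ∧ Wp P σ fun τ t => I c (g % c) τ ∧ b.cost σ + t ≤ K * lg (g / c))
    (hdone : ∀ g σ, I g 0 σ → ¬ b.Holds σ ∧ b.cost σ ≤ d) {g c : ℤ} (hg : 0 ≤ g) (hc : 0 ≤ c)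
    {σ : State} (hσ : I g c σ) :
    Wp (.loop b P) σ fun τ t => (∃ g', 0 ≤ g' ∧ I g' 0 τ) ∧ t ≤ K * euclidPot g c + d := by
  induction h : c.toNat using Nat.strong_induction_on generalizing g c σ with
  | _ k ih =>
    rcases hc.eq_or_lt with h0 | hpos
    · subst h0
      obtain ⟨h1, h2⟩ := hdone g σ hσ
      exact ⟨σ, _, .loopDone _ _ _ h1, ⟨g, hg, hσ⟩, by omega⟩
    · obtain ⟨h1, τ, t, h3, h4, h5⟩ := hstep g c σ hσ hg hpos
      have hr0 := Int.emod_nonneg g hpos.ne'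
      have hrc := Int.emod_lt_of_pos g hpos
      obtain ⟨υ, u, h6, h7, h8⟩ := ih (g % c).toNat (by omega) hc hr0 h4 rfl
      refine ⟨υ, _, .loopStep _ _ _ _ _ _ _ h1 h3 h6, h7, ?_⟩
      have := Nat.mul_le_mul_left K (euclidPot_step hg hpos)
      rw [Nat.mul_add] at this
      omega

theorem euclidPot_le {g c h : ℤ} (hg : 0 ≤ g) (hgh : g ≤ h) (hc : 0 ≤ c) (hch : c ≤ h) :
    euclidPot g c ≤ 6 * lg h := by
  have h1 := (size_le_lg g).trans (lg_le_lg_of_nonneg hg hgh)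
  have h2 := (size_le_lg c).trans (lg_le_lg_of_nonneg hc hch)
  have h3 := one_le_lg h
  unfold euclidPot
  split_ifs <;> omega

/-! ### The program

Variables: `0` is `n`, `2` is the first index `f` of a nontrivial entry of `S`, `3` is the row `i`,
`4` is `h i`, `5` is the column `j`, `6` is `j + 1`, `7` and `8` are the pair of the Euclidean
algorithm, `9` is its quotient, `10` is the index `l` of the inner loops, `11` is `s l`, `12` and
`13` are auxiliary, `14` and `15` are numerator and denominator of the accumulated fraction.
Array `5` holds the generators of the current subgroup, and column `i` of array `4` the candidate
for column `i` of the result. -/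

/-- One entry of the column operation `(w, b) ← (b, w - q b)`. -/
def columnOpBody : Cmd :=
  .seq (.load 12 4 (.var 10) (.var 3)) <|
  .seq (.load 13 5 (.var 10) (.var 5)) <|
  .seq (.load 11 1 (.var 10) (.var 10)) <|
  .seq (.store 4 (.var 10) (.var 3) (.var 13)) <|
  .seq (.op 13 .mul (.var 9) (.var 13)) <|
  .seq (.op 12 .sub (.var 12) (.var 13)) <|
  .seq (.op 12 .mod (.var 12) (.var 11)) <|
  .seq (.store 5 (.var 10) (.var 5) (.var 12)) <|
  .op 10 .add (.var 10) (.lit 1)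

def columnOp : Cmd := .loop (.lt (.var 10) (.var 6)) columnOpBody

/-- One step of the Euclidean algorithm on the pair of values and the pair of columns. -/
def euclidBody : Cmd :=
  .seq (.op 9 .div (.var 7) (.var 8)) <|
  .seq (.op 12 .mod (.var 7) (.var 8)) <|
  .seq (.op 7 .add (.var 8) (.lit 0)) <|
  .seq (.op 8 .add (.var 12) (.lit 0)) <|
  .seq (.op 10 .add (.var 2) (.lit 0)) columnOp

def euclidLoop : Cmd := .loop (.lt (.lit 0) (.var 8)) euclidBody

/-- One summand of the value of row `i` at column `j`. -/
def valueBody : Cmd :=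
  .seq (.load 11 1 (.var 10) (.var 10)) <|
  .seq (.op 12 .div (.var 11) (.var 15)) <|
  .seq (.op 14 .mul (.var 14) (.var 12)) <|
  .seq (.load 12 5 (.var 10) (.var 5)) <|
  .seq (.load 13 2 (.var 3) (.var 10)) <|
  .seq (.op 12 .mul (.var 12) (.var 13)) <|
  .seq (.op 14 .add (.var 14) (.var 12)) <|
  .seq (.op 14 .mod (.var 14) (.var 11)) <|
  .seq (.op 15 .add (.var 11) (.lit 0)) <|
  .op 10 .add (.var 10) (.lit 1)

def valueLoop : Cmd := .loop (.lt (.var 10) (.var 6)) valueBody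

def columnBody : Cmd :=
  .seq (.op 6 .add (.var 5) (.lit 1)) <|
  .seq (.op 14 .add (.lit 0) (.lit 0)) <|
  .seq (.op 15 .add (.lit 1) (.lit 0)) <|
  .seq (.op 10 .add (.var 2) (.lit 0)) <|
  .seq valueLoop <|
  .seq (.op 14 .mul (.var 14) (.var 4)) <|
  .seq (.op 8 .div (.var 14) (.var 15)) <|
  .seq euclidLoop <|
  .op 5 .add (.var 6) (.lit 0)

def columnLoop : Cmd := .loop (.lt (.var 5) (.var 0)) columnBody

def rowBody : Cmd :=
  .seq (.op 3 .sub (.var 3) (.lit 1)) <|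
  .seq (.load 4 3 (.var 3) (.var 3)) <|
  .seq (.op 7 .add (.var 4) (.lit 0)) <|
  .seq (.op 5 .add (.var 2) (.lit 0)) columnLoop

def rowLoop : Cmd := .loop (.lt (.lit 0) (.var 3)) rowBody

def skipBody : Cmd :=
  .seq (.op 2 .add (.var 2) (.lit 1)) (.load 11 1 (.var 2) (.var 2))

def skipLoop : Cmd := .loop (.eq (.var 11) (.lit 1)) skipBody

def initBody : Cmd :=
  .seq (.store 5 (.var 5) (.var 5) (.lit 1)) (.op 5 .add (.var 5) (.lit 1))

def initLoop : Cmd := .loop (.lt (.var 5) (.var 0)) initBody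

def howellProgram : Cmd :=
  .seq (.load 11 1 (.var 2) (.var 2)) <|
  .seq skipLoop <|
  .seq (.op 5 .add (.var 2) (.lit 0)) <|
  .seq initLoop <|
  .seq (.op 3 .add (.var 0) (.lit 0)) rowLoop

/-! ### Specification of the loops -/

theorem setVar_vars (σ : State) (x : ℕ) (a : ℤ) (y : ℕ) :
    (σ.setVar x a).vars y = if y = x then a else σ.vars y := rfl

theorem setVar_mem (σ : State) (x : ℕ) (a : ℤ) : (σ.setVar x a).mem = σ.mem := rfl

theorem setMem_vars (σ : State) (r : ℕ) (i j a : ℤ) : (σ.setMem r i j a).vars = σ.vars := rfl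

theorem setMem_mem (σ : State) (r : ℕ) (i j a : ℤ) (r' : ℕ) (i' j' : ℤ) :
    (σ.setMem r i j a).mem r' i' j' =
      if r' = r ∧ i' = i ∧ j' = j then a else σ.mem r' i' j' := rfl

/-- The data that the program reads. -/
structure Env where
  n : ℕ
  f : ℕ
  s : ℕ → ℤ
  h : ℕ → ℤ
  M : ℕ → ℕ → ℤ

/-- Only the entries of the Smith form from `f` on are constrained; these are the ones different
from `1`. Of the divisor chain only the order matters for the cost. -/
structure Env.Valid (e : Env) : Prop where
  f_le : e.f ≤ e.n
  two_le : ∀ l, e.f ≤ l → l < e.n → 2 ≤ e.s l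
  s_mono : ∀ l l', e.f ≤ l → l ≤ l' → l' < e.n → e.s l ≤ e.s l'
  M_bound : ∀ i l, i < e.n → e.f ≤ l → l < e.n → 0 ≤ e.M i l ∧ e.M i l < e.s l
  h_pos : ∀ i, i < e.n → 0 < e.h i

/-- The state `σ` holds the data `e`. -/
structure Env.Holds (e : Env) (σ : State) : Prop where
  n_eq : σ.vars 0 = e.n
  f_eq : σ.vars 2 = e.f
  s_eq : ∀ l : ℕ, σ.mem 1 l l = e.s l
  M_eq : ∀ i l : ℕ, σ.mem 2 i l = e.M i l
  h_eq : ∀ i : ℕ, σ.mem 3 i i = e.h i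

/-- The states agree on the variables below `d`, the arrays other than `4` and `5`, and on these
arrays outside of column `i` and column `j`, respectively. -/
structure Keep (d : ℕ) (i j : ℤ) (σ τ : State) : Prop where
  vars : ∀ y < d, τ.vars y = σ.vars y
  mem : ∀ r, r ≠ 4 → r ≠ 5 → τ.mem r = σ.mem r
  mem4 : ∀ x y, y ≠ i → τ.mem 4 x y = σ.mem 4 x y
  mem5 : ∀ x y, y ≠ j → τ.mem 5 x y = σ.mem 5 x y

theorem Keep.refl (d : ℕ) (i j : ℤ) (σ : State) : Keep d i j σ σ :=
  ⟨fun _ _ => rfl, fun _ _ _ => rfl, fun _ _ _ => rfl, fun _ _ _ => rfl⟩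

theorem Keep.trans {d : ℕ} {i j : ℤ} {σ τ υ : State} (h : Keep d i j σ τ) (h' : Keep d i j τ υ) :
    Keep d i j σ υ :=
  ⟨fun y hy => (h'.vars y hy).trans (h.vars y hy),
    fun r h4 h5 => (h'.mem r h4 h5).trans (h.mem r h4 h5),
    fun x y hy => (h'.mem4 x y hy).trans (h.mem4 x y hy),
    fun x y hy => (h'.mem5 x y hy).trans (h.mem5 x y hy)⟩

theorem Keep.mono {d d' : ℕ} (hd : d' ≤ d) {i j : ℤ} {σ τ : State} (h : Keep d i j σ τ) :
    Keep d' i j σ τ :=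
  ⟨fun y hy => h.vars y (by omega), h.mem, h.mem4, h.mem5⟩

theorem Keep.setVar {d : ℕ} {i j : ℤ} {σ τ : State} (h : Keep d i j σ τ) {x : ℕ} (hx : d ≤ x)
    (a : ℤ) : Keep d i j σ (τ.setVar x a) :=
  ⟨fun y hy => (if_neg (by omega : y ≠ x)).trans (h.vars y hy), h.mem, h.mem4, h.mem5⟩

theorem Keep.setMem4 {d : ℕ} {i j : ℤ} {σ τ : State} (h : Keep d i j σ τ) (x a : ℤ) :
    Keep d i j σ (τ.setMem 4 x i a) :=
  ⟨h.vars, fun r h4 h5 => by rw [← h.mem r h4 h5]; ext u v; simp [State.setMem, h4],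
    fun u v hv => by rw [← h.mem4 u v hv]; simp [State.setMem, hv],
    fun u v hv => by rw [← h.mem5 u v hv]; simp [State.setMem]⟩

theorem Keep.setMem5 {d : ℕ} {i j : ℤ} {σ τ : State} (h : Keep d i j σ τ) (x a : ℤ) :
    Keep d i j σ (τ.setMem 5 x j a) :=
  ⟨h.vars, fun r h4 h5 => by rw [← h.mem r h4 h5]; ext u v; simp [State.setMem, h5],
    fun u v hv => by rw [← h.mem4 u v hv]; simp [State.setMem],
    fun u v hv => by rw [← h.mem5 u v hv]; simp [State.setMem, hv]⟩

theorem Env.Holds.keep {e : Env} {σ τ : State} (h : e.Holds σ) {d : ℕ} (hd : 3 ≤ d) {i j : ℤ}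
    (hk : Keep d i j σ τ) : e.Holds τ where
  n_eq := (hk.vars 0 (by omega)).trans h.n_eq
  f_eq := (hk.vars 2 (by omega)).trans h.f_eq
  s_eq l := by rw [hk.mem 1 (by decide) (by decide)]; exact h.s_eq l
  M_eq i l := by rw [hk.mem 2 (by decide) (by decide)]; exact h.M_eq i l
  h_eq i := by rw [hk.mem 3 (by decide) (by decide)]; exact h.h_eq i

/-- The vector `u` is reduced and supported in the indices `f ≤ l < k`. -/
structure Env.Red (e : Env) (k : ℕ) (u : ℕ → ℤ) : Prop where
  bound : ∀ l, e.f ≤ l → l < k → 0 ≤ u l ∧ u l < e.s l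
  supp : ∀ l, ¬ (e.f ≤ l ∧ l < k) → u l = 0

theorem lg_natCast_le {l n : ℕ} (h : l ≤ n) : lg (l : ℤ) ≤ lg (n : ℤ) := lg_le_lg (by simpa using h)

theorem lg_le_of_mem {a b : ℤ} (h : 0 ≤ a ∧ a < b) : lg a ≤ lg b := lg_le_lg_of_nonneg h.1 h.2.le

theorem Env.Red.emod {e : Env} (hv : e.Valid) {k : ℕ} (hk : k ≤ e.n) {w b : ℕ → ℤ}
    (hw : e.Red k w) (hb : e.Red k b) (q : ℤ) : e.Red k fun l => (w l - q * b l) % e.s l where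
  bound l h1 h2 := by
    have := hv.two_le l h1 (by omega)
    exact ⟨Int.emod_nonneg _ (by omega), Int.emod_lt_of_pos _ (by omega)⟩
  supp l hl := by simp [hw.supp l hl, hb.supp l hl]

theorem Env.Red.mono {e : Env} (hv : e.Valid) {k k' : ℕ} (h : k ≤ k') (hk : k' ≤ e.n) {u : ℕ → ℤ}
    (hu : e.Red k u) : e.Red k' u where
  bound l h1 h2 := by
    by_cases hl : l < k
    · exact hu.bound l h1 hl
    · rw [hu.supp l (by omega)]
      have := hv.two_le l h1 (by omega)
      omega
  supp l hl := hu.supp l (by omega)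

/-- The quotient lies between `-q` and `0`. Thus reducing `w - q b` modulo `s` costs about `lg q *
lg s`, like the product `q b`. -/
theorem lg_ediv_le {w b q s : ℤ} (hw : 0 ≤ w ∧ w < s) (hb : 0 ≤ b ∧ b < s) (hq : 0 ≤ q) :
    lg ((w - q * b) / s) ≤ lg q + 1 := by
  have hs : 0 < s := by omega
  have h1 : (w - q * b) / s ≤ 0 := by
    have : (w - q * b) / s < 1 := by
      rw [Int.ediv_lt_iff_lt_mul hs]; nlinarith [mul_nonneg hq hb.1]
    omega
  have h2 : -q ≤ (w - q * b) / s := by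
    rw [Int.le_ediv_iff_mul_le hs]; nlinarith [mul_le_mul_of_nonneg_left hb.2.le hq]
  exact (lg_le_lg (by omega)).trans (Nat.le_succ _)

/-- Both columns vanish outside the rows from `f` to `j`, so the loop over these rows performs the
operation on whole columns. Row `l` costs a product and a remainder of order `lg q * lg (s l)`, plus
addresses of length at most `lg n`. -/
theorem wp_columnOp {e : Env} (hv : e.Valid) {σ : State} (he : e.Holds σ) {i j : ℕ} (hi : i < e.n)
    (hfj : e.f ≤ j) (hj : j < e.n) (v3 : σ.vars 3 = i) (v5 : σ.vars 5 = j)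
    (v6 : σ.vars 6 = (j + 1 : ℕ)) {q : ℤ} (hq : 0 ≤ q) (v9 : σ.vars 9 = q) (v10 : σ.vars 10 = e.f)
    {w b : ℕ → ℤ} (hw : ∀ l : ℕ, σ.mem 4 l i = w l) (hb : ∀ l : ℕ, σ.mem 5 l j = b l)
    (redw : e.Red (j + 1) w) (rb : e.Red (j + 1) b) :
    Wp columnOp σ fun τ t => (Keep 10 i j σ τ ∧ (∀ l : ℕ, τ.mem 4 l i = b l) ∧
      ∀ l : ℕ, τ.mem 5 l j = (w l - q * b l) % e.s l) ∧
      t ≤ 30 * lg q * ∑ l ∈ Finset.Ico e.f (j + 1), (lg (e.s l) + lg e.n) := by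
  have main := wp_loop_count (b := .lt (.var 10) (.var 6)) (P := columnOpBody)
    (I := fun l₀ τ => Keep 10 i j σ τ ∧ τ.vars 10 = (l₀ : ℕ) ∧
      (∀ l : ℕ, τ.mem 4 l i = if l < l₀ then b l else w l) ∧
      ∀ l : ℕ, τ.mem 5 l j = if l < l₀ then (w l - q * b l) % e.s l else b l)
    (c := fun l => 20 * (lg q * (lg (e.s l) + lg e.n))) (d := 2 * lg e.n)
    (lo := e.f) (hi := j + 1) (by omega) ?step ?done (σ := σ) ?start
  case start =>
    refine ⟨Keep.refl _ _ _ _, v10, fun l => ?_, fun l => ?_⟩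
    · rw [hw]
      split_ifs with h
      · rw [redw.supp l (by omega), rb.supp l (by omega)]
      · rfl
    · rw [hb]
      split_ifs with h
      · simp [redw.supp l (by omega), rb.supp l (by omega)]
      · rfl
  case done =>
    rintro τ ⟨hk, h10, -, -⟩
    have h6 : τ.vars 6 = (j + 1 : ℕ) := by rw [hk.vars 6 (by omega), v6]
    simp only [Test.Holds, Test.cost, Operand.val, h10, h6]
    have := lg_natCast_le (show j + 1 ≤ e.n by omega)
    exact ⟨lt_irrefl _, by omega⟩
  case step =>
    rintro l τ hl1 hl2 ⟨hk, h10, h4, h5⟩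
    have h6 : τ.vars 6 = (j + 1 : ℕ) := by rw [hk.vars 6 (by omega), v6]
    have h3 : τ.vars 3 = i := by rw [hk.vars 3 (by omega), v3]
    have h5v : τ.vars 5 = j := by rw [hk.vars 5 (by omega), v5]
    have h9 : τ.vars 9 = q := by rw [hk.vars 9 (by omega), v9]
    have hs := (he.keep (by omega) hk).s_eq l
    have e4 := h4 l
    have e5 := h5 l
    rw [if_neg (lt_irrefl l)] at e4 e5
    have cl := lg_natCast_le (show l ≤ e.n by omega)
    have cj := lg_natCast_le (show j ≤ e.n by omega)
    have cj1 := lg_natCast_le (show j + 1 ≤ e.n by omega)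
    have ci := lg_natCast_le (show i ≤ e.n by omega)
    refine ⟨?_, ?_, ?_⟩
    · simp only [Test.Holds, Operand.val, h10, h6]; exact_mod_cast hl2
    · simp only [Test.cost, Operand.val, h10, h6]; omega
    · simp only [columnOpBody, wp_seq, wp_op, wp_load, wp_store, Operand.val, BinOp.eval,
        BinOp.cost]
      simp only [setVar_vars, setVar_mem, setMem_vars, setMem_mem, Nat.reduceEqDiff, if_true,
        if_false, false_and, true_and, and_true, h10, h3, h5v, h9, hs, e4, e5]
      refine ⟨⟨?_, by push_cast; rfl, fun l' => ?_, fun l' => ?_⟩, ?_⟩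
      · exact ((((((((hk.setVar (by omega) _).setVar (by omega) _).setVar (by omega) _).setMem4
          _ _).setVar (by omega) _).setVar (by omega) _).setVar (by omega) _).setMem5 _ _).setVar
          (by omega) _
      · rw [h4]
        rcases lt_trichotomy l' l with h | h | h
        · rw [if_neg (by omega), if_pos h, if_pos (by omega)]
        · subst h; simp
        · rw [if_neg (by omega), if_neg (by omega), if_neg (by omega)]
      · rw [h5]
        rcases lt_trichotomy l' l with h | h | h
        · rw [if_neg (by omega), if_pos h, if_pos (by omega)]
        · subst h; simp
        · rw [if_neg (by omega), if_neg (by omega), if_neg (by omega)]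
      · have bw := redw.bound l hl1 hl2
        have bb := rb.bound l hl1 hl2
        have c1 := lg_le_of_mem bw
        have c2 := lg_le_of_mem bb
        have c3 := lg_le_of_mem ((redw.emod hv (by omega) rb q).bound l hl1 hl2)
        have c4 := lg_mul_le q (b l)
        have c5 := lg_sub_le (w l) (q * b l)
        have c6 := Nat.mul_le_mul_right (lg (e.s l)) (lg_ediv_le bw bb hq)
        have c7 := Nat.mul_le_mul_left (lg q) c2
        have q1 := one_le_lg q
        have a1 := one_le_lg (e.s l)
        have n1 := one_le_lg e.n
        have c8 := Nat.mul_le_mul_right (lg (e.s l)) q1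
        have c9 := Nat.mul_le_mul_right (lg e.n) q1
        have c10 := Nat.mul_le_mul_left (lg q) a1
        have c11 := lg_one
        simp only [Nat.mul_add, Nat.add_mul] at c6 c7 ⊢
        omega
  refine Wp.mono main fun τ t h => ?_
  obtain ⟨⟨hk, -, h4, h5⟩, ht⟩ := h
  refine ⟨⟨hk, fun l => ?_, fun l => ?_⟩, ht.trans ?_⟩
  · rw [h4]
    split_ifs with h
    · rfl
    · rw [redw.supp l (by omega), rb.supp l (by omega)]
  · rw [h5]
    split_ifs with h
    · rfl
    · simp [redw.supp l (by omega), rb.supp l (by omega)]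
  · have q1 := one_le_lg q
    have n1 := one_le_lg e.n
    rw [mul_assoc, Finset.mul_sum, Finset.mul_sum]
    have h1 : ∀ l ∈ Finset.Ico e.f (j + 1), 20 * (lg q * (lg (e.s l) + lg e.n)) + 2 * lg e.n ≤
        22 * (lg q * (lg (e.s l) + lg e.n)) := by
      intro l _
      have := Nat.mul_le_mul_right (lg e.n) q1
      have := Nat.mul_le_mul_left (lg q) (Nat.le_add_left (lg e.n) (lg (e.s l)))
      omega
    have h2 := Finset.sum_le_sum h1
    have h3 : lg q * (lg (e.s j) + lg e.n) ≤
        ∑ l ∈ Finset.Ico e.f (j + 1), lg q * (lg (e.s l) + lg e.n) :=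
      Finset.single_le_sum (f := fun l => lg q * (lg (e.s l) + lg e.n))
        (fun _ _ => Nat.zero_le _) (Finset.mem_Ico.2 ⟨hfj, by omega⟩)
    have h4 := Nat.mul_le_mul_right (lg e.n) q1
    have h5 := Nat.mul_le_mul_left (lg q) (Nat.le_add_left (lg e.n) (lg (e.s j)))
    rw [← Finset.mul_sum] at h2 ⊢
    omega

/-- The size of the leading part of a column up to row `j`. -/
def Env.width (e : Env) (j : ℕ) : ℕ := ∑ l ∈ Finset.Ico e.f (j + 1), (lg (e.s l) + lg e.n)

theorem Env.le_width (e : Env) {j : ℕ} (hfj : e.f ≤ j) : lg (e.s j) + lg e.n ≤ e.width j :=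
  Finset.single_le_sum (f := fun l => lg (e.s l) + lg e.n)
    (fun _ _ => Nat.zero_le _) (Finset.mem_Ico.2 ⟨hfj, by omega⟩)

/-- The factor `lg q` in the cost of a column operation is charged to the Euclidean potential, so a
whole run costs about `lg h` times the width of a column, however many steps it takes. `Inv` stands
for any relation that is preserved by a step; it is later taken to be equality of spans. -/
theorem wp_euclidLoop {e : Env} (hv : e.Valid) {σ : State} (he : e.Holds σ) {i j : ℕ}
    (hi : i < e.n) (hfj : e.f ≤ j) (hj : j < e.n) (v3 : σ.vars 3 = i) (v5 : σ.vars 5 = j)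
    (v6 : σ.vars 6 = (j + 1 : ℕ)) {w b : ℕ → ℤ} {g c h : ℤ} (v7 : σ.vars 7 = g)
    (v8 : σ.vars 8 = c) (hg : 0 ≤ g) (hgh : g ≤ h) (hc : 0 ≤ c) (hch : c ≤ h)
    (hw : ∀ l : ℕ, σ.mem 4 l i = w l) (hb : ∀ l : ℕ, σ.mem 5 l j = b l)
    (redw : e.Red (j + 1) w) (rb : e.Red (j + 1) b) (Inv : (ℕ → ℤ) → ℤ → (ℕ → ℤ) → ℤ → Prop)
    (hInv : ∀ w g b c, Inv w g b c →
      Inv b c (fun l => (w l - (g / c) * b l) % e.s l) (g % c))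
    (h0 : Inv w g b c) :
    Wp euclidLoop σ fun τ t => (Keep 7 i j σ τ ∧ ∃ w' b' g', 0 ≤ g' ∧ g' ≤ h ∧ τ.vars 7 = g' ∧
      (∀ l : ℕ, τ.mem 4 l i = w' l) ∧ (∀ l : ℕ, τ.mem 5 l j = b' l) ∧ e.Red (j + 1) w' ∧
      e.Red (j + 1) b' ∧ Inv w' g' b' 0) ∧
      t ≤ 200 * ((lg h + e.width j) * lg h) := by
  have main := wp_loop_euclid (b := .lt (.lit 0) (.var 8)) (P := euclidBody)
    (I := fun g c τ => Keep 7 i j σ τ ∧ g ≤ h ∧ c ≤ h ∧ τ.vars 7 = g ∧ τ.vars 8 = c ∧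
      ∃ w b : ℕ → ℤ, (∀ l : ℕ, τ.mem 4 l i = w l) ∧ (∀ l : ℕ, τ.mem 5 l j = b l) ∧
        e.Red (j + 1) w ∧ e.Red (j + 1) b ∧ Inv w g b c)
    -- `30` per unit of quotient length for the column operation, the rest for the arithmetic on the
    -- pair itself; the potential is at most `6 * lg h`, and `31 * 6 = 186` leaves room for the last
    -- test.
    (K := 31 * (lg h + e.width j)) (d := 2) ?step ?done hg hc (σ := σ)
    ⟨Keep.refl _ _ _ _, hgh, hch, v7, v8, w, b, hw, hb, redw, rb, h0⟩
  case done =>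
    rintro g τ ⟨-, -, -, -, h8, -⟩
    simp [Test.Holds, Test.cost, Operand.val, h8, lg_zero]
  case step =>
    rintro g c τ ⟨hk, hgh, hch, h7, h8, w, b, hw, hb, redw, rb, hI⟩ hg hc
    refine ⟨by simpa [Test.Holds, Operand.val, h8] using hc, ?_⟩
    have hτ := he.keep (by omega) hk
    have h2 := hτ.f_eq
    simp only [euclidBody, wp_seq, wp_op, Operand.val, BinOp.eval, BinOp.cost, setVar_vars,
      Nat.reduceEqDiff, if_true, if_false, h7, h8, h2, add_zero, Test.cost]
    set σ' := ((((τ.setVar 9 (g / c)).setVar 12 (g % c)).setVar 7 c).setVar 8 (g % c)).setVar 10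
      (e.f : ℤ) with hσ'
    have hq : 0 ≤ g / c := Int.ediv_nonneg hg hc.le
    have hr0 := Int.emod_nonneg g hc.ne'
    have hrc := Int.emod_lt_of_pos g hc
    have hk' : Keep 7 i j τ σ' := by
      rw [hσ']
      exact (((((Keep.refl 7 i j τ).setVar (by omega) _).setVar (by omega) _).setVar
        (by omega) _).setVar (by omega) _).setVar (by omega) _
    have hkk := hk.trans hk'
    refine Wp.mono (wp_columnOp hv (he.keep (by omega) hkk) hi hfj hj
      (by rw [hkk.vars 3 (by omega), v3]) (by rw [hkk.vars 5 (by omega), v5])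
      (by rw [hkk.vars 6 (by omega), v6]) hq (by simp [hσ', setVar_vars])
      (by simp [hσ', setVar_vars]) (w := w) (b := b) (by simpa [hσ', setVar_mem] using hw)
      (by simpa [hσ', setVar_mem] using hb) redw rb) ?_
    rintro υ t ⟨⟨hK, hm4, hm5⟩, ht⟩
    refine ⟨⟨hkk.trans (hK.mono (by omega)), hch, by omega, ?_, ?_, b, _, hm4, hm5, rb,
      redw.emod hv (by omega) rb _, hInv _ _ _ _ hI⟩, ?_⟩
    · rw [hK.vars 7 (by omega)]; simp [hσ', setVar_vars]
    · rw [hK.vars 8 (by omega)]; simp [hσ', setVar_vars]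
    · change t ≤ 30 * lg (g / c) * e.width j at ht
      have c1 := lg_le_lg_of_nonneg hg hgh
      have c2 := lg_le_lg_of_nonneg hc.le hch
      have c3 := lg_le_lg_of_nonneg hr0 (hrc.le.trans hch)
      have c4 := lg_natCast_le hv.f_le
      have c5 := e.le_width hfj
      have q1 := one_le_lg (g / c)
      have h1 := one_le_lg h
      have c6 := Nat.mul_le_mul_left (lg (g / c)) c2
      have c7 := Nat.mul_le_mul_right (lg h) q1
      have c8 := Nat.mul_le_mul_right (e.width j) q1
      rw [lg_zero]
      rw [mul_assoc] at ht
      rw [mul_assoc, mul_comm (lg h + e.width j), Nat.mul_add]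
      omega
  refine Wp.mono main fun τ t hh => ?_
  obtain ⟨⟨g', hg', hk, hgh', -, h7, -, w', b', hw', hb', redw', rb', hI⟩, ht⟩ := hh
  refine ⟨⟨hk, w', b', g', hg', hgh', h7, hw', hb', redw', rb', hI⟩, ht.trans ?_⟩
  have h1 := one_le_lg h
  have h2 := Nat.mul_le_mul_left (31 * (lg h + e.width j)) (euclidPot_le hg hgh hc hch)
  have h3 : 1 ≤ (lg h + e.width j) * lg h := Nat.mul_pos (by omega) (by omega)
  have h4 : 31 * (lg h + e.width j) * (6 * lg h) = 186 * ((lg h + e.width j) * lg h) := by ring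
  omega

/-- The cost of evaluating a row at a column. -/
def Env.area (e : Env) (j : ℕ) : ℕ := ∑ l ∈ Finset.Ico e.f (j + 1), (lg (e.s l) ^ 2 + lg e.n)

theorem lg_ediv_le_lg {a b : ℤ} (ha : 0 ≤ a) (hb : 0 ≤ b) : lg (a / b) ≤ lg a :=
  lg_le_lg_of_nonneg (Int.ediv_nonneg ha hb) (Int.ediv_le_self _ ha)

/-- Accumulating along the chain keeps numerator and denominator below the current `s l`, so that a
summand costs `O(lg (s l) ^ 2)` instead of arithmetic with the last entry `s`. -/
theorem wp_valueLoop {e : Env} (hv : e.Valid) {σ : State} (he : e.Holds σ) {i j : ℕ}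
    (hi : i < e.n) (hfj : e.f ≤ j) (hj : j < e.n) (v3 : σ.vars 3 = i) (v5 : σ.vars 5 = j)
    (v6 : σ.vars 6 = (j + 1 : ℕ)) (v10 : σ.vars 10 = e.f) (v14 : σ.vars 14 = 0)
    (v15 : σ.vars 15 = 1) {b : ℕ → ℤ} (hb : ∀ l : ℕ, σ.mem 5 l j = b l) (rb : e.Red (j + 1) b) :
    Wp valueLoop σ fun τ t => (Keep 10 i j σ τ ∧ τ.mem = σ.mem ∧
      τ.vars 14 = chainAcc e.f e.s b (e.M i) (j + 1 - e.f) ∧ τ.vars 15 = e.s j) ∧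
      t ≤ 30 * e.area j := by
  have main := wp_loop_count (b := .lt (.var 10) (.var 6)) (P := valueBody)
    (I := fun l τ => Keep 10 i j σ τ ∧ τ.mem = σ.mem ∧ τ.vars 10 = (l : ℕ) ∧
      τ.vars 14 = chainAcc e.f e.s b (e.M i) (l - e.f) ∧
      τ.vars 15 = chainPrev e.f e.s (l - e.f))
    (c := fun l => 24 * (lg (e.s l) ^ 2 + lg e.n)) (d := 2 * lg e.n)
    (lo := e.f) (hi := j + 1) (by omega) ?step ?done (σ := σ)
    ⟨Keep.refl _ _ _ _, rfl, v10, by simpa [chainAcc] using v14, by simpa [chainPrev] using v15⟩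
  case done =>
    rintro τ ⟨hk, -, h10, -, -⟩
    have h6 : τ.vars 6 = (j + 1 : ℕ) := by rw [hk.vars 6 (by omega), v6]
    simp only [Test.Holds, Test.cost, Operand.val, h10, h6]
    have := lg_natCast_le (show j + 1 ≤ e.n by omega)
    exact ⟨lt_irrefl _, by omega⟩
  case step =>
    rintro l τ hl1 hl2 ⟨hk, hmem, h10, h14, h15⟩
    obtain ⟨k, rfl⟩ := Nat.exists_eq_add_of_le hl1
    rw [Nat.add_sub_cancel_left] at h14 h15
    have h6 : τ.vars 6 = (j + 1 : ℕ) := by rw [hk.vars 6 (by omega), v6]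
    have h3 : τ.vars 3 = i := by rw [hk.vars 3 (by omega), v3]
    have h5v : τ.vars 5 = j := by rw [hk.vars 5 (by omega), v5]
    have hτ := he.keep (by omega) hk
    have hs := hτ.s_eq (e.f + k)
    have hM := hτ.M_eq i (e.f + k)
    have e5 : τ.mem 5 ((e.f + k : ℕ) : ℤ) j = b (e.f + k) := by rw [hmem, hb]
    have cl := lg_natCast_le (show e.f + k ≤ e.n by omega)
    have cj := lg_natCast_le (show j ≤ e.n by omega)
    have cj1 := lg_natCast_le (show j + 1 ≤ e.n by omega)
    have ci := lg_natCast_le (show i ≤ e.n by omega)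
    refine ⟨?_, ?_, ?_⟩
    · simp only [Test.Holds, Operand.val, h10, h6]; exact_mod_cast hl2
    · simp only [Test.cost, Operand.val, h10, h6]; omega
    · simp only [valueBody, wp_seq, wp_op, wp_load, Operand.val, BinOp.eval, BinOp.cost]
      simp only [setVar_vars, setVar_mem, Nat.reduceEqDiff, if_true, if_false, h10, h3, h5v, hs,
        hM, e5, h14, h15, add_zero]
      rw [show e.f + k + 1 - e.f = k + 1 by omega, chainPrev_succ]
      refine ⟨⟨?_, hmem, by push_cast; rfl, rfl, rfl⟩, ?_⟩
      · exact (((((((((hk.setVar (by omega) _).setVar (by omega) _).setVar (by omega) _).setVar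
          (by omega) _).setVar (by omega) _).setVar (by omega) _).setVar (by omega) _).setVar
          (by omega) _).setVar (by omega) _).setVar (by omega) _
      · set s := e.s (e.f + k) with hsdef
        set p := chainPrev e.f e.s k with hp
        set y := chainAcc e.f e.s b (e.M i) k with hy
        have hs2 : 2 ≤ s := hv.two_le _ (by omega) (by omega)
        have hyb : 0 ≤ y ∧ y < p := chainAcc_nonneg_lt
          (fun l h1 h2 => lt_of_lt_of_le two_pos (hv.two_le l h1 h2)) _ _
          (by omega : e.f + k ≤ e.n)
        have hps : p ≤ s := by
          rw [hp]
          cases k with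
          | zero => simp only [chainPrev, if_true]; omega
          | succ k => rw [chainPrev_succ]; exact hv.s_mono _ _ (by omega) (by omega) (by omega)
        have bb := rb.bound _ hl1 hl2
        have bM := hv.M_bound i (e.f + k) hi (by omega) (by omega)
        have c1 := lg_le_lg_of_nonneg (a := p) (b := s) (by omega) hps
        have c2 := lg_le_lg_of_nonneg (a := y) (b := s) (by omega) (by omega)
        have c3 : lg (b (e.f + k)) ≤ lg s := lg_le_of_mem bb
        have c4 : lg (e.M i (e.f + k)) ≤ lg s := lg_le_of_mem bM
        have c5 : lg (s / p) ≤ lg s := lg_ediv_le_lg (by omega) (by omega)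
        have hr0 : 0 ≤ s / p := Int.ediv_nonneg (by omega) (by omega)
        have hX : 0 ≤ y * (s / p) + b (e.f + k) * e.M i (e.f + k) :=
          add_nonneg (mul_nonneg hyb.1 hr0) (mul_nonneg bb.1 bM.1)
        have c6 := lg_mul_le y (s / p)
        have c7 := lg_mul_le (b (e.f + k)) (e.M i (e.f + k))
        have c8 := lg_add_le (y * (s / p)) (b (e.f + k) * e.M i (e.f + k))
        have c9 := lg_ediv_le_lg hX (b := s) (by omega)
        have d1 := Nat.mul_le_mul c5 c1
        have d2 := Nat.mul_le_mul c2 c5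
        have d3 := Nat.mul_le_mul c3 c4
        -- Before the reduction the numerator is a sum of two products of factors of length at most
        -- `lg s`, so its length is at most `4 * lg s`.
        have d4 : lg ((y * (s / p) + b (e.f + k) * e.M i (e.f + k)) / s) * lg s
            ≤ 4 * (lg s * lg s) := by
          rw [← mul_assoc]; exact Nat.mul_le_mul_right _ (by omega)
        have a1 := one_le_lg s
        have n1 := one_le_lg e.n
        have a2 := Nat.mul_le_mul_left (lg s) a1
        rw [lg_zero, lg_one, pow_two]
        omega
  refine Wp.mono main fun τ t h => ?_
  obtain ⟨⟨hk, hm, -, h14, h15⟩, ht⟩ := h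
  refine ⟨⟨hk, hm, h14, ?_⟩, ht.trans ?_⟩
  · rw [h15, show j + 1 - e.f = (j - e.f) + 1 by omega, chainPrev_succ,
      show e.f + (j - e.f) = j by omega]
  · unfold Env.area
    have h1 : ∀ l ∈ Finset.Ico e.f (j + 1), 24 * (lg (e.s l) ^ 2 + lg e.n) + 2 * lg e.n ≤
        26 * (lg (e.s l) ^ 2 + lg e.n) := by
      intro l _
      omega
    have h2 := Finset.sum_le_sum h1
    have h3 : (lg (e.s j) ^ 2 + lg e.n) ≤
        ∑ l ∈ Finset.Ico e.f (j + 1), (lg (e.s l) ^ 2 + lg e.n) :=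
      Finset.single_le_sum (f := fun l => lg (e.s l) ^ 2 + lg e.n)
        (fun _ _ => Nat.zero_le _) (Finset.mem_Ico.2 ⟨hfj, by omega⟩)
    rw [← Finset.mul_sum] at h2
    omega

/-- The value of row `i` at the vector `b` in units of `1 / h i`. -/
def Env.value (e : Env) (i j : ℕ) (b : ℕ → ℤ) : ℤ :=
  chainAcc e.f e.s b (e.M i) (j + 1 - e.f) * e.h i / e.s j

theorem wp_columnBody {e : Env} (hv : e.Valid) {σ : State} (he : e.Holds σ) {i j : ℕ}
    (hi : i < e.n) (hfj : e.f ≤ j) (hj : j < e.n) (v3 : σ.vars 3 = i) (v4 : σ.vars 4 = e.h i)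
    (v5 : σ.vars 5 = j) {w b : ℕ → ℤ} {g : ℤ} (v7 : σ.vars 7 = g) (hg : 0 ≤ g) (hgh : g ≤ e.h i)
    (hc : 0 ≤ e.value i j b) (hch : e.value i j b ≤ e.h i)
    (hw : ∀ l : ℕ, σ.mem 4 l i = w l) (hb : ∀ l : ℕ, σ.mem 5 l j = b l)
    (redw : e.Red (j + 1) w) (rb : e.Red (j + 1) b) (Inv : (ℕ → ℤ) → ℤ → (ℕ → ℤ) → ℤ → Prop)
    (hInv : ∀ w g b c, Inv w g b c →
      Inv b c (fun l => (w l - (g / c) * b l) % e.s l) (g % c))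
    (h0 : Inv w g b (e.value i j b)) :
    Wp columnBody σ fun τ t => (Keep 5 i j σ τ ∧ τ.vars 5 = (j + 1 : ℕ) ∧
      ∃ w' b' g', 0 ≤ g' ∧ g' ≤ e.h i ∧ τ.vars 7 = g' ∧
      (∀ l : ℕ, τ.mem 4 l i = w' l) ∧ (∀ l : ℕ, τ.mem 5 l j = b' l) ∧ e.Red (j + 1) w' ∧
      e.Red (j + 1) b' ∧ Inv w' g' b' 0) ∧
      t ≤ 30 * e.area j + 230 * ((lg (e.h i) + e.width j) * lg (e.h i)) := by
  have h2 := he.f_eq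
  rw [columnBody]
  simp only [wp_seq, wp_op, Operand.val, BinOp.eval, BinOp.cost, setVar_vars,
      Nat.reduceEqDiff, if_true, if_false, v5, h2, add_zero]
  set σ₁ := (((σ.setVar 6 ((j : ℤ) + 1)).setVar 14 0).setVar 15 1).setVar 10 (e.f : ℤ) with hσ₁
  have hk₁ : Keep 6 i j σ σ₁ := by
    rw [hσ₁]
    exact ((((Keep.refl 6 i j σ).setVar (by omega) _).setVar (by omega) _).setVar
        (by omega) _).setVar (by omega) _
  have h61 : σ₁.vars 6 = (j + 1 : ℕ) := by simp [hσ₁, setVar_vars]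
  refine Wp.mono (wp_valueLoop hv (he.keep (by omega) hk₁) hi hfj hj
      (by rw [hk₁.vars 3 (by omega), v3]) (by rw [hk₁.vars 5 (by omega), v5])
      h61 (by simp [hσ₁, setVar_vars]) (by simp [hσ₁, setVar_vars])
      (by simp [hσ₁, setVar_vars]) (b := b) (by simpa [hσ₁, setVar_mem] using hb) rb) ?_
  rintro τ t ⟨⟨hk₂, hm₂, h14, h15⟩, ht⟩
  have hk₂' := hk₁.trans (hk₂.mono (by omega))
  have h4τ : τ.vars 4 = e.h i := by rw [hk₂'.vars 4 (by omega), v4]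
  set y := chainAcc e.f e.s b (e.M i) (j + 1 - e.f) with hy
  simp only [h14, h4τ, h15]
  set σ₃ := (τ.setVar 14 (y * e.h i)).setVar 8 (y * e.h i / e.s j) with hσ₃
  have hk₃ : Keep 8 i j τ σ₃ := by
    rw [hσ₃]
    exact ((Keep.refl 8 i j τ).setVar (by omega) _).setVar (by omega) _
  have hk₃' := hk₂'.trans (hk₃.mono (by omega))
  have hmem₃ : σ₃.mem = σ.mem := by
    rw [hσ₃, setVar_mem, setVar_mem, hm₂, hσ₁]; rfl
  refine Wp.mono (wp_euclidLoop hv (he.keep (by omega) hk₃') hi hfj hj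
      (by rw [hk₃'.vars 3 (by omega), v3]) (by rw [hk₃'.vars 5 (by omega), v5])
      (by rw [hk₃.vars 6 (by omega), hk₂.vars 6 (by omega), h61])
      (g := g) (c := e.value i j b) (h := e.h i)
      (by rw [hk₃.vars 7 (by omega), hk₂.vars 7 (by omega), hσ₁]; simpa [setVar_vars] using v7)
      (by rw [hσ₃, setVar_vars]; rfl) hg hgh hc hch (w := w) (b := b)
      (by rw [hmem₃]; exact hw) (by rw [hmem₃]; exact hb) redw rb Inv hInv h0) ?_
  rintro υ u ⟨⟨hk₄, w', b', g', hg', hgh', h7, hw', hb', redw', rb', hI⟩, hu⟩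
  have h6υ : υ.vars 6 = (j + 1 : ℕ) := by
    rw [hk₄.vars 6 (by omega), hk₃.vars 6 (by omega), hk₂.vars 6 (by omega), h61]
  refine ⟨⟨((hk₃'.trans (hk₄.mono (by omega))).mono (by omega)).setVar le_rfl _, by simpa using h6υ,
    w', b', g', hg', hgh', by simpa using h7, hw', hb', redw', rb', hI⟩, ?_⟩
  have hsj := hv.two_le j hfj hj
  have hyb : 0 ≤ y ∧ y < e.s j := by
    have := chainAcc_nonneg_lt
          (fun l h1 h2 => lt_of_lt_of_le two_pos (hv.two_le l h1 h2)) b (e.M i)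
          (by omega : e.f + (j - e.f + 1) ≤ e.n)
    rw [chainPrev_succ, show e.f + (j - e.f) = j by omega,
      show j - e.f + 1 = j + 1 - e.f by omega] at this
    exact this
  have c1 := lg_le_of_mem hyb
  have c2 := lg_mul_le y (e.h i)
  have c3 : lg (y * e.h i / e.s j) ≤ lg (e.h i) := lg_le_lg_of_nonneg hc hch
  have c4 := Nat.mul_le_mul_right (lg (e.h i)) c1
  have c5 := Nat.mul_le_mul_right (lg (e.s j)) c3
  have c6 := e.le_width hfj
  have h1 := one_le_lg (e.h i)
  have a1 := one_le_lg (e.s j)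
  have c7 := Nat.mul_le_mul_left (lg (e.s j)) h1
  have c8 := Nat.mul_le_mul_left (lg e.n) h1
  have c9 := Nat.mul_le_mul_right (lg (e.h i)) c6
  have c10 := Nat.mul_le_mul_right (lg (e.h i)) h1
  have n1 := one_le_lg e.n
  have i1 := lg_natCast_le (show j ≤ e.n by omega)
  have i2 := lg_natCast_le (show j + 1 ≤ e.n by omega)
  have i3 := lg_natCast_le hv.f_le
  have c11 := Nat.mul_le_mul_right (lg (e.h i)) n1
  rw [mul_comm (lg (e.h i)) (lg (e.s j))] at c5
  rw [Nat.add_mul] at c9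
  rw [h6υ, lg_zero, lg_one]
  simp only [Nat.add_mul] at hu ⊢
  omega

/-! ### From matrices to the data of the program. -/

theorem matrixCells_natCast {n : ℕ} (B : Matrix (Fin n) (Fin n) ℤ) (i j : Fin n) :
    matrixCells B ((i : ℕ) : ℤ) ((j : ℕ) : ℤ) = B i j := by
  simp [matrixCells]

theorem matrixCells_of_le {n : ℕ} (B : Matrix (Fin n) (Fin n) ℤ) {i : ℕ} (hi : n ≤ i) (j : ℤ) :
    matrixCells B (i : ℤ) j = 0 := by
  rw [matrixCells, dif_neg]
  simp only [Int.toNat_natCast]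
  omega

/-- The data of the program for the given matrices. -/
def matrixEnv {n : ℕ} (f : ℕ) (S M H : Matrix (Fin n) (Fin n) ℤ) : Env where
  n := n
  f := f
  s l := matrixCells S l l
  h i := matrixCells (Matrix.diagonal fun i => H i i) i i
  M i l := matrixCells M i l

/-- The vector modulo `m` with coordinates `u` with respect to the columns of `B`. -/
def colVec {n m : ℕ} (B : Matrix (Fin n) (Fin n) (ZMod m)) (u : ℕ → ℤ) : Fin n → ZMod m :=
  B *ᵥ fun l => (u l : ZMod m)

section

variable {n : ℕ} (hn : 0 < n) {A S M H : Matrix (Fin n) (Fin n) ℤ}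

theorem matrixEnv_s (f : ℕ) (l : Fin n) : (matrixEnv f S M H).s l = S l l :=
  matrixCells_natCast S l l

theorem matrixEnv_h (f : ℕ) (i : Fin n) : (matrixEnv f S M H).h i = H i i := by
  refine (matrixCells_natCast _ i i).trans ?_
  simp

theorem matrixEnv_M (f : ℕ) (i l : Fin n) : (matrixEnv f S M H).M i l = M i l :=
  matrixCells_natCast M i l

theorem matrixEnv_valid (hS : IsSmithFormOf S A) (hM : IsReducedSmithMassager M A S)
    (hH : IsHermiteFormOf H A) {f : ℕ} (hf : f ≤ n)
    (hf1 : ∀ hf : f < n, S ⟨f, hf⟩ ⟨f, hf⟩ ≠ 1) : (matrixEnv f S M H).Valid := by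
  have mono : ∀ l l' : Fin n, l ≤ l' → S l l ≤ S l' l' := fun l l' h =>
    Int.le_of_dvd (hS.2.1 l') (hS.2.2.1 l l' h)
  constructor
  · exact hf
  · intro l h1 h2
    change l < n at h2
    change f ≤ l at h1
    rw [matrixEnv_s f ⟨l, h2⟩]
    have h3 := mono ⟨f, by omega⟩ ⟨l, h2⟩ h1
    have h4 := hf1 (by omega)
    have h5 := hS.2.1 ⟨f, by omega⟩
    omega
  · intro l l' h1 h2 h3
    change l' < n at h3
    rw [matrixEnv_s f ⟨l, by omega⟩, matrixEnv_s f ⟨l', h3⟩]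
    exact mono _ _ h2
  · intro i l hi h1 h2
    change l < n at h2
    change i < n at hi
    rw [matrixEnv_s f ⟨l, h2⟩, matrixEnv_M f ⟨i, hi⟩ ⟨l, h2⟩, hM.2]
    exact ⟨Int.emod_nonneg _ (hS.2.1 _).ne', Int.emod_lt_of_pos _ (hS.2.1 _)⟩
  · intro i hi
    change i < n at hi
    rw [matrixEnv_h f ⟨i, hi⟩]
    exact hH.1.2.1 _

theorem reduceMod_mul_starMatrix_apply {m : ℕ} (i l : Fin n) :
    reduceMod m (M * starMatrix hn S) i l = ((M i l * (lastEntry hn S / S l l) : ℤ) : ZMod m) := by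
  rw [reduceMod, Matrix.map_apply, mul_starMatrix_apply]

/-- Column `l` of `M S*` is annihilated by `s l`, so coordinate `l` may be reduced modulo `s l`. -/
theorem colVec_emod (hS : IsSmithFormOf S A) (f : ℕ) (w b : ℕ → ℤ) (q : ℤ) :
    colVec (reduceMod (lastEntry hn S).natAbs (M * starMatrix hn S))
      (fun l => (w l - q * b l) % (matrixEnv f S M H).s l) =
    colVec (reduceMod (lastEntry hn S).natAbs (M * starMatrix hn S)) w -
      q • colVec (reduceMod (lastEntry hn S).natAbs (M * starMatrix hn S)) b := by
  have hz := intCast_lastEntry_eq_zero hn hS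
  set m := (lastEntry hn S).natAbs
  ext i
  simp only [colVec, Matrix.mulVec, dotProduct, Pi.sub_apply, Pi.smul_apply]
  rw [Finset.smul_sum, ← Finset.sum_sub_distrib]
  refine Finset.sum_congr rfl fun l _ => ?_
  rw [reduceMod_mul_starMatrix_apply, matrixEnv_s, Int.emod_def, zsmul_eq_mul]
  have h1 : ((lastEntry hn S / S l l : ℤ) : ZMod m) * (S l l : ZMod m) = 0 := by
    rw [← Int.cast_mul, mul_comm, mul_div_lastEntry hn hS, hz]
  push_cast
  linear_combination (-(M i l : ZMod m) * (((w l - q * b l) / S l l : ℤ) : ZMod m)) * h1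

/-- Entry `i` is the fraction `y / s j` computed along the chain, in units of `1 / s`. Membership in
the step `i + 1` makes `h i` times it an integer, so the division in `Env.value` is exact and gives
the numerator over `h i`. -/
theorem value_spec (hS : IsSmithFormOf S A) (hH : IsHermiteFormOf H A) {f : ℕ} (i j : Fin n)
    (hfj : f ≤ j)
    {b : ℕ → ℤ} (rb : (matrixEnv f S M H).Red (j + 1) b)
    (hb : colVec (reduceMod (lastEntry hn S).natAbs (M * starMatrix hn S)) b ∈
      kerFrom H (lastEntry hn S).natAbs (i + 1)) :
    0 ≤ (matrixEnv f S M H).value i j b ∧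
      (matrixEnv f S M H).value i j b ≤ (matrixEnv f S M H).h i ∧
      colVec (reduceMod (lastEntry hn S).natAbs (M * starMatrix hn S)) b i =
        (((matrixEnv f S M H).value i j b * (lastEntry hn S / H i i) : ℤ) :
          ZMod (lastEntry hn S).natAbs) := by
  have hpos : ∀ l, f ≤ l → l < n → 0 < (matrixEnv f S M H).s l := fun l h1 h2 => by
    rw [matrixEnv_s f ⟨l, h2⟩]; exact hS.2.1 _
  have hk : f + (j - f + 1) ≤ n := by omega
  have hacc := chainAcc_nonneg_lt hpos b ((matrixEnv f S M H).M i) hk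
  have hmod := chainAcc_mul_modEq (sL := lastEntry hn S) hpos
    (fun l l' _ h2 h3 => by
      rw [matrixEnv_s f ⟨l, by omega⟩, matrixEnv_s f ⟨l', h3⟩]; exact hS.2.2.1 _ _ h2)
    (fun l _ h2 => by rw [matrixEnv_s f ⟨l, h2⟩]; exact dvd_lastEntry hn hS _)
    b ((matrixEnv f S M H).M i) hk
  rw [chainPrev_succ, show f + (j - f) = j by omega, show (j : ℕ) - f + 1 = j + 1 - f by omega]
    at hacc
  rw [chainPrev_succ, show f + (j - f) = j by omega, show (j : ℕ) - f + 1 = j + 1 - f by omega]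
    at hmod
  set y := chainAcc f (matrixEnv f S M H).s b ((matrixEnv f S M H).M i) (j + 1 - f) with hy
  have hyi : colVec (reduceMod (lastEntry hn S).natAbs (M * starMatrix hn S)) b i
      = ((y * (lastEntry hn S / S j j) : ℤ) : ZMod (lastEntry hn S).natAbs) := by
    have h1 : colVec (reduceMod (lastEntry hn S).natAbs (M * starMatrix hn S)) b i
        = ((∑ l ∈ Finset.Ico f (f + (j + 1 - f)), (matrixEnv f S M H).M i l *
          (lastEntry hn S / (matrixEnv f S M H).s l) * b l : ℤ) :
            ZMod (lastEntry hn S).natAbs) := by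
      have h2 : ∑ l ∈ Finset.Ico f (f + (j + 1 - f)), (matrixEnv f S M H).M i l *
          (lastEntry hn S / (matrixEnv f S M H).s l) * b l = ∑ l ∈ Finset.range n,
            (matrixEnv f S M H).M i l * (lastEntry hn S / (matrixEnv f S M H).s l) * b l := by
        refine Finset.sum_subset (fun l hl => ?_) fun l hl hl' => ?_
        · rw [Finset.mem_Ico] at hl; rw [Finset.mem_range]; omega
        · rw [Finset.mem_Ico] at hl'
          rw [rb.supp l (by change ¬ (f ≤ l ∧ _); omega), mul_zero]
      rw [h2, Finset.sum_range, Int.cast_sum, colVec, Matrix.mulVec, dotProduct]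
      refine Finset.sum_congr rfl fun l _ => ?_
      rw [reduceMod_mul_starMatrix_apply, matrixEnv_s, matrixEnv_M, ← Int.cast_mul]
    rw [h1]
    have h3 := hmod
    rw [← natAbs_lastEntry hn hS] at h3
    rw [← matrixEnv_s f j (S := S) (M := M) (H := H)]
    have h4 := (ZMod.intCast_eq_intCast_iff _ _ _).2 h3
    rw [natAbs_lastEntry hn hS] at h4
    exact h4.symm
  have hz : lastEntry hn S ∣ H i i * (y * (lastEntry hn S / S j j)) := by
    have h1 := hermite_mul_apply_eq_zero hH hb
    rw [hyi, ← Int.cast_mul, ZMod.intCast_zmod_eq_zero_iff_dvd, natAbs_lastEntry hn hS] at h1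
    exact h1
  rw [matrixEnv_s] at hacc
  obtain ⟨r1, r2, r3⟩ := mul_ediv_spec (hS.2.1 j) (dvd_lastEntry hn hS j)
    (Int.mul_ediv_cancel' (hermite_dvd_lastEntry hn hS hH i)) (lastEntry_pos hn hS)
    (hH.1.2.1 i) hacc.1 hacc.2 hz
  have hval : (matrixEnv f S M H).value i j b = y * H i i / S j j := by
    rw [Env.value, matrixEnv_s, matrixEnv_h]; rfl
  rw [hval, matrixEnv_h, hyi, r3]
  exact ⟨r1, r2.le, rfl⟩

end

/-! ### Correctness of the row and column loops. -/

/-- The abstract setting of the row loop: reduced vectors `u` represent elements `Y u` of a group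
that is filtered by the kernels of functionals `π i`, whose values are the multiples of `κ i`. -/
structure Model (e : Env) (E : Type*) [AddCommGroup E] where
  m : ℕ
  κ : ℕ → ℤ
  Y : (ℕ → ℤ) → E
  ker : ℕ → Submodule ℤ E
  π : ℕ → E →+ ZMod m
  Y_emod : ∀ w b q, Y (fun l => (w l - q * b l) % e.s l) = Y w - q • Y b
  Y_zero : Y (fun _ => 0) = 0
  mul_κ : ∀ i < e.n, e.h i * κ i = m
  κ_pos : ∀ i < e.n, 0 < κ i
  value_spec : ∀ i < e.n, ∀ j, e.f ≤ j → j < e.n → ∀ b, e.Red (j + 1) b → Y b ∈ ker (i + 1) →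
    0 ≤ e.value i j b ∧ e.value i j b ≤ e.h i ∧
      π i (Y b) = ((e.value i j b * κ i : ℤ) : ZMod m)
  exists_pivot : ∀ i < e.n, ∃ y ∈ ker (i + 1), π i y = (κ i : ZMod m)
  mem_ker : ∀ i < e.n, ∀ y, y ∈ ker i ↔ y ∈ ker (i + 1) ∧ π i y = 0

/-- Column `j` of array `r`. -/
def State.col (σ : State) (r j : ℕ) : ℕ → ℤ := fun l => σ.mem r l j

/-- Array `5` holds reduced generators of `ker t`. -/
structure Generates {e : Env} {E : Type*} [AddCommGroup E] (X : Model e E) (t : ℕ) (σ : State) :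
    Prop where
  red : ∀ j, e.f ≤ j → j < e.n → e.Red (j + 1) (σ.col 5 j)
  span : Submodule.span ℤ ((fun j => X.Y (σ.col 5 j)) '' Set.Ico e.f e.n) = X.ker t

/-- Column `i` of array `4` is a reduced pivot vector of row `i`. -/
structure IsPivot {e : Env} {E : Type*} [AddCommGroup E] (X : Model e E) (i : ℕ) (u : ℕ → ℤ) :
    Prop where
  red : e.Red e.n u
  mem : X.Y u ∈ X.ker (i + 1)
  eq : X.π i (X.Y u) = (X.κ i : ZMod X.m)

/-- The states agree on the variables below `d`, the arrays other than `4` and `5`, and on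
array `4` outside of column `i`. -/
structure Frame (d : ℕ) (i : ℕ) (σ τ : State) : Prop where
  vars : ∀ y < d, τ.vars y = σ.vars y
  mem : ∀ r, r ≠ 4 → r ≠ 5 → τ.mem r = σ.mem r
  col : ∀ i', i' ≠ i → τ.col 4 i' = σ.col 4 i'

theorem Frame.refl (d i : ℕ) (σ : State) : Frame d i σ σ :=
  ⟨fun _ _ => rfl, fun _ _ _ => rfl, fun _ _ => rfl⟩

theorem Frame.trans {d i : ℕ} {σ τ υ : State} (h : Frame d i σ τ) (h' : Frame d i τ υ) :
    Frame d i σ υ :=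
  ⟨fun y hy => (h'.vars y hy).trans (h.vars y hy),
    fun r h4 h5 => (h'.mem r h4 h5).trans (h.mem r h4 h5),
    fun x hy => (h'.col x hy).trans (h.col x hy)⟩

theorem Keep.frame {d i j : ℕ} {σ τ : State} (h : Keep d i j σ τ) : Frame d i σ τ :=
  ⟨h.vars, h.mem, fun i' hi' => funext fun l => h.mem4 l i' (by exact_mod_cast hi')⟩

theorem Env.Holds.frame {e : Env} {σ τ : State} (h : e.Holds σ) {d i : ℕ} (hd : 3 ≤ d)
    (hk : Frame d i σ τ) : e.Holds τ where
  n_eq := (hk.vars 0 (by omega)).trans h.n_eq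
  f_eq := (hk.vars 2 (by omega)).trans h.f_eq
  s_eq l := by rw [hk.mem 1 (by decide) (by decide)]; exact h.s_eq l
  M_eq i l := by rw [hk.mem 2 (by decide) (by decide)]; exact h.M_eq i l
  h_eq i := by rw [hk.mem 3 (by decide) (by decide)]; exact h.h_eq i

/-- The cost of the operations on column `j` for row `i`. -/
def Env.columnCost (e : Env) (i j : ℕ) : ℕ :=
  30 * e.area j + 230 * ((lg (e.h i) + e.width j) * lg (e.h i))

/-- The pairs always span the subgroup they spanned at the start of the row: generators already
treated have value `0`, later ones are untouched and have their original value `c j`. Moreover `w`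
is supported below the current `j`, so combining it with generator `j` keeps that generator
triangular. -/
theorem wp_columnLoop {e : Env} (hv : e.Valid) {E : Type*} [AddCommGroup E] (X : Model e E)
    {σ : State} (he : e.Holds σ) {i : ℕ} (hi : i < e.n) (v3 : σ.vars 3 = i)
    (v4 : σ.vars 4 = e.h i) (v5 : σ.vars 5 = e.f) (v7 : σ.vars 7 = e.h i)
    (h0 : σ.col 4 i = fun _ => 0) (hgen : Generates X (i + 1) σ) :
    Wp columnLoop σ fun τ t => (Frame 5 i σ τ ∧ IsPivot X i (τ.col 4 i) ∧ Generates X i τ) ∧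
      t ≤ ∑ j ∈ Finset.Ico e.f e.n, (e.columnCost i j + 2 * lg e.n) + 2 * lg e.n := by
  set c : ℕ → ℤ := fun j => e.value i j (σ.col 5 j) with hcdef
  have hY0 : ∀ j, e.f ≤ j → j < e.n → X.Y (σ.col 5 j) ∈ X.ker (i + 1) := fun j h1 h2 => by
    rw [← hgen.span]; exact Submodule.subset_span ⟨j, ⟨h1, h2⟩, rfl⟩
  have hc : ∀ j, e.f ≤ j → j < e.n → _ := fun j h1 h2 =>
    X.value_spec i hi j h1 h2 _ (hgen.red j h1 h2) (hY0 j h1 h2)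
  have main := wp_loop_count (b := .lt (.var 5) (.var 0)) (P := columnBody)
    (I := fun j τ => Frame 5 i σ τ ∧ τ.vars 5 = (j : ℕ) ∧ e.Red j (τ.col 4 i) ∧
      (∀ j', e.f ≤ j' → j' < e.n → e.Red (j' + 1) (τ.col 5 j')) ∧
      (∀ j', j ≤ j' → τ.col 5 j' = σ.col 5 j') ∧
      ∃ g, 0 ≤ g ∧ g ≤ e.h i ∧ τ.vars 7 = g ∧
        Submodule.span ℤ (insert (X.Y (τ.col 4 i), g)
          ((fun j' => (X.Y (τ.col 5 j'), if j' < j then 0 else c j')) '' Set.Ico e.f e.n)) =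
        Submodule.span ℤ (insert ((0 : E), e.h i)
          ((fun j' => (X.Y (σ.col 5 j'), c j')) '' Set.Ico e.f e.n)))
    (c := e.columnCost i) (d := 2 * lg e.n)
    (lo := e.f) (hi := e.n) hv.f_le ?step ?done (σ := σ) ?start
  case start =>
    refine ⟨Frame.refl _ _ _, v5, ⟨fun l h1 h2 => by omega, fun l _ => congrFun h0 l⟩, hgen.red,
      fun _ _ => rfl, e.h i, (hv.h_pos i hi).le, le_rfl, v7, ?_⟩
    rw [h0, X.Y_zero]
    congr 2
    refine Set.image_congr fun j' hj' => ?_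
    rw [if_neg (by have := hj'.1; omega)]
  case done =>
    rintro τ ⟨hk, h5, -⟩
    have h6 : τ.vars 0 = e.n := by rw [hk.vars 0 (by omega), he.n_eq]
    simp only [Test.Holds, Test.cost, Operand.val, h5, h6]
    exact ⟨lt_irrefl _, by omega⟩
  case step =>
    rintro j τ hj1 hj2 ⟨hk, h5, hw, hred, hsame, g, hg, hgh, h7, hP⟩
    have h6 : τ.vars 0 = e.n := by rw [hk.vars 0 (by omega), he.n_eq]
    have cj := lg_natCast_le (show j ≤ e.n by omega)
    refine ⟨?_, ?_, ?_⟩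
    · simp only [Test.Holds, Operand.val, h5, h6]; exact_mod_cast hj2
    · simp only [Test.cost, Operand.val, h5, h6]; omega
    · have hcj : e.value i j (τ.col 5 j) = c j := by rw [hsame j le_rfl]
      obtain ⟨hc1, hc2, -⟩ := hc j hj1 hj2
      -- During one Euclidean run only two pairs change, so the invariant is the subgroup spanned by
      -- these two.
      let Inv : (ℕ → ℤ) → ℤ → (ℕ → ℤ) → ℤ → Prop := fun w g' b c' =>
        Submodule.span ℤ {(X.Y w, g'), (X.Y b, c')} =
          Submodule.span ℤ {(X.Y (τ.col 4 i), g), (X.Y (τ.col 5 j), c j)}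
      refine Wp.mono (wp_columnBody hv (he.frame (by omega) hk) hi hj1 hj2
        (by rw [hk.vars 3 (by omega), v3]) (by rw [hk.vars 4 (by omega), v4]) h5
        (w := τ.col 4 i) (b := τ.col 5 j) h7 hg hgh (by rw [hcj]; exact hc1)
        (by rw [hcj]; exact hc2) (fun _ => rfl) (fun _ => rfl)
        (hw.mono hv (by omega) (by omega)) (hred j hj1 hj2) Inv ?_ ?_) ?_
      · intro w g' b c' h
        refine Eq.trans ?_ h
        rw [span_pair_euclid (X.Y w, g') (X.Y b, c') (g' / c'), X.Y_emod, Int.emod_def, mul_comm c']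
        rfl
      · change Submodule.span ℤ _ = _
        rw [hcj]
      · rintro υ t ⟨⟨hK, hυ5, w', b', g', hg', hgh', hυ7, hw', hb', redw, rb', hI⟩, ht⟩
        have e4 : υ.col 4 i = w' := funext hw'
        have e5 : υ.col 5 j = b' := funext hb'
        have e5' : ∀ j', j' ≠ j → υ.col 5 j' = τ.col 5 j' := fun j' hj' =>
          funext fun l => hK.mem5 l j' (by exact_mod_cast hj')
        refine ⟨⟨hk.trans hK.frame, hυ5, e4 ▸ redw, fun j' h1 h2 => ?_, fun j' h1 => ?_,
          g', hg', hgh', hυ7, ?_⟩, ht⟩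
        · by_cases h : j' = j
          · subst h; rw [e5]; exact rb'
          · rw [e5' j' h]; exact hred j' h1 h2
        · rw [e5' j' (by omega)]; exact hsame j' (by omega)
        · rw [← hP]
          refine span_insert_image_congr (j := j) ⟨hj1, hj2⟩ ?_ fun k hk hkj => ?_
          · rw [if_pos (Nat.lt_succ_self j), if_neg (lt_irrefl j), e4, e5]
            exact hI
          · rw [e5' k hkj]
            congr 1
            by_cases h : k < j
            · rw [if_pos h, if_pos (by omega)]
            · rw [if_neg h, if_neg (by omega)]
  refine Wp.mono main fun τ t h => ?_
  obtain ⟨⟨hk, -, hw, hred, -, g, hg, hgh, -, hP⟩, ht⟩ := h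
  have himg : (fun j' => (X.Y (τ.col 5 j'), if j' < e.n then 0 else c j')) '' Set.Ico e.f e.n =
      (fun j' => (X.Y (τ.col 5 j'), (0 : ℤ))) '' Set.Ico e.f e.n :=
    Set.image_congr fun j' hj' => by rw [if_pos hj'.2]
  rw [himg] at hP
  -- All generators now have value `0`: `w` is a pivot vector and the generators span the kernel of
  -- `π i`, which is the next step of the filtration.
  obtain ⟨r1, r2, r3⟩ := pivot_of_span_eq (X.π i) (X.mul_κ i hi) (X.κ_pos i hi)
    (Y₀ := fun j => X.Y (σ.col 5 j)) (Y := fun j => X.Y (τ.col 5 j)) hg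
    (fun j hj => (hc j hj.1 hj.2).2.2)
    (by rw [hgen.span]; exact X.exists_pivot i hi) hP
  refine ⟨⟨hk, ⟨hw, ?_, r2⟩, hred, ?_⟩, ht⟩
  · rw [← hgen.span]; exact r1
  · ext y
    rw [r3, hgen.span, X.mem_ker i hi]

/-- The cost of row `i`. -/
def Env.rowCost (e : Env) (i : ℕ) : ℕ :=
  ∑ j ∈ Finset.Ico e.f e.n, (e.columnCost i j + 2 * lg e.n) + 10 * lg e.n + 2 * lg (e.h i)

theorem wp_rowLoop {e : Env} (hv : e.Valid) {E : Type*} [AddCommGroup E] (X : Model e E)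
    {σ : State} (he : e.Holds σ) (v3 : σ.vars 3 = e.n)
    (h0 : ∀ i < e.n, σ.col 4 i = fun _ => 0) (hgen : Generates X e.n σ) :
    Wp rowLoop σ fun τ t => (∀ i < e.n, IsPivot X i (τ.col 4 i)) ∧
      t ≤ ∑ i ∈ Finset.range e.n, (e.rowCost i + 2 * lg e.n) + 2 * lg e.n := by
  have main := wp_loop_count (b := .lt (.lit 0) (.var 3)) (P := rowBody)
    (I := fun k τ => e.Holds τ ∧ τ.vars 3 = ((e.n - k : ℕ) : ℤ) ∧
      (∀ i < e.n - k, τ.col 4 i = fun _ => 0) ∧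
      (∀ i < e.n, e.n - k ≤ i → IsPivot X i (τ.col 4 i)) ∧ Generates X (e.n - k) τ)
    (c := fun k => e.rowCost (e.n - 1 - k)) (d := 2 * lg e.n)
    (lo := 0) (hi := e.n) (Nat.zero_le _) ?step ?done (σ := σ)
    ⟨he, by simpa using v3, by simpa using h0, fun i h1 h2 => by omega, by simpa using hgen⟩
  case done =>
    rintro τ ⟨-, h3, -⟩
    have n1 := one_le_lg e.n
    rw [Nat.sub_self] at h3
    simp only [Test.Holds, Test.cost, Operand.val, h3, Nat.cast_zero, lg_zero]
    exact ⟨lt_irrefl _, by omega⟩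
  case step =>
    rintro k τ - hk ⟨hτ, h3, hz, hpiv, hgen⟩
    obtain ⟨i, hi⟩ : ∃ i, e.n - k = i + 1 := ⟨e.n - k - 1, by omega⟩
    rw [hi] at h3 hz hpiv hgen
    have hi' : e.n - (k + 1) = i := by omega
    have hi'' : e.n - 1 - k = i := by omega
    have hin : i < e.n := by omega
    have n1 := one_le_lg e.n
    have ci := lg_natCast_le (show i ≤ e.n by omega)
    have ci1 := lg_natCast_le (show i + 1 ≤ e.n by omega)
    have cf := lg_natCast_le hv.f_le
    rw [hi', hi'']
    refine ⟨?_, ?_, ?_⟩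
    · simp only [Test.Holds, Operand.val, h3]; omega
    · simp only [Test.cost, Operand.val, h3, lg_zero]; omega
    · have h3' : τ.vars 3 - 1 = i := by rw [h3]; push_cast; ring
      have hh := hτ.h_eq i
      have h2 := hτ.f_eq
      simp only [rowBody, wp_seq, wp_op, wp_load, Operand.val, BinOp.eval, BinOp.cost]
      simp only [setVar_vars, setVar_mem, Nat.reduceEqDiff, if_true, if_false, h3', hh, h2,
        add_zero]
      set σ' := (((τ.setVar 3 (i : ℤ)).setVar 4 (e.h i)).setVar 7 (e.h i)).setVar 5 (e.f : ℤ)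
        with hσ'
      have hkeep : Keep 3 i 0 τ σ' := by
        rw [hσ']
        exact ((((Keep.refl 3 i 0 τ).setVar (by omega) _).setVar (by omega) _).setVar
          (by omega) _).setVar (by omega) _
      have hσ'h := hτ.keep le_rfl hkeep
      have hcol : ∀ r j, σ'.col r j = τ.col r j := fun r j => rfl
      refine Wp.mono (wp_columnLoop hv X hσ'h hin (by simp [hσ', setVar_vars])
        (by simp [hσ', setVar_vars]) (by simp [hσ', setVar_vars]) (by simp [hσ', setVar_vars])
        (by rw [hcol]; exact hz i (by omega)) ⟨hgen.red, hgen.span⟩) ?_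
      rintro υ t ⟨⟨hF, hP, hG⟩, ht⟩
      refine ⟨⟨hσ'h.frame (by omega) hF, ?_, fun i' hi' => ?_, fun i' h1 h2 => ?_, hG⟩, ?_⟩
      · rw [hF.vars 3 (by omega)]; simp [hσ', setVar_vars]
      · rw [hF.col i' (by omega), hcol]; exact hz i' (by omega)
      · by_cases h : i' = i
        · subst h; exact hP
        · rw [hF.col i' h, hcol]; exact hpiv i' h1 (by omega)
      · unfold Env.rowCost
        rw [h3, lg_one, lg_zero]
        omega
  refine Wp.mono main fun τ t h => ?_
  obtain ⟨⟨-, -, -, hpiv, -⟩, ht⟩ := h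
  refine ⟨fun i hi => hpiv i hi (by omega), ht.trans ?_⟩
  rw [← Finset.range_eq_Ico]
  -- Rows are treated in decreasing order, while the loop counts upwards.
  have := Finset.sum_range_reflect (fun i => e.rowCost i + 2 * lg e.n) e.n
  omega

theorem wp_initLoop {e : Env} (hv : e.Valid) {σ : State} (he : e.Holds σ) (v5 : σ.vars 5 = e.f)
    (h0 : ∀ l j : ℕ, σ.mem 5 l j = 0) :
    Wp initLoop σ fun τ t => (Frame 5 0 σ τ ∧ τ.mem 4 = σ.mem 4 ∧
      ∀ l j : ℕ, τ.mem 5 l j = if l = j ∧ e.f ≤ j ∧ j < e.n then 1 else 0) ∧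
      t ≤ (e.n + 1) * (8 * lg e.n) := by
  have n1 := one_le_lg e.n
  have main := wp_loop_count (b := .lt (.var 5) (.var 0)) (P := initBody)
    (I := fun j₀ τ => Frame 5 0 σ τ ∧ τ.mem 4 = σ.mem 4 ∧ τ.vars 5 = (j₀ : ℕ) ∧
      ∀ l j : ℕ, τ.mem 5 l j = if l = j ∧ e.f ≤ j ∧ j < j₀ then 1 else 0)
    (c := fun _ => 6 * lg e.n) (d := 2 * lg e.n) (lo := e.f) (hi := e.n) hv.f_le ?step ?done
    (σ := σ) ⟨Frame.refl _ _ _, rfl, v5, fun l j => by rw [h0, if_neg (by omega)]⟩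
  case done =>
    rintro τ ⟨hk, -, h5, -⟩
    have h6 : τ.vars 0 = e.n := by rw [hk.vars 0 (by omega), he.n_eq]
    simp only [Test.Holds, Test.cost, Operand.val, h5, h6]
    exact ⟨lt_irrefl _, by omega⟩
  case step =>
    rintro j τ hj1 hj2 ⟨hk, hm4, h5, hm5⟩
    have h6 : τ.vars 0 = e.n := by rw [hk.vars 0 (by omega), he.n_eq]
    have cj := lg_natCast_le (show j ≤ e.n by omega)
    refine ⟨?_, ?_, ?_⟩
    · simp only [Test.Holds, Operand.val, h5, h6]; exact_mod_cast hj2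
    · simp only [Test.cost, Operand.val, h5, h6]; omega
    · simp only [initBody, wp_seq, wp_op, wp_store, Operand.val, BinOp.eval, BinOp.cost,
        setMem_vars, h5]
      refine ⟨⟨⟨fun y hy => ?_, fun r h4 h5 => ?_, fun i' hi' => ?_⟩, ?_, ?_, fun l j' => ?_⟩, ?_⟩
      · rw [setVar_vars, if_neg (by omega)]; exact hk.vars y hy
      · rw [← hk.mem r h4 h5]; ext u v; simp [setVar_mem, setMem_mem, h5]
      · rw [← hk.col i' hi']; ext u; simp [State.col, setVar_mem, setMem_mem]
      · rw [← hm4]; ext u v; simp [setVar_mem, setMem_mem]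
      · simp [setVar_vars]
      · rw [setVar_mem, setMem_mem, hm5]
        simp only [true_and, Nat.cast_inj]
        by_cases h : l = j ∧ j' = j
        · rw [if_pos h, if_pos (by omega)]
        · rw [if_neg h]
          by_cases h' : l = j' ∧ e.f ≤ j' ∧ j' < j
          · rw [if_pos h', if_pos (by omega)]
          · rw [if_neg h', if_neg (by omega)]
      · rw [lg_one]; omega
  refine Wp.mono main fun τ t h => ?_
  obtain ⟨⟨hk, hm4, -, hm5⟩, ht⟩ := h
  refine ⟨⟨hk, hm4, hm5⟩, ht.trans ?_⟩
  rw [Finset.sum_const, Nat.card_Ico, smul_eq_mul, Nat.add_mul,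
    show 6 * lg (e.n : ℤ) + 2 * lg (e.n : ℤ) = 8 * lg (e.n : ℤ) by omega]
  have := Nat.mul_le_mul_right (8 * lg e.n) (Nat.sub_le e.n e.f)
  omega

/-- No bound test is needed: some diagonal cell with index at most `n` is different from `1`, since
the cell just outside the matrix holds `0`. -/
theorem wp_skipLoop {e : Env} (hf : e.f ≤ e.n) (h1 : ∀ l < e.f, e.s l = 1) (h2 : e.s e.f ≠ 1)
    {σ : State} (hs : ∀ l : ℕ, σ.mem 1 l l = e.s l) (v2 : σ.vars 2 = 0)
    (v11 : σ.vars 11 = e.s 0) :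
    Wp skipLoop σ fun τ t => (τ.mem = σ.mem ∧ τ.vars 0 = σ.vars 0 ∧ τ.vars 2 = e.f) ∧
      t ≤ (e.n + 1) * (5 * lg e.n + 2 * lg (e.s e.f)) := by
  have n1 := one_le_lg e.n
  have s1 := one_le_lg (e.s e.f)
  have hle : ∀ l ≤ e.f, lg (e.s l) ≤ lg (e.s e.f) := fun l hl => by
    rcases hl.eq_or_lt with h | h
    · rw [h]
    · rw [h1 l h, lg_one]; exact s1
  have main := wp_loop_count (b := .eq (.var 11) (.lit 1)) (P := skipBody)
    (I := fun l τ => τ.mem = σ.mem ∧ τ.vars 0 = σ.vars 0 ∧ τ.vars 2 = (l : ℕ) ∧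
      τ.vars 11 = e.s l)
    (c := fun _ => 4 * lg e.n + lg (e.s e.f)) (d := lg e.n + lg (e.s e.f)) (lo := 0) (hi := e.f)
    (Nat.zero_le _) ?step ?done (σ := σ) ⟨rfl, rfl, by simpa using v2, v11⟩
  case done =>
    rintro τ ⟨-, -, -, h11⟩
    simp only [Test.Holds, Test.cost, Operand.val, h11, lg_one]
    exact ⟨h2, by omega⟩
  case step =>
    rintro l τ - hl ⟨hm, hv0, hv2, h11⟩
    have c1 := lg_natCast_le (show l ≤ e.n by omega)
    have c2 := lg_natCast_le (show l + 1 ≤ e.n by omega)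
    have c3 := hle l hl.le
    have c4 := hle (l + 1) hl
    refine ⟨?_, ?_, ?_⟩
    · simp only [Test.Holds, Operand.val, h11]; exact h1 l hl
    · simp only [Test.cost, Operand.val, h11, lg_one]; omega
    · have hs' : τ.mem 1 ((l : ℤ) + 1) ((l : ℤ) + 1) = e.s (l + 1) := by
        rw [hm, ← hs]; push_cast; rfl
      simp only [skipBody, wp_seq, wp_op, wp_load, Operand.val, BinOp.eval, BinOp.cost,
        setVar_vars, setVar_mem, if_true, Nat.reduceEqDiff, if_false, hv2, hs']
      refine ⟨⟨hm, hv0, by push_cast; rfl, trivial⟩, ?_⟩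
      rw [lg_one]
      push_cast at c2
      omega
  refine Wp.mono main fun τ t h => ?_
  obtain ⟨⟨hm, hv0, hv2, -⟩, ht⟩ := h
  refine ⟨⟨hm, hv0, hv2⟩, ht.trans ?_⟩
  rw [Finset.sum_const, Nat.card_Ico, smul_eq_mul, Nat.add_mul, Nat.sub_zero]
  have := Nat.mul_le_mul_right (5 * lg e.n + 2 * lg (e.s e.f)) hf
  have h4 : 4 * lg e.n + lg (e.s e.f) + (lg e.n + lg (e.s e.f))
    = 5 * lg e.n + 2 * lg (e.s e.f) := by ring
  rw [h4]
  omega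

/-- The cost of the program. -/
def Env.totalCost (e : Env) : ℕ :=
  (e.n + 1) * (13 * lg e.n + 2 * lg (e.s e.f)) + 10 * lg e.n + lg (e.s e.f) +
    ∑ i ∈ Finset.range e.n, (e.rowCost i + 2 * lg e.n)

/-- The initial generators are unit vectors, that is, the columns of `M S*` with index at least `f`;
`hspan` says that they generate the whole kernel. -/
theorem wp_howellProgram {e : Env} (hv : e.Valid) {E : Type*} [AddCommGroup E] (X : Model e E)
    (h1 : ∀ l < e.f, e.s l = 1) (h2 : e.s e.f ≠ 1) {σ : State} (v0 : σ.vars 0 = e.n)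
    (v2 : σ.vars 2 = 0) (hs : ∀ l : ℕ, σ.mem 1 l l = e.s l)
    (hM : ∀ i l : ℕ, σ.mem 2 i l = e.M i l) (hh : ∀ i : ℕ, σ.mem 3 i i = e.h i)
    (h4 : σ.mem 4 = fun _ _ => 0) (h5 : σ.mem 5 = fun _ _ => 0)
    (hspan : Submodule.span ℤ ((fun j => X.Y (fun l => if l = j then 1 else 0)) ''
      Set.Ico e.f e.n) = X.ker e.n) :
    Wp howellProgram σ fun τ t => (∀ i < e.n, IsPivot X i (τ.col 4 i)) ∧ t ≤ e.totalCost := by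
  have n1 := one_le_lg e.n
  have s1 := one_le_lg (e.s e.f)
  have s0 : lg (e.s 0) ≤ lg (e.s e.f) := by
    rcases Nat.eq_zero_or_pos e.f with h | h
    · rw [h]
    · rw [h1 0 h, lg_one]; exact s1
  have cf := lg_natCast_le hv.f_le
  have hs0 : σ.mem 1 0 0 = e.s 0 := by simpa using hs 0
  rw [howellProgram]
  simp only [wp_seq, wp_op, wp_load, Operand.val, BinOp.eval, BinOp.cost, v2, hs0, add_zero]
  refine Wp.mono (wp_skipLoop hv.f_le h1 h2 (σ := σ.setVar 11 (e.s 0)) hs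
    (by simpa [setVar_vars] using v2) (by simp [setVar_vars])) ?_
  rintro τ t ⟨⟨hm, hv0, hv2⟩, ht⟩
  rw [setVar_mem] at hm
  rw [setVar_vars, if_neg (by decide), v0] at hv0
  simp only [hv2]
  have hτ : e.Holds (τ.setVar 5 (e.f : ℤ)) := by
    refine ⟨hv0, hv2, ?_, ?_, ?_⟩
    · rw [setVar_mem, hm]; exact hs
    · rw [setVar_mem, hm]; exact hM
    · rw [setVar_mem, hm]; exact hh
  refine Wp.mono (wp_initLoop hv hτ (by simp [setVar_vars])
    (fun l j => by rw [setVar_mem, hm, h5])) ?_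
  rintro υ u ⟨⟨hF, hm4, hm5⟩, hu⟩
  have hυ := hτ.frame (by omega) hF
  simp only [hυ.n_eq]
  have hυ' := hυ.keep le_rfl ((Keep.refl 3 0 0 υ).setVar le_rfl (e.n : ℤ))
  refine Wp.mono (wp_rowLoop hv X hυ' (by simp [setVar_vars]) (fun i _ => ?_) ⟨?_, ?_⟩) ?_
  · funext l
    change υ.mem 4 _ _ = 0
    rw [hm4, setVar_mem, hm, h4]
  · intro j hj1 hj2
    constructor
    · intro l hl1 hl2
      have := hv.two_le l hl1 (by omega)
      change 0 ≤ υ.mem 5 _ _ ∧ υ.mem 5 _ _ < _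
      rw [hm5]
      split_ifs <;> omega
    · intro l hl
      change υ.mem 5 _ _ = 0
      rw [hm5, if_neg (by omega)]
  · rw [← hspan]
    congr 1
    refine Set.image_congr fun j hj => ?_
    congr 1
    funext l
    change υ.mem 5 _ _ = _
    rw [hm5]
    have := hj.1
    have := hj.2
    by_cases h : l = j
    · rw [if_pos ⟨h, hj⟩, if_pos h]
    · rw [if_neg (fun h' => h h'.1), if_neg h]
  · rintro ω r ⟨hpiv, hr⟩
    refine ⟨hpiv, ?_⟩
    unfold Env.totalCost
    rw [lg_zero]
    have e1 : (e.n + 1) * (13 * lg e.n + 2 * lg (e.s e.f)) =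
      (e.n + 1) * (5 * lg e.n + 2 * lg (e.s e.f)) + (e.n + 1) * (8 * lg e.n) := by ring
    omega

/-! ### The total cost -/

/-- The total length of the nontrivial entries of the Smith form. -/
def Env.length (e : Env) : ℕ := ∑ l ∈ Finset.Ico e.f e.n, lg (e.s l)

/-- For `l ≤ j` one factor of `lg (s l) ^ 2` is replaced by `lg (s j)`. Summed over `j` this gives
the square of the total length; triangularity of the generators is used here. -/
theorem Env.area_le {e : Env} (hv : e.Valid) {j : ℕ} (hj : j < e.n) :
    e.area j ≤ lg (e.s j) * e.length + (e.n - e.f) * lg e.n := by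
  unfold Env.area Env.length
  rw [Finset.sum_add_distrib, Finset.sum_const, Nat.card_Ico, smul_eq_mul, Finset.mul_sum]
  refine Nat.add_le_add ?_ (Nat.mul_le_mul_right _ (by omega))
  refine (Finset.sum_le_sum (g := fun l => lg (e.s j) * lg (e.s l)) fun l hl => ?_).trans
    (Finset.sum_le_sum_of_subset (Finset.Ico_subset_Ico_right hj))
  rw [Finset.mem_Ico] at hl
  have h1 := hv.two_le l hl.1 (by omega)
  have h2 := hv.s_mono l j hl.1 (by omega) hj
  rw [pow_two]
  exact Nat.mul_le_mul_right _ (lg_le_lg_of_nonneg (by omega) h2)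

theorem Env.width_le {e : Env} {j : ℕ} (hj : j < e.n) :
    e.width j ≤ e.length + (e.n - e.f) * lg e.n := by
  unfold Env.width Env.length
  rw [Finset.sum_add_distrib, Finset.sum_const, Nat.card_Ico, smul_eq_mul]
  exact Nat.add_le_add (Finset.sum_le_sum_of_subset (Finset.Ico_subset_Ico_right hj))
    (Nat.mul_le_mul_right _ (by omega))

theorem Env.rowCost_le {e : Env} (hv : e.Valid) (i : ℕ) :
    e.rowCost i ≤ 30 * (e.length ^ 2 + (e.n - e.f) * ((e.n - e.f) * lg e.n)) +
      230 * ((e.n - e.f) * ((lg (e.h i) + (e.length + (e.n - e.f) * lg e.n)) * lg (e.h i))) +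
      2 * ((e.n - e.f) * lg e.n) + 10 * lg e.n + 2 * lg (e.h i) := by
  have h1 : ∑ j ∈ Finset.Ico e.f e.n, (e.columnCost i j + 2 * lg e.n) ≤
      ∑ j ∈ Finset.Ico e.f e.n, (30 * (lg (e.s j) * e.length) +
        (30 * ((e.n - e.f) * lg e.n) +
        230 * ((lg (e.h i) + (e.length + (e.n - e.f) * lg e.n)) * lg (e.h i)) + 2 * lg e.n)) := by
    refine Finset.sum_le_sum fun j hj => ?_
    rw [Finset.mem_Ico] at hj
    have a1 := Env.area_le hv hj.2
    have a2 := Nat.mul_le_mul_right (lg (e.h i))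
      (Nat.add_le_add_left (Env.width_le hj.2) (lg (e.h i)))
    unfold Env.columnCost
    omega
  conv_rhs at h1 =>
    rw [Finset.sum_add_distrib, ← Finset.mul_sum, ← Finset.sum_mul, Finset.sum_const, Nat.card_Ico,
      smul_eq_mul]
  change _ ≤ 30 * (e.length * e.length) + _ at h1
  unfold Env.rowCost
  refine (Nat.add_le_add_right (Nat.add_le_add_right h1 _) _).trans (le_of_eq ?_)
  ring

theorem Env.totalCost_le {e : Env} (hv : e.Valid) :
    e.totalCost ≤ (e.n + 1) * (13 * lg e.n + 2 * (e.length + 1)) + 10 * lg e.n + (e.length + 1) +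
      e.n * (30 * (e.length ^ 2 + (e.n - e.f) * ((e.n - e.f) * lg e.n)) +
        2 * ((e.n - e.f) * lg e.n) + 12 * lg e.n) +
      230 * ((e.n - e.f) * ∑ i ∈ Finset.range e.n, lg (e.h i) ^ 2) +
      230 * ((e.n - e.f) * (e.length + (e.n - e.f) * lg e.n) * ∑ i ∈ Finset.range e.n, lg (e.h i)) +
      2 * ∑ i ∈ Finset.range e.n, lg (e.h i) + (lg (e.s e.n) * (e.n + 4)) * 2 := by
  -- If `f = n`, then `s f` is read outside the matrix; the term `lg (e.s e.n)` covers this case.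
  have hs : lg (e.s e.f) ≤ e.length + lg (e.s e.n) := by
    rcases hv.f_le.eq_or_lt with h | h
    · rw [h]; omega
    · have : lg (e.s e.f) ≤ e.length := Finset.single_le_sum (f := fun l => lg (e.s l))
        (fun _ _ => Nat.zero_le _) (Finset.mem_Ico.2 ⟨le_rfl, h⟩)
      omega
  have h1 : ∑ i ∈ Finset.range e.n, (e.rowCost i + 2 * lg e.n) ≤
      ∑ i ∈ Finset.range e.n, ((30 * (e.length ^ 2 + (e.n - e.f) * ((e.n - e.f) * lg e.n)) +
        2 * ((e.n - e.f) * lg e.n) + 12 * lg e.n) + 230 * (e.n - e.f) * lg (e.h i) ^ 2 +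
        230 * ((e.n - e.f) * (e.length + (e.n - e.f) * lg e.n)) * lg (e.h i) + 2 * lg (e.h i)) := by
    refine Finset.sum_le_sum fun i _ => ?_
    refine (Nat.add_le_add_right (Env.rowCost_le hv i) _).trans (le_of_eq ?_)
    ring
  conv_rhs at h1 =>
    rw [Finset.sum_add_distrib, Finset.sum_add_distrib, Finset.sum_add_distrib, Finset.sum_const,
      Finset.card_range, smul_eq_mul, ← Finset.mul_sum, ← Finset.mul_sum, ← Finset.mul_sum]
  have h2 := Nat.mul_le_mul_left (e.n + 1)
    (Nat.add_le_add_left (Nat.mul_le_mul_left 2 hs) (13 * lg e.n))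
  unfold Env.totalCost
  refine (Nat.add_le_add (Nat.add_le_add (Nat.add_le_add_right h2 _) hs) h1).trans ?_
  have h3 := one_le_lg (e.s e.n)
  nlinarith [Nat.zero_le (e.n * lg (e.s e.n)), Nat.zero_le (lg (e.s e.n))]

theorem sum_log_le_logb_prod {n : ℕ} {a : ℕ → ℤ} (ha : ∀ i < n, 0 < a i) :
    ((∑ i ∈ Finset.range n, Nat.log 2 (a i).natAbs : ℕ) : ℝ) ≤
      Real.logb 2 ((∏ i ∈ Finset.range n, a i : ℤ) : ℝ) := by
  push_cast
  rw [Real.logb_prod _ _ fun i hi => by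
    have := ha i (Finset.mem_range.1 hi)
    exact_mod_cast this.ne']
  refine Finset.sum_le_sum fun i hi => ?_
  have h1 := ha i (Finset.mem_range.1 hi)
  have h2 := Real.natLog_le_logb (a i).natAbs 2
  have h3 : (((a i).natAbs : ℕ) : ℝ) = (a i : ℝ) := by
    rw [← Int.cast_natCast, Int.natAbs_of_nonneg h1.le]
  rw [h3] at h2
  exact_mod_cast h2

theorem sq_le_four_mul_two_pow (k : ℕ) : k ^ 2 ≤ 4 * 2 ^ k := by
  induction k with
  | zero => simp
  | succ k ih =>
    rcases Nat.lt_or_ge k 3 with h | h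
    · interval_cases k <;> norm_num
    · rw [pow_succ 2 k]; nlinarith

/-- If `k ^ 2 < n`, then `k log n ≤ 2 n` because `(log n) ^ 2 ≤ 4 n`. Otherwise `log n ≤ 2 log k ≤ 2
log x`. The remaining `k ≤ n` comes from the `+ 1` in `lg`. -/
theorem mul_lg_le {n k : ℕ} {x : ℝ} (hn : 0 < n) (hkn : k ≤ n) (hkx : (k : ℝ) ≤ x) :
    (k : ℝ) * lg (n : ℤ) ≤ 3 * n * log1 x := by
  have hl1 : 1 ≤ log1 x := le_max_left _ _
  have hkn' : (k : ℝ) ≤ n := by exact_mod_cast hkn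
  have hlg : ((lg (n : ℤ) : ℕ) : ℝ) = (Nat.log 2 n : ℝ) + 1 := by simp [lg]
  have hk0 : (0 : ℝ) ≤ k := Nat.cast_nonneg k
  have hn0 : (0 : ℝ) ≤ n := Nat.cast_nonneg n
  have key : (k : ℝ) * Nat.log 2 n ≤ 2 * n * log1 x := by
    rcases Nat.lt_or_ge (k ^ 2) n with h | h
    · have h1 : (k * Nat.log 2 n) ^ 2 ≤ (2 * n) ^ 2 := by
        have h2 := (sq_le_four_mul_two_pow (Nat.log 2 n)).trans
          (Nat.mul_le_mul_left 4 (Nat.pow_log_le_self 2 hn.ne'))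
        calc (k * Nat.log 2 n) ^ 2 = k ^ 2 * (Nat.log 2 n) ^ 2 := by ring
          _ ≤ n * (4 * n) := Nat.mul_le_mul h.le h2
          _ = _ := by ring
      have h3 : k * Nat.log 2 n ≤ 2 * n := (Nat.pow_le_pow_iff_left two_ne_zero).1 h1
      have h4 : (k : ℝ) * Nat.log 2 n ≤ 2 * n := by exact_mod_cast h3
      nlinarith
    · have hkpos : 0 < k := by
        rcases Nat.eq_zero_or_pos k with h0 | h0
        · subst h0; simp at h; omega
        · exact h0
      have h1 : (Nat.log 2 n : ℝ) ≤ 2 * log1 x := by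
        have h2 := Real.natLog_le_logb n 2
        have h3 : Real.logb 2 n ≤ Real.logb 2 ((k : ℝ) ^ 2) :=
          Real.logb_le_logb_of_le (by norm_num) (by exact_mod_cast hn) (by exact_mod_cast h)
        have h4 : Real.logb 2 ((k : ℝ) ^ 2) = 2 * Real.logb 2 k := by
          rw [Real.logb_pow]; norm_num
        have h5 : Real.logb 2 k ≤ Real.logb 2 x :=
          Real.logb_le_logb_of_le (by norm_num) (by exact_mod_cast hkpos) hkx
        have h6 : Real.logb 2 x ≤ log1 x := le_max_right _ _
        push_cast at h2
        linarith
      nlinarith [mul_le_mul hkn' h1 (Nat.cast_nonneg _) hn0]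
  rw [hlg]
  nlinarith

theorem lg_natCast_le_self {n : ℕ} (hn : 0 < n) : lg (n : ℤ) ≤ n :=
  lg_le_of_natAbs_lt hn (by simpa using Nat.lt_two_pow_self)

/-- The numerical form of the cost estimate. -/
theorem real_cost_le {n k L N q p x y : ℝ} (hn : 1 ≤ n) (hx : 1 ≤ x) (hy : 1 ≤ y) (hk : 0 ≤ k)
    (hkn : k ≤ n) (hkx : k ≤ x) (hL0 : 0 ≤ L) (hL : L ≤ 2 * x) (hN0 : 0 ≤ N) (hN : N ≤ n)
    (hkN : k * N ≤ 3 * n * y) (hq : q ≤ n + 3 * x ^ 2) (hp : p ≤ n + x) :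
    (n + 1) * (13 * N + 2 * (L + 1)) + 10 * N + (L + 1) +
      n * (30 * (L ^ 2 + k * (k * N)) + 2 * (k * N) + 12 * N) + 230 * (k * q) +
      230 * (k * (L + k * N) * p) + 2 * p + (n + 4) * 2 ≤
      5000 * (n * x ^ 2 + n ^ 2 * x * y) := by
  set P := n * x ^ 2
  set Q := n ^ 2 * x * y
  have hxy : 1 ≤ x * y := one_le_mul_of_one_le_of_one_le hx hy
  have b1 : n ^ 2 ≤ Q := by
    have : n ^ 2 * 1 ≤ n ^ 2 * (x * y) := mul_le_mul_of_nonneg_left hxy (by positivity)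
    simp only [Q]; linarith
  have b2 : n ≤ n ^ 2 := by nlinarith
  have b3 : n ^ 2 * y ≤ Q := by
    have : n ^ 2 * y * 1 ≤ n ^ 2 * y * x := mul_le_mul_of_nonneg_left hx (by positivity)
    simp only [Q]; linarith
  have b4 : n * x ≤ P := by
    have : n * x * 1 ≤ n * x * x := mul_le_mul_of_nonneg_left hx (by positivity)
    simp only [P]; linarith
  have b5 : x ≤ n * x := by nlinarith
  have d1 : (n + 1) * (13 * N + 2 * (L + 1)) ≤ (2 * n) * (13 * n + 2 * (2 * x + 1)) :=
    mul_le_mul (by linarith) (by linarith) (by positivity) (by linarith)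
  have hkkN0 : 0 ≤ k * N := mul_nonneg hk hN0
  have d2 : L ^ 2 ≤ (2 * x) ^ 2 := pow_le_pow_left₀ hL0 hL 2
  have d3 : k * (k * N) ≤ x * (3 * n * y) := mul_le_mul hkx hkN hkkN0 (by linarith)
  have d4 : n * (30 * (L ^ 2 + k * (k * N)) + 2 * (k * N) + 12 * N) ≤
      n * (30 * ((2 * x) ^ 2 + x * (3 * n * y)) + 2 * (3 * n * y) + 12 * n) :=
    mul_le_mul_of_nonneg_left (by linarith) (by linarith)
  have d5 : k * q ≤ n * (n + 3 * x ^ 2) :=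
    (mul_le_mul_of_nonneg_left hq hk).trans (mul_le_mul_of_nonneg_right hkn (by positivity))
  have d6 : k * L ≤ x * (2 * x) := mul_le_mul hkx hL hL0 (by linarith)
  have d7 : k * L ≤ n * (2 * x) := mul_le_mul hkn hL hL0 (by linarith)
  have d8 : k * (k * N) ≤ n * (3 * n * y) := mul_le_mul hkn hkN hkkN0 (by linarith)
  -- The product is split along `p ≤ n + x`: the part with `n` is bounded with `k ≤ x`, the part
  -- with `x` with `k ≤ n`. Each is then at most `2 P + 3 Q`.
  have e1 : k * (L + k * N) * p ≤ k * (L + k * N) * n + k * (L + k * N) * x := by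
    rw [← mul_add]; exact mul_le_mul_of_nonneg_left hp (by positivity)
  have e2 : k * (L + k * N) * n ≤ (x * (2 * x) + x * (3 * n * y)) * n :=
    mul_le_mul_of_nonneg_right (by linarith) (by linarith)
  have e3 : k * (L + k * N) * x ≤ (n * (2 * x) + n * (3 * n * y)) * x :=
    mul_le_mul_of_nonneg_right (by linarith) (by linarith)
  have f1 : (2 * n) * (13 * n + 2 * (2 * x + 1)) = 26 * n ^ 2 + 8 * (n * x) + 4 * n := by ring
  have f2 : n * (30 * ((2 * x) ^ 2 + x * (3 * n * y)) + 2 * (3 * n * y) + 12 * n)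
      = 120 * P + 90 * Q + 6 * (n ^ 2 * y) + 12 * n ^ 2 := by simp only [P, Q]; ring
  have f3 : n * (n + 3 * x ^ 2) = n ^ 2 + 3 * P := by simp only [P]; ring
  have f4 : (x * (2 * x) + x * (3 * n * y)) * n = 2 * P + 3 * Q := by simp only [P, Q]; ring
  have f5 : (n * (2 * x) + n * (3 * n * y)) * x = 2 * P + 3 * Q := by simp only [P, Q]; ring
  rw [f1] at d1
  rw [f2] at d4
  rw [f3] at d5
  rw [f4] at e2
  rw [f5] at e3
  linarith

theorem totalCost_le_costBound {e : Env} (hv : e.Valid) (hn : 0 < e.n) (hsn : lg (e.s e.n) = 1)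
    {D : ℝ} (hS : ((∑ i ∈ Finset.range e.n, Nat.log 2 (e.s i).natAbs : ℕ) : ℝ) ≤ Real.logb 2 D)
    (hH : ((∑ i ∈ Finset.range e.n, Nat.log 2 (e.h i).natAbs : ℕ) : ℝ) ≤ Real.logb 2 D) :
    (e.totalCost : ℝ) ≤ 5000 * costBound e.n D := by
  have hx1 : 1 ≤ log1 D := le_max_left _ _
  have hxD : Real.logb 2 D ≤ log1 D := le_max_right _ _
  have hlog : ∀ l ∈ Finset.Ico e.f e.n, 1 ≤ Nat.log 2 (e.s l).natAbs := by
    intro l hl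
    rw [Finset.mem_Ico] at hl
    have := hv.two_le l hl.1 hl.2
    exact Nat.log_pos (by norm_num) (by omega)
  have hsub : ∑ l ∈ Finset.Ico e.f e.n, Nat.log 2 (e.s l).natAbs ≤
      ∑ i ∈ Finset.range e.n, Nat.log 2 (e.s i).natAbs := by
    rw [Finset.range_eq_Ico]
    exact Finset.sum_le_sum_of_subset (Finset.Ico_subset_Ico_left (Nat.zero_le _))
  have hsub' : ((∑ l ∈ Finset.Ico e.f e.n, Nat.log 2 (e.s l).natAbs : ℕ) : ℝ) ≤ log1 D :=
    (Nat.cast_le.2 hsub).trans (hS.trans hxD)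
  -- Every entry of the Smith form from `f` on is at least `2`, so it contributes at least one bit
  -- to `log₂ D`.
  have hk : e.n - e.f ≤ ∑ l ∈ Finset.Ico e.f e.n, Nat.log 2 (e.s l).natAbs := by
    have := Finset.sum_le_sum hlog
    simpa using this
  have hkx : ((e.n - e.f : ℕ) : ℝ) ≤ log1 D := (Nat.cast_le.2 hk).trans hsub'
  have hL : (e.length : ℝ) ≤ 2 * log1 D := by
    have h1 : e.length ≤ 2 * ∑ l ∈ Finset.Ico e.f e.n, Nat.log 2 (e.s l).natAbs := by
      rw [Finset.mul_sum]
      refine Finset.sum_le_sum fun l hl => ?_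
      have := hlog l hl
      unfold lg
      omega
    have h2 : (e.length : ℝ) ≤
        2 * ((∑ l ∈ Finset.Ico e.f e.n, Nat.log 2 (e.s l).natAbs : ℕ) : ℝ) := by exact_mod_cast h1
    linarith
  set T := ∑ i ∈ Finset.range e.n, Nat.log 2 (e.h i).natAbs with hT
  have hTx : (T : ℝ) ≤ log1 D := hH.trans hxD
  have hp : ∑ i ∈ Finset.range e.n, lg (e.h i) = T + e.n := by
    unfold lg
    rw [Finset.sum_add_distrib]
    simp [hT]
  have hq : ∑ i ∈ Finset.range e.n, lg (e.h i) ^ 2 ≤ e.n + 3 * T ^ 2 := by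
    have h1 : ∑ i ∈ Finset.range e.n, lg (e.h i) ^ 2 ≤
        ∑ i ∈ Finset.range e.n, (1 + 3 * (Nat.log 2 (e.h i).natAbs) ^ 2) := by
      refine Finset.sum_le_sum fun i _ => ?_
      unfold lg
      nlinarith [Nat.le_self_pow (two_ne_zero) (Nat.log 2 (e.h i).natAbs)]
    rw [Finset.sum_add_distrib, ← Finset.mul_sum] at h1
    have h2 : ∑ i ∈ Finset.range e.n, (Nat.log 2 (e.h i).natAbs) ^ 2 ≤ T ^ 2 :=
      Finset.sum_sq_le_sq_sum_of_nonneg (fun _ _ => Nat.zero_le _)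
    simp only [Finset.sum_const, Finset.card_range, smul_eq_mul, mul_one] at h1
    omega
  have hq' : ((∑ i ∈ Finset.range e.n, lg (e.h i) ^ 2 : ℕ) : ℝ) ≤ e.n + 3 * log1 D ^ 2 := by
    have h1 : ((∑ i ∈ Finset.range e.n, lg (e.h i) ^ 2 : ℕ) : ℝ) ≤ e.n + 3 * (T : ℝ) ^ 2 := by
      exact_mod_cast hq
    have h2 : (T : ℝ) ^ 2 ≤ log1 D ^ 2 := pow_le_pow_left₀ (Nat.cast_nonneg _) hTx 2
    linarith
  have hp' : ((∑ i ∈ Finset.range e.n, lg (e.h i) : ℕ) : ℝ) ≤ e.n + log1 D := by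
    rw [hp]; push_cast; linarith
  have h1 := Nat.cast_le (α := ℝ) |>.2 (Env.totalCost_le hv)
  rw [hsn, one_mul] at h1
  refine h1.trans ?_
  unfold costBound
  have hkn : ((e.n - e.f : ℕ) : ℝ) ≤ e.n := Nat.cast_le.2 (Nat.sub_le _ _)
  have hmain := real_cost_le (n := e.n) (k := ((e.n - e.f : ℕ) : ℝ)) (L := e.length)
    (N := lg (e.n : ℤ)) (x := log1 D) (y := log1 (log1 D)) (by exact_mod_cast hn) hx1
    (le_max_left _ _) (Nat.cast_nonneg _) hkn hkx (Nat.cast_nonneg _) hL (Nat.cast_nonneg _)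
    (by exact_mod_cast lg_natCast_le_self hn) (mul_lg_le hn (Nat.sub_le _ _) hkx) hq'
    hp'
  exact_mod_cast hmain

/-! ### Assembly for the given matrices. -/

section

variable {n : ℕ} (hn : 0 < n) {A S M H : Matrix (Fin n) (Fin n) ℤ}

/-- The setting of the row loop for the given matrices. -/
def matrixModel (hS : IsSmithFormOf S A) (hH : IsHermiteFormOf H A) (f : ℕ) :
    Model (matrixEnv f S M H) (Fin n → ZMod (lastEntry hn S).natAbs) where
  m := (lastEntry hn S).natAbs
  κ i := lastEntry hn S / (matrixEnv f S M H).h i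
  Y := colVec (reduceMod (lastEntry hn S).natAbs (M * starMatrix hn S))
  ker := kerFrom H (lastEntry hn S).natAbs
  π i := if h : i < n then Pi.evalAddMonoidHom _ ⟨i, h⟩ else 0
  Y_emod := colVec_emod hn hS f
  Y_zero := by ext i; simp [colVec, Matrix.mulVec, dotProduct]
  mul_κ i hi := by
    have hh : (matrixEnv f S M H).h i = _ := matrixEnv_h f ⟨i, hi⟩
    rw [hh, natAbs_lastEntry hn hS]
    exact Int.mul_ediv_cancel' (hermite_dvd_lastEntry hn hS hH _)
  κ_pos i hi := by
    have hh : (matrixEnv f S M H).h i = _ := matrixEnv_h f ⟨i, hi⟩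
    rw [hh]
    exact Int.ediv_pos_of_pos_of_dvd (lastEntry_pos hn hS) (hH.1.2.1 _).le
      (hermite_dvd_lastEntry hn hS hH _)
  value_spec i hi j hfj hj b rb hb := by
    have hi' : i < n := hi
    rw [dif_pos hi']
    have := value_spec hn hS hH ⟨i, hi⟩ ⟨j, hj⟩ hfj rb hb
    rw [← matrixEnv_h f ⟨i, hi⟩ (S := S) (M := M) (H := H)] at this
    exact this
  exists_pivot i hi := by
    have hi' : i < n := hi
    have hh : (matrixEnv f S M H).h i = _ := matrixEnv_h f ⟨i, hi⟩
    rw [dif_pos hi', hh]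
    exact exists_kerFrom_apply_eq hn hS hH ⟨i, hi⟩
  mem_ker i hi y := by
    have hi' : i < n := hi
    rw [dif_pos hi']
    constructor
    · intro hy
      exact ⟨⟨hy.1, fun l hl => hy.2 l (by omega)⟩, hy.2 ⟨i, hi⟩ le_rfl⟩
    · rintro ⟨hy, hyi⟩
      refine ⟨hy.1, fun l hl => ?_⟩
      rcases hl.eq_or_lt with h | h
      · have : l = ⟨i, hi⟩ := Fin.ext h.symm
        subst this
        exact hyi
      · exact hy.2 l h

theorem colVec_single {m : ℕ} (B : Matrix (Fin n) (Fin n) (ZMod m)) (j : Fin n) :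
    colVec B (fun l => if l = j then 1 else 0) = fun i => B i j := by
  ext i
  simp [colVec, Matrix.mulVec, dotProduct, Fin.val_inj]

/-- Columns of `M S*` before `f` are multiples of `s`, hence zero, so the remaining ones already
span the kernel. -/
theorem span_columns_eq_kerFrom (hS : IsSmithFormOf S A) (hM : IsSmithMassager M A S)
    (hH : IsHermiteFormOf H A) {f : ℕ} (hf : ∀ l : Fin n, (l : ℕ) < f → S l l = 1) :
    Submodule.span ℤ ((fun j : ℕ => colVec (reduceMod (lastEntry hn S).natAbs
      (M * starMatrix hn S)) (fun l => if l = j then 1 else 0)) '' Set.Ico f n) =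
    kerFrom H (lastEntry hn S).natAbs n := by
  have hz := intCast_lastEntry_eq_zero hn hS
  apply le_antisymm
  · rw [Submodule.span_le]
    rintro _ ⟨j, -, rfl⟩
    refine ⟨?_, fun l hl => absurd l.2 (by omega)⟩
    simp only [colVec]
    rw [Matrix.mulVec_mulVec, reduceMod_hermite_mul hn hS hM hH, Matrix.zero_mulVec]
  · rintro y ⟨hy, -⟩
    obtain ⟨u, rfl⟩ := exists_mulVec_eq_of_hermite_mulVec_eq_zero hn hS hM hH y hy
    obtain ⟨v, rfl⟩ := exists_intCast_eq u
    have hsum : reduceMod (lastEntry hn S).natAbs (M * starMatrix hn S) *ᵥ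
        (fun i => (v i : ZMod (lastEntry hn S).natAbs)) =
        ∑ l, v l • fun i => reduceMod (lastEntry hn S).natAbs (M * starMatrix hn S) i l := by
      ext i
      simp [Matrix.mulVec, dotProduct, mul_comm]
    rw [hsum]
    refine Submodule.sum_mem _ fun l _ => Submodule.smul_mem _ _ ?_
    by_cases hl : (l : ℕ) < f
    · have : (fun i => reduceMod (lastEntry hn S).natAbs (M * starMatrix hn S) i l) = 0 := by
        ext i
        rw [reduceMod_mul_starMatrix_apply, hf l hl, Int.ediv_one, Int.cast_mul, hz, mul_zero]
        rfl
      rw [this]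
      exact Submodule.zero_mem _
    · exact Submodule.subset_span ⟨l, ⟨by omega, l.2⟩, colVec_single _ l⟩

/-- Pivot vectors in all columns of the output give a Howell form. -/
theorem isHowellFormOf_outputMatrix (hS : IsSmithFormOf S A) (hM : IsSmithMassager M A S)
    (hH : IsHermiteFormOf H A) {f : ℕ} {τ : State}
    (hpiv : ∀ i < n, IsPivot (matrixModel (M := M) hn hS hH f) i (τ.col 4 i)) :
    IsHowellFormOf
      (reduceMod (lastEntry hn S).natAbs (M * starMatrix hn S * outputMatrix n τ))
      (reduceMod (lastEntry hn S).natAbs (M * starMatrix hn S)) := by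
  have hcol : ∀ i : Fin n, (fun l => reduceMod (lastEntry hn S).natAbs
      (M * starMatrix hn S * outputMatrix n τ) l i) =
      colVec (reduceMod (lastEntry hn S).natAbs (M * starMatrix hn S)) (τ.col 4 i) := by
    intro i
    rw [reduceMod_mul]
    rfl
  refine isHowellFormOf_of_kerFrom hn hS hM hH _ (fun i => ?_) fun i => ?_
  · rw [hcol i]
    exact (hpiv i i.2).mem
  · have h1 : (if h : (i : ℕ) < n then Pi.evalAddMonoidHom
        (fun _ : Fin n => ZMod (lastEntry hn S).natAbs) ⟨i, h⟩ else 0)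
        (colVec (reduceMod (lastEntry hn S).natAbs (M * starMatrix hn S)) (τ.col 4 i)) =
        ((lastEntry hn S / (matrixEnv f S M H).h i : ℤ) : ZMod (lastEntry hn S).natAbs) :=
      (hpiv i i.2).eq
    rw [dif_pos i.2, matrixEnv_h] at h1
    exact (congrFun (hcol i) i).trans h1

theorem outputMatrix_eq_rowmod {f : ℕ} {τ : State}
    (hred : ∀ i < n, (matrixEnv f S M H).Red n (τ.col 4 i)) :
    outputMatrix n τ = rowmod (outputMatrix n τ) S := by
  ext l i
  have h := hred i i.2
  change τ.col 4 i l = τ.col 4 i l % S l l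
  by_cases hl : f ≤ l
  · have := h.bound l hl l.2
    rw [matrixEnv_s] at this
    rw [Int.emod_eq_of_lt this.1 this.2]
  · rw [h.supp l (fun h' => hl h'.1), Int.zero_emod]

/-- The program computes the transformation to a Howell form within the cost bound. -/
theorem howellProgram_spec (hS : IsSmithFormOf S A) (hM : IsReducedSmithMassager M A S)
    (hH : IsHermiteFormOf H A) (p : ℕ) :
    ∃ (τ : State) (t : ℕ), Exec howellProgram (inputState A S M (fun i => H i i) p) τ t ∧
      outputMatrix n τ = rowmod (outputMatrix n τ) S ∧
      IsHowellFormOf (reduceMod (lastEntry hn S).natAbs (M * starMatrix hn S * outputMatrix n τ))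
        (reduceMod (lastEntry hn S).natAbs (M * starMatrix hn S)) ∧
      (t : ℝ) ≤ 5000 * costBound n (S.det : ℝ) := by
  classical
  have hsn : matrixCells S (n : ℤ) (n : ℤ) = 0 := matrixCells_of_le S le_rfl _
  -- The zero cell just outside the matrix guarantees that `f` exists even when `S` is the identity;
  -- then `f = n`.
  have hex : ∃ l : ℕ, matrixCells S (l : ℤ) (l : ℤ) ≠ 1 := ⟨n, by rw [hsn]; decide⟩
  obtain ⟨f, hf, hmin⟩ : ∃ f : ℕ, matrixCells S (f : ℤ) (f : ℤ) ≠ 1 ∧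
      ∀ l < f, matrixCells S (l : ℤ) (l : ℤ) = 1 :=
    ⟨Nat.find hex, Nat.find_spec hex, fun l hl => not_not.1 (Nat.find_min hex hl)⟩
  have hfn : f ≤ n := by
    by_contra h
    have := hmin n (by omega)
    rw [hsn] at this
    exact absurd this (by decide)
  have hv : (matrixEnv f S M H).Valid := matrixEnv_valid hS hM hH hfn fun hlt => by
    rw [← matrixCells_natCast S ⟨f, hlt⟩]; exact hf
  obtain ⟨τ, t, hexec, hpiv, ht⟩ := wp_howellProgram hv (matrixModel hn hS hH f) hmin hf
    (σ := inputState A S M (fun i => H i i) p) rfl rfl (fun _ => rfl) (fun _ _ => rfl)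
    (fun _ => rfl) rfl rfl (span_columns_eq_kerFrom hn hS hM.1 hH fun l hl => by
      rw [← matrixCells_natCast S l l]; exact hmin l hl)
  refine ⟨τ, t, hexec, outputMatrix_eq_rowmod (f := f) (M := M) (H := H)
    fun i hi => (hpiv i hi).red, isHowellFormOf_outputMatrix hn hS hM.1 hH hpiv,
    (Nat.cast_le.2 ht).trans (totalCost_le_costBound hv hn ?_ ?_ ?_)⟩
  · change lg (matrixCells S (n : ℤ) (n : ℤ)) = 1
    rw [hsn, lg_zero]
  · have h1 := sum_log_le_logb_prod (n := n) (a := (matrixEnv f S M H).s) fun i hi => by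
      rw [matrixEnv_s f ⟨i, hi⟩]; exact hS.2.1 _
    rw [Finset.prod_range, Finset.prod_congr rfl fun i _ => matrixEnv_s f i,
      ← det_smith_eq_prod hS] at h1
    exact h1
  · have h1 := sum_log_le_logb_prod (n := n) (a := (matrixEnv f S M H).h) fun i hi => by
      rw [matrixEnv_h f ⟨i, hi⟩]; exact hH.1.2.1 _
    rw [Finset.prod_range, Finset.prod_congr rfl fun i _ => matrixEnv_h f i,
      ← det_smith_eq_prod_hermite hS hH] at h1
    exact h1

end

end HermiteHowell

theorem mainTheorem7 :
    ∃ P : HermiteHowell.Cmd, ∀ c₁ c₂ : ℝ, 0 < c₁ → 0 < c₂ → ∃ C : ℝ,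
      ∀ (n : ℕ) (hn : 0 < n) (A S M H : Matrix (Fin n) (Fin n) ℤ) (p : ℕ),
        A.det ≠ 0 →
        HermiteHowell.IsSmithFormOf S A →
        HermiteHowell.IsReducedSmithMassager M A S →
        HermiteHowell.IsHermiteFormOf H A →
        p.Prime →
        IsCoprime (p : ℤ) (HermiteHowell.lastEntry hn S) →
        c₁ * HermiteHowell.log1 (HermiteHowell.log1 (HermiteHowell.lastEntry hn S : ℝ))
          ≤ Real.logb 2 (p : ℝ) →
        Real.logb 2 (p : ℝ)
          ≤ c₂ * HermiteHowell.log1 (HermiteHowell.log1 (HermiteHowell.lastEntry hn S : ℝ)) →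
        ∃ (τ : HermiteHowell.State) (t : ℕ) (U : Matrix (Fin n) (Fin n) ℤ),
          HermiteHowell.Exec P (HermiteHowell.inputState A S M (fun i => H i i) p) τ t ∧
          HermiteHowell.outputMatrix n τ = U ∧
          U = HermiteHowell.rowmod U S ∧
          HermiteHowell.IsHowellFormOf
            (HermiteHowell.reduceMod (HermiteHowell.lastEntry hn S).natAbs
              (M * HermiteHowell.starMatrix hn S * U))
            (HermiteHowell.reduceMod (HermiteHowell.lastEntry hn S).natAbs
              (M * HermiteHowell.starMatrix hn S)) ∧
          (t : ℝ) ≤ C * HermiteHowell.costBound n (S.det : ℝ) := by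
  refine ⟨HermiteHowell.howellProgram, fun _ _ _ _ => ⟨5000, ?_⟩⟩
  intro n hn A S M H p _ hS hM hH _ _ _ _
  obtain ⟨τ, t, hexec, hrow, hhow, ht⟩ := HermiteHowell.howellProgram_spec hn hS hM hH p
  exact ⟨τ, t, HermiteHowell.outputMatrix n τ, hexec, rfl, hrow, hhow, ht⟩
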